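/- **Setting.** Let $X_0\subset\mathbb R^n$ be closed and convex, $\mathcal O_0\supseteq X_0$ open and convex, $p\ge 1$, and let $\xi$ be a random element of a measurable space $\Xi$ with law $P$. Consider $$\min_{x\in X_0} f(x)=\mathbb E[F(x,\xi)]\quad\text{s.t.}\quad g_i(x)=\mathbb E[G_i(x,\xi)]\le 0,\ i=1,\dots,p,$$ where for $x\in\mathcal O_0$ the functions $F(x,\cdot),G_i(x,\cdot)$ are measurable and $P$-integrable, and for each $z\in\Xi$ the functions $F(\cdot,z),G_i(\cdot,z)$ are differentiable on $\mathcal O_0$. Let $G=(G_1,\dots,G_p)$, $g=(g_1,\dots,g_p)$ and $L(x,\lambda)=f(x)+\langle\lambda,g(x)\rangle$. Norms are Euclidean (spectral for matrices), and $h$ is called $\rho$-weakly convex on $\mathcal O_0$ if $h+\frac{\rho}{2}\|\cdot\|^2$ is convex there. Assume: * (A1) $\xi_1,\xi_2,\dots$ are i.i.d. with law $P$; * (A2) $D_0>0$ and $\|x-z\|\le D_0$ for $x,z\in X_0$; * (A3) $\nu_g>0$ and $\|G(x,z)\|\le\nu_g$ for $(x,z)\in\mathcal O_0\times\Xi$;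 * (A4) $\kappa_f,\kappa_g>0$, $\|\nabla_xF(x,z)\|\le\kappa_f$ and $\|\nabla_xG_i(x,z)\|\le\kappa_g$ for $(x,z)\in\mathcal O_0\times\Xi$ and all $i$; * (A5) $\epsilon_0>0$ and there is $\widehat x\in X_0$ with $g_i(\widehat x)\le-\epsilon_0$ for all $i$; * (A6) $L_0,\dots,L_p>0$ and, for each $z\in\Xi$, $F(\cdot,z)$ is $L_0$-weakly convex and $G_i(\cdot,z)$ is $L_i$-weakly convex on $\mathcal O_0$. **Algorithm (PMQSopt).** Let $\sigma,\alpha,\tau>0$, $x^1\in X_0$ and $\lambda^1=0\in\mathbb R^p$. For $t=1,\dots,T$ select symmetric matrices $\Sigma_1^t,\dots,\Sigma_p^t$, put $\Sigma_0^t=-\sum_{j}\lambda_j^t\Sigma_j^t+\tau I$, $$q_0^t(x)=F(x^t,\xi_t)+\langle\nabla_xF(x^t,\xi_t),x-x^t\rangle+\tfrac12\langle\Sigma_0^t(x-x^t),x-x^t\rangle,$$ $$q_i^t(x)=G_i(x^t,\xi_t)+\langle\nabla_xG_i(x^t,\xi_t),x-x^t\rangle+\tfrac12\langle\Sigma_i^t(x-x^t),x-x^t\rangle,$$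 let $x^{t+1}$ be a minimizer over $x\in X_0$ of $$q_0^t(x)+\tfrac1{2\sigma}\Big[\sum_{i=1}^p[\lambda_i^t+\sigma q_i^t(x)]_+^2-\|\lambda^t\|^2\Big]+\tfrac\alpha2\|x-x^t\|^2,$$ and put $\lambda_i^{t+1}=[\lambda_i^t+\sigma q_i^t(x^{t+1})]_+$. The iterates $x^{t+1},\lambda^{t+1}$ are measurable functions of $(\xi_1,\dots,\xi_t)$. **Constants.** For $\kappa_\Sigma>0$ let $\gamma_1=\nu_g+\sqrt p\,(\kappa_gD_0+\frac12\kappa_\Sigma D_0^2)$, $\gamma_2=\nu_g+\kappa_gD_0+\frac12\kappa_\Sigma D_0^2$, $\beta=2\big[L_0+\sum_{j=1}^p\gamma_2L_j\big]+1$, $$\gamma_3=\frac{4\kappa_fD_0}{\epsilon_0}+\frac{2D_0^2}{\epsilon_0}+\Big(\frac{2\nu_g^2}{\epsilon_0}-\gamma_1\Big)+\Big(2\gamma_1+\frac{\epsilon_0}4+\frac{16\gamma_1^2}{\epsilon_0}\log\frac{128\gamma_1^2}{\epsilon_0^2}\Big),$$ $$\gamma_4=\gamma_3^2+32\gamma_3\frac{\gamma_1^2}{\epsilon_0}+256\frac{\gamma_1^4}{\epsilon_0^2}+2\sigma\nu_g\Big[\gamma_3+16\frac{\gamma_1^2}{\epsilon_0}\Big]+\nu_g^2+2\nu_g^2\big[\Gamma(6,1)+2\Gamma(4,1)+\Gamma(2,1)\big],$$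 where $\Gamma(a,b)=\int_b^\infty t^{a-1}e^{-t}\,dt$, and $$\gamma_5=\gamma_3+\frac1\beta\Big\{(2\kappa_g+\kappa_\Sigma D_0)\kappa_f+(\nu_g+\gamma_3)(2\kappa_g+\kappa_\Sigma D_0)\Big(\kappa_g+\frac{\kappa_\Sigma D_0}2\Big)\sqrt p\Big\}.$$ **Theorem.** Let (A1)--(A6) hold and let $(x^t,\lambda^t)$ be generated by PMQSopt with $\sigma=T^{-3/4}$, $\alpha=\beta T^{1/4}$, $\tau=T^{1/2}$, and matrices with $\Sigma_i^t\preceq-L_iI$ and $\|\Sigma_i^t\|\le\kappa_\Sigma$ for $i=1,\dots,p$ (for instance $\Sigma_i^t=-L_iI$ with $\kappa_\Sigma=\max\{L_1,\dots,L_p\}$). Assume $\sqrt p\,\kappa_\Sigma D_0^2\le\epsilon_0$ and $$T>\max\big\{\beta^2,\ \beta^{-1}p(\kappa_g+\kappa_\Sigma D_0/2)^2,\ (\kappa_\Sigma\gamma_2)^4\big\}.$$ For $t\le T$ let $\phi^t_{1/\alpha}(x)=\inf_{z\in X_0}\{L(z,\lambda^t)+\frac\alpha2\|z-x\|^2\}$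 be the Moreau envelope of $L(\cdot,\lambda^t)+\delta_{X_0}$, where $\delta_{X_0}$ is the indicator function of $X_0$. Then $\phi^t_{1/\alpha}$ is differentiable at $x^t$, $\inf_{X_0}f$ is finite, all expectations below exist and are finite, and the following three bounds, each of order $O(T^{-1/4})$, hold. (i) Gradient of the Moreau envelope of the Lagrangian: $$\begin{aligned}\frac1T\,\mathbb E\sum_{t=1}^T\|\nabla\phi^t_{1/\alpha}(x^t)\|^2\le{}&\frac{4(\beta+1)}{T^{1/2}}\Big[f(x^1)-\inf_{z\in X_0}f(z)\Big]+\frac4{T^{1/2}}\Big[(\beta+1)\nu_g\gamma_3+\beta D_0\gamma_2p(\kappa_g+\kappa_\Sigma D_0)\Big]\\&+\frac4{T^{1/4}}\Big[(\beta+1)\nu_g\gamma_1+\beta\big[\kappa_f+\gamma_2p(\kappa_g+\kappa_\Sigma D_0)\big]^2+\beta p\kappa_g^2\gamma_4\Big]\\&+\frac{8\beta}Tp\kappa_g^2\gamma_1\gamma_3+\frac{4\beta}{T^{7/4}}\gamma_1^2p\kappa_g^2.\end{aligned}$$ (ii) Constraint violation: for every $i=1,\dots,p$, $$\frac1T\,\mathbb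 E\Big[\sum_{t=1}^TG_i(x^t,\xi_t)\Big]\le\frac{\gamma_5}{T^{1/4}}\qquad\text{and}\qquad\frac1T\,\mathbb E\Big[\sum_{t=1}^Tg_i(x^t)\Big]\le\frac{\gamma_5}{T^{1/4}}.$$ (iii) Complementarity violation: $$-\frac1T\,\mathbb E\Big(\sum_{t=1}^T\langle\lambda^t,g(x^t)\rangle\Big)\le\frac{\nu_g^2}{2T^{3/4}}+\frac{\kappa_f^2}{2\beta T^{1/4}}.$$ -/

import Mathlib

open MeasureTheory ProbabilityTheory

namespace PMQS

noncomputable section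

/-- `ℝⁿ` with its Euclidean norm and inner product. -/
abbrev E (n : ℕ) : Type := EuclideanSpace ℝ (Fin n)

/-- `h` is `ρ`-weakly convex on `s`: `h + (ρ/2)‖·‖²` is convex on `s`. -/
def WeaklyConvexOn {n : ℕ} (ρ : ℝ) (s : Set (E n)) (h : E n → ℝ) : Prop :=
  ConvexOn ℝ s (fun x => h x + ρ / 2 * ‖x‖ ^ 2)

/-- The data of the stochastic program
`min_{x ∈ X₀} 𝔼[F(x,ξ)]` subject to `𝔼[Gᵢ(x,ξ)] ≤ 0`, `i = 1,…,p`.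
`Ξ` is the space in which the random vector `ξ` takes its values, and only the values of `F` and
`Gᵢ` on `O₀ × Ξ`, where `O₀` is an open convex set containing `X₀`, are ever relevant. -/
structure Problem (n p : ℕ) (Ξ : Type*) where
  X0 : Set (E n)
  O0 : Set (E n)
  F : E n → Ξ → ℝ
  G : Fin p → E n → Ξ → ℝ

namespace Problem

variable {n p : ℕ} {Ξ : Type*} [MeasurableSpace Ξ]

/-- The objective `f(x) = 𝔼[F(x,ξ)]`, where `ξ` has law `P`. -/
def f (Q : Problem n p Ξ) (P : Measure Ξ) (x : E n) : ℝ := ∫ z, Q.F x z ∂P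

/-- The constraint functions `gᵢ(x) = 𝔼[Gᵢ(x,ξ)]`. -/
def g (Q : Problem n p Ξ) (P : Measure Ξ) (i : Fin p) (x : E n) : ℝ := ∫ z, Q.G i x z ∂P

/-- The Lagrangian `L(x,λ) = f(x) + ∑ⱼ λⱼ gⱼ(x)`. -/
def lagrangian (Q : Problem n p Ξ) (P : Measure Ξ) (x : E n) (lam : E p) : ℝ :=
  Q.f P x + ∑ j, lam j * Q.g P j x

end Problem

/-- The Moreau envelope with parameter `r` of `h + δ_X` (`δ_X` the indicator function of `X`, equal
to `0` on `X` and to `+∞` off `X`):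
`x ↦ inf_z { h z + δ_X z + ‖z - x‖²/(2r) } = inf_{z ∈ X} { h z + ‖z - x‖²/(2r) }`. -/
def moreauEnvelope {n : ℕ} (X : Set (E n)) (h : E n → ℝ) (r : ℝ) (x : E n) : ℝ :=
  ⨅ z : X, (h z + 1 / (2 * r) * ‖(z : E n) - x‖ ^ 2)

/-- The constants that appear in the assumptions on the problem and on the matrices of the
method: the diameter bound `D₀`, the bounds `ν_g`, `κ_f`, `κ_g`, the Slater constant `ε₀`, the
moduli `L₀, L₁, …, L_p` of weak convexity and the bound `κ_Σ` on the matrices. -/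
structure Consts (p : ℕ) where
  D0 : ℝ
  nug : ℝ
  kf : ℝ
  kg : ℝ
  eps0 : ℝ
  L0 : ℝ
  L : Fin p → ℝ
  kS : ℝ

/-- The standing assumptions on the problem (all but the one on sampling). -/
structure Assumptions {n p : ℕ} {Ξ : Type*} [MeasurableSpace Ξ]
    (Q : Problem n p Ξ) (P : Measure Ξ) (c : Consts p) : Prop where
  closed_X0 : IsClosed Q.X0
  convex_X0 : Convex ℝ Q.X0
  open_O0 : IsOpen Q.O0
  convex_O0 : Convex ℝ Q.O0
  subset : Q.X0 ⊆ Q.O0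
  -- the expectations are well defined and finite on `O₀`
  measurable_F : ∀ x ∈ Q.O0, Measurable (Q.F x)
  measurable_G : ∀ i, ∀ x ∈ Q.O0, Measurable (Q.G i x)
  integrable_F : ∀ x ∈ Q.O0, Integrable (Q.F x) P
  integrable_G : ∀ i, ∀ x ∈ Q.O0, Integrable (Q.G i x) P
  -- `F(·,z)` and `Gᵢ(·,z)` have gradients on `O₀`
  differentiable_F : ∀ z, ∀ x ∈ Q.O0, DifferentiableAt ℝ (fun y => Q.F y z) x
  differentiable_G : ∀ i z, ∀ x ∈ Q.O0, DifferentiableAt ℝ (fun y => Q.G i y z) x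
  -- bounded diameter of `X₀`
  D0_pos : 0 < c.D0
  diam_le : ∀ x ∈ Q.X0, ∀ z ∈ Q.X0, ‖x - z‖ ≤ c.D0
  -- bounded constraint values
  nug_pos : 0 < c.nug
  norm_G_le : ∀ x ∈ Q.O0, ∀ z, √(∑ i, Q.G i x z ^ 2) ≤ c.nug
  -- bounded gradients
  kf_pos : 0 < c.kf
  kg_pos : 0 < c.kg
  norm_gradF_le : ∀ x ∈ Q.O0, ∀ z, ‖gradient (fun y => Q.F y z) x‖ ≤ c.kf
  norm_gradG_le : ∀ i, ∀ x ∈ Q.O0, ∀ z, ‖gradient (fun y => Q.G i y z) x‖ ≤ c.kg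
  -- strict feasibility
  eps0_pos : 0 < c.eps0
  slater : ∃ xhat ∈ Q.X0, ∀ i, Q.g P i xhat ≤ -c.eps0
  -- weak convexity
  L0_pos : 0 < c.L0
  L_pos : ∀ i, 0 < c.L i
  weaklyConvex_F : ∀ z, WeaklyConvexOn c.L0 Q.O0 (fun y => Q.F y z)
  weaklyConvex_G : ∀ i z, WeaklyConvexOn (c.L i) Q.O0 (fun y => Q.G i y z)

/-- `ξ 1, ξ 2, …` is an i.i.d. sample of the law `P` (the value `ξ 0` plays no role). -/
structure IsIIDSample {Ω Ξ : Type*} [MeasurableSpace Ω] [MeasurableSpace Ξ]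
    (ξ : ℕ → Ω → Ξ) (P : Measure Ξ) (μ : Measure Ω) : Prop where
  measurable : ∀ t, 1 ≤ t → Measurable (ξ t)
  law : ∀ t, 1 ≤ t → μ.map (ξ t) = P
  indep : iIndepFun (fun t : ℕ => ξ (t + 1)) μ

/-- The σ-algebra generated by the history `ξ_[t] = (ξ 1, …, ξ t)`. -/
abbrev history {Ω Ξ : Type*} [mΞ : MeasurableSpace Ξ] (ξ : ℕ → Ω → Ξ) (t : ℕ) : MeasurableSpace Ω :=
  ⨆ s ∈ Set.Icc 1 t, mΞ.comap (ξ s)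

/-- The quadratic form `⟨A v, v⟩` of a matrix `A`. -/
def quadForm {n : ℕ} (A : Matrix (Fin n) (Fin n) ℝ) (v : E n) : ℝ :=
  inner ℝ (Matrix.toEuclideanCLM (𝕜 := ℝ) A v) v

/-- The quadratic approximation `h y + ⟨∇h(y), x - y⟩ + ½⟨A(x - y), x - y⟩` of `h` at `y`. -/
def quadModel {n : ℕ} (h : E n → ℝ) (A : Matrix (Fin n) (Fin n) ℝ) (y x : E n) : ℝ :=
  h y + inner ℝ (gradient h y) (x - y) + 1 / 2 * quadForm A (x - y)

/-- The matrix `Σ₀ = -∑ᵢ λᵢ Σᵢ + τ I`. -/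
def sigma0 {n p : ℕ} (tau : ℝ) (S : Fin p → Matrix (Fin n) (Fin n) ℝ) (lam : E p) :
    Matrix (Fin n) (Fin n) ℝ :=
  -(∑ i, lam i • S i) + tau • (1 : Matrix (Fin n) (Fin n) ℝ)

/-- The augmented Lagrangian
`q₀(x) + (1/(2σ)) [∑ᵢ [λᵢ + σ qᵢ(x)]₊² - ‖λ‖²]`
of the problem of minimizing `q₀` subject to `qᵢ ≤ 0`. -/
def augLagrangian {n p : ℕ} (sigma : ℝ) (q0 : E n → ℝ) (q : Fin p → E n → ℝ)
    (lam : E p) (x : E n) : ℝ :=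
  q0 x + 1 / (2 * sigma) * (∑ i, max (lam i + sigma * q i x) 0 ^ 2 - ‖lam‖ ^ 2)

/-- `x`, `lam` are `T` iterations of the proximal method of multipliers with quadratic
approximations (PMQSopt), with parameters `σ`, `α`, `τ`, samples `ξ 1, …, ξ T`, matrices
`Sig t i = Σᵢᵗ` and starting points `x¹ = x1`, `λ¹ = 0`.
The iterates `x^{t+1}` and `λ^{t+1}` are (measurable) functions of the history
`ξ_[t] = (ξ 1, …, ξ t)`. -/
structure IsPMQSopt {n p : ℕ} {Ω Ξ : Type*} [MeasurableSpace Ξ] (Q : Problem n p Ξ)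
    (sigma alpha tau : ℝ) (T : ℕ) (ξ : ℕ → Ω → Ξ)
    (Sig : ℕ → Fin p → Ω → Matrix (Fin n) (Fin n) ℝ) (x1 : E n)
    (x : ℕ → Ω → E n) (lam : ℕ → Ω → E p) : Prop where
  x_one : ∀ ω, x 1 ω = x1
  lam_one : ∀ ω, lam 1 ω = 0
  measurable_x : ∀ t, 1 ≤ t → t ≤ T → Measurable[history ξ t] (x (t + 1))
  measurable_lam : ∀ t, 1 ≤ t → t ≤ T → Measurable[history ξ t] (lam (t + 1))
  symm : ∀ t, 1 ≤ t → t ≤ T → ∀ i ω, (Sig t i ω).IsSymm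
  x_mem : ∀ t, 1 ≤ t → t ≤ T → ∀ ω, x (t + 1) ω ∈ Q.X0
  x_argmin : ∀ t, 1 ≤ t → t ≤ T → ∀ ω,
    IsMinOn
      (fun y => augLagrangian sigma
          (quadModel (fun u => Q.F u (ξ t ω))
            (sigma0 tau (fun i => Sig t i ω) (lam t ω)) (x t ω))
          (fun i => quadModel (fun u => Q.G i u (ξ t ω)) (Sig t i ω) (x t ω))
          (lam t ω) y
        + alpha / 2 * ‖y - x t ω‖ ^ 2)
      Q.X0 (x (t + 1) ω)
  lam_succ : ∀ t, 1 ≤ t → t ≤ T → ∀ ω i,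
    lam (t + 1) ω i =
      max (lam t ω i + sigma *
        quadModel (fun u => Q.G i u (ξ t ω)) (Sig t i ω) (x t ω) (x (t + 1) ω)) 0

/-- The upper incomplete Gamma function `Γ(a,b) = ∫_b^∞ t^{a-1} e^{-t} dt`. -/
def upperGamma (a b : ℝ) : ℝ := ∫ t in Set.Ioi b, t ^ (a - 1) * Real.exp (-t)

namespace Consts

variable {p : ℕ} (c : Consts p)

def gamma1 : ℝ := c.nug + √(p : ℝ) * (c.kg * c.D0 + 1 / 2 * c.kS * c.D0 ^ 2)

def gamma2 : ℝ := c.nug + (c.kg * c.D0 + c.kS * c.D0 ^ 2 / 2)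

def beta : ℝ := 2 * (c.L0 + ∑ j, c.gamma2 * c.L j) + 1

def kappa0 : ℝ := 4 * c.kf * c.D0 / c.eps0

def kappa1 : ℝ := 2 * c.D0 ^ 2 / c.eps0

def kappa3 : ℝ := 2 * c.nug ^ 2 / c.eps0 - c.gamma1

def kappa4 : ℝ :=
  2 * c.gamma1 + c.eps0 / 4
    + 16 * c.gamma1 ^ 2 / c.eps0 * Real.log (128 * c.gamma1 ^ 2 / c.eps0 ^ 2)

def gamma3 : ℝ := c.kappa0 + c.kappa1 + c.kappa3 + c.kappa4

/-- The constant `γ₄`; it contains the parameter `σ` of the method, which tends to `0`. -/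
def gamma4 (sigma : ℝ) : ℝ :=
  c.gamma3 ^ 2 + 32 * c.gamma3 * (c.gamma1 ^ 2 / c.eps0)
    + 256 * (c.gamma1 ^ 4 / c.eps0 ^ 2)
    + 2 * sigma * c.nug * (c.gamma3 + 16 * (c.gamma1 ^ 2 / c.eps0))
    + c.nug ^ 2
    + 2 * c.nug ^ 2 * (upperGamma 6 1 + 2 * upperGamma 4 1 + upperGamma 2 1)

def rho1 : ℝ := (2 * c.kg + c.kS * c.D0) * c.kf

def rho2 : ℝ := (2 * c.kg + c.kS * c.D0) * (c.kg + c.kS * c.D0 / 2) * √(p : ℝ)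

def gamma5 : ℝ := c.gamma3 + 1 / c.beta * (c.rho1 + (c.nug + c.gamma3) * c.rho2)

end Consts

end

end PMQS

open PMQS

/-! One inequality for the subproblem drives all three bounds. The subproblem is not assumed convex,
since the constraint models are concave. Still, the squared positive part is convex with Lipschitz
derivative, so first-order optimality of x^{t+1} along the segment to any z in X₀ gives a
three-point inequality with modulus τ+α (`IsStep.three_point`). The curvature -∑λⱼΣⱼ built into Σ₀
cancels against that of the augmented term, whose weights at the minimizer are the new multipliers
λ'. What survives is ∑(λ'ⱼ-λⱼ)Σⱼ, and √p κ_Σ D₀² ≤ ε₀ makes its contribution at most of order ε₀σγ₁.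

Multipliers: because Σᵢ ⪯ -LᵢI, the models minorize the sampled constraints. With z = w a Slater
point, V² = ‖λ‖² + σ(τ+α)‖w-x‖² grows in one step by at most 2σ(B + (ε₀/2)‖λ‖ + ∑λᵢGᵢ(w,ξ)), with B
constant (`IsStep.drift`). The sample is independent of the state, so the last sum has conditional
mean at most -ε₀‖λ‖, and above a level θ the mean drift is at most -(ε₀/4)V. Hence E exp(rV)
contracts up to an additive constant and is bounded uniformly in t (`integral_exp_le`). This bounds
E‖λ‖ by γ₃ and E‖λ‖² by γ₄ (`moments_le`).

Bounds (ii) and (iii): the update of λ dominates σ times the models, so constraint values are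
bounded by telescoping increments of λ/σ plus a multiple of the step length, which is O((1+‖λ‖)/α).
Comparing x^{t+1} with x^t in the subproblem makes ‖λ‖² telescope against ⟨λ,G⟩.

Bound (i): pathwise λᵢ ≤ Tσγ₂ = T^{1/4}γ₂, so the choice of β keeps the weak convexity modulus of
L(·,λ) below α/2. The envelope is then differentiable with gradient α(x-z), z the proximal point.
With this z, the three-point inequality shows that the envelope decreases by a multiple of ‖x-z‖²,
up to small terms and the difference between sampled and expected Lagrangians. That difference has
mean zero because z depends continuously on (λ,x), hence only on the past
(`exists_continuousOn_prox`). Changing λ costs ν_gσγ₁ per step, and the sum telescopes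
(`integral_prox_sq_le`). -/

namespace PMQS

/-! ### Euclidean norms and quadratic forms. -/

section Euclidean

variable {n p : ℕ}

theorem norm_sq_eq_sum (v : E p) : ‖v‖ ^ 2 = ∑ i, v i ^ 2 :=
  EuclideanSpace.real_norm_sq_eq v

theorem abs_apply_le_norm (v : E p) (i : Fin p) : |v i| ≤ ‖v‖ := by
  simpa using PiLp.norm_apply_le v i

theorem sum_abs_le_sqrt_mul_norm (v : E p) : ∑ i, |v i| ≤ √(p : ℝ) * ‖v‖ := by
  refine le_of_sq_le_sq ?_ (by positivity)
  have h := sq_sum_le_card_mul_sum_sq (s := (Finset.univ : Finset (Fin p))) (f := fun i => |v i|)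
  rw [mul_pow, Real.sq_sqrt (by positivity), norm_sq_eq_sum]
  simpa using h

theorem norm_le_sqrt_mul {v : E p} {b : ℝ} (hb : 0 ≤ b) (h : ∀ i, |v i| ≤ b) :
    ‖v‖ ≤ √(p : ℝ) * b := by
  refine le_of_sq_le_sq ?_ (by positivity)
  rw [mul_pow, Real.sq_sqrt (by positivity), norm_sq_eq_sum]
  calc ∑ i, v i ^ 2 ≤ ∑ _i : Fin p, b ^ 2 :=
        Finset.sum_le_sum fun i _ => sq_le_sq' (by linarith [neg_abs_le (v i), h i])
          ((le_abs_self _).trans (h i))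
    _ = p * b ^ 2 := by simp

theorem abs_sum_mul_le_norm_mul_norm (u v : E p) : |∑ i, u i * v i| ≤ ‖u‖ * ‖v‖ := by
  have h := abs_real_inner_le_norm u v
  rw [PiLp.inner_apply] at h
  simpa [mul_comm] using h

theorem quadForm_add_smul {A : Matrix (Fin n) (Fin n) ℝ} (hA : A.IsSymm) (u w : E n) (s : ℝ) :
    quadForm A (u + s • w) = quadForm A u
      + 2 * s * inner ℝ (Matrix.toEuclideanCLM (𝕜 := ℝ) A u) w + s ^ 2 * quadForm A w := by
  have hsym : inner ℝ (Matrix.toEuclideanCLM (𝕜 := ℝ) A w) u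
      = inner ℝ (Matrix.toEuclideanCLM (𝕜 := ℝ) A u) w := by
    have h1 : A.IsHermitian := by
      rw [Matrix.IsHermitian, Matrix.conjTranspose_eq_transpose_of_trivial]; exact hA
    rw [real_inner_comm w]
    exact Matrix.isSymmetric_toEuclideanLin_iff.2 h1 w u
  simp only [quadForm, map_add, map_smul, inner_add_left, inner_add_right, inner_smul_left,
    inner_smul_right, hsym]
  simp
  ring

theorem quadForm_sigma0 (tau : ℝ) (S : Fin p → Matrix (Fin n) (Fin n) ℝ) (lam : E p) (v : E n) :
    quadForm (sigma0 tau S lam) v = -(∑ i, lam i * quadForm (S i) v) + tau * ‖v‖ ^ 2 := by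
  simp [quadForm, sigma0, sum_inner, inner_smul_left, inner_add_left]

theorem quadForm_le_of_posSemidef {A : Matrix (Fin n) (Fin n) ℝ} {l : ℝ}
    (h : (-(l • (1 : Matrix (Fin n) (Fin n) ℝ)) - A).PosSemidef) (v : E n) :
    quadForm A v ≤ -l * ‖v‖ ^ 2 := by
  have h1 : 0 ≤ quadForm (-(l • (1 : Matrix (Fin n) (Fin n) ℝ)) - A) v := by
    have := h.dotProduct_mulVec_nonneg v.ofLp
    rwa [quadForm, EuclideanSpace.inner_eq_star_dotProduct, Matrix.ofLp_toEuclideanCLM]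
  have h2 : quadForm (-(l • (1 : Matrix (Fin n) (Fin n) ℝ)) - A) v
      = -l * ‖v‖ ^ 2 - quadForm A v := by
    simp [quadForm, inner_sub_left, inner_smul_left, inner_neg_left]
  linarith

theorem abs_quadForm_le {A : Matrix (Fin n) (Fin n) ℝ} {k : ℝ}
    (h : ‖Matrix.toEuclideanCLM (𝕜 := ℝ) A‖ ≤ k) (v : E n) :
    |quadForm A v| ≤ k * ‖v‖ ^ 2 := by
  have h1 := abs_real_inner_le_norm (Matrix.toEuclideanCLM (𝕜 := ℝ) A v) v
  have h2 := (Matrix.toEuclideanCLM (𝕜 := ℝ) A).le_of_opNorm_le h v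
  unfold quadForm
  nlinarith [norm_nonneg v]

theorem sigma0_isSymm {tau : ℝ} {S : Fin p → Matrix (Fin n) (Fin n) ℝ} {lam : E p}
    (hS : ∀ i, (S i).IsSymm) : (sigma0 tau S lam).IsSymm := by
  unfold sigma0 Matrix.IsSymm
  rw [Matrix.transpose_add, Matrix.transpose_neg, Matrix.transpose_sum]
  simp [fun i => (hS i).eq]

end Euclidean

/-! ### Inequalities for the positive part. -/

section PositivePart

/-- The derivative 2[a]₊ of [a]₊² is 2-Lipschitz, which gives the upper quadratic bound. -/
theorem posPart_sq_add_le (a b : ℝ) : max (a + b) 0 ^ 2 ≤ max a 0 ^ 2 + 2 * max a 0 * b + b ^ 2 := by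
  rcases le_total a 0 with ha | ha <;> rcases le_total (a + b) 0 with hab | hab <;>
    simp only [max_eq_left, max_eq_right, ha, hab] <;> nlinarith

/-- Convexity of [·]₊²: the graph lies above the tangent at a. -/
theorem le_posPart_sq_add (a b : ℝ) : max a 0 ^ 2 + 2 * max a 0 * b ≤ max (a + b) 0 ^ 2 := by
  rcases le_total a 0 with ha | ha <;> rcases le_total (a + b) 0 with hab | hab <;>
    simp only [max_eq_left, max_eq_right, ha, hab] <;> nlinarith [sq_nonneg b]

theorem posPart_sq_le_sq (a : ℝ) : max a 0 ^ 2 ≤ a ^ 2 := by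
  rcases le_total a 0 with ha | ha <;> simp only [max_eq_left, max_eq_right, ha] <;> nlinarith

theorem abs_posPart_add_sub_le {l : ℝ} (hl : 0 ≤ l) (b : ℝ) : |max (l + b) 0 - l| ≤ |b| := by
  have := abs_max_sub_max_le_abs (l + b) l 0
  rw [max_eq_left hl] at this
  simpa using this

theorem posPart_add_sub_le {l b k : ℝ} (hk : 0 ≤ k) (hl : 0 ≤ l) (hb : b ≤ k) :
    max (l + b) 0 - l ≤ k := by
  rcases le_total (l + b) 0 with h | h <;> simp only [max_eq_left, max_eq_right, h] <;> linarith

end PositivePart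

/-! ### First-order optimality along segments. -/

/-- A function of one variable with derivative `D` at `0` up to a quadratic error is minimal at `0`
on `[0, 1]` only if `D ≥ 0`. -/
theorem nonneg_of_forall_le_linear_add_sq {D C : ℝ}
    (h : ∀ s : ℝ, 0 < s → s ≤ 1 → 0 ≤ s * D + s ^ 2 * C) : 0 ≤ D := by
  by_contra! hD
  have hC : 0 < C := by have := h 1 one_pos le_rfl; nlinarith
  -- This s makes s²C at most -sD/2, so s·D + s²·C is negative.
  have hs : 0 < min 1 (-D / (2 * C)) := lt_min one_pos (by apply div_pos <;> linarith)
  have h1 := h _ hs (min_le_left _ _)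
  have h2 : min 1 (-D / (2 * C)) * (2 * C) ≤ -D := by
    rw [← le_div_iff₀ (by linarith)]; exact min_le_right _ _
  nlinarith

theorem quadModel_add_smul {n : ℕ} (h : E n → ℝ) {A : Matrix (Fin n) (Fin n) ℝ} (hA : A.IsSymm)
    (y u w : E n) (s : ℝ) :
    quadModel h A y (u + s • w) = quadModel h A y u
      + (s * (inner ℝ (gradient h y) w + inner ℝ (Matrix.toEuclideanCLM (𝕜 := ℝ) A (u - y)) w)
        + s ^ 2 * (quadForm A w / 2)) := by
  have h1 : u + s • w - y = (u - y) + s • w := by abel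
  rw [quadModel, h1, quadForm_add_smul hA, inner_add_right, inner_smul_right, quadModel]
  ring

/-- Optimality along a segment, for a quadratic function plus a sum of squared positive parts of
quadratic functions. -/
theorem quadratic_le_of_forall_nonneg {ι : Type*} [Fintype ι] {σ : ℝ} (hσ : 0 < σ)
    (a e k : ι → ℝ) (e0 k0 : ℝ)
    (h : ∀ s : ℝ, 0 < s → s ≤ 1 → 0 ≤ s * e0 + s ^ 2 * k0
      + 1 / (2 * σ) * ∑ i, (max (a i + σ * (s * e i + s ^ 2 * k i)) 0 ^ 2 - max (a i) 0 ^ 2)) :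
    k0 + ∑ i, max (a i) 0 * k i ≤ e0 + k0
      + 1 / (2 * σ) * ∑ i, (max (a i + σ * (e i + k i)) 0 ^ 2 - max (a i) 0 ^ 2) := by
  have hD : 0 ≤ e0 + ∑ i, max (a i) 0 * e i := by
    -- The hypothesis is linearized at s = 0. For s ≤ 1 the increment s·e + s²·k is at most
    -- s(|e|+|k|) in absolute value, so everything beyond the derivative is a multiple of s².
    refine nonneg_of_forall_le_linear_add_sq
      (C := k0 + ∑ i, max (a i) 0 * k i + σ / 2 * ∑ i, (|e i| + |k i|) ^ 2) fun s hs hs1 => ?_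
    refine (h s hs hs1).trans ?_
    have h1 : ∑ i, (max (a i + σ * (s * e i + s ^ 2 * k i)) 0 ^ 2 - max (a i) 0 ^ 2)
        ≤ ∑ i, (2 * max (a i) 0 * (σ * (s * e i + s ^ 2 * k i))
          + σ ^ 2 * (s ^ 2 * (|e i| + |k i|) ^ 2)) := by
      refine Finset.sum_le_sum fun i _ => ?_
      have h2 := posPart_sq_add_le (a i) (σ * (s * e i + s ^ 2 * k i))
      have h3 : (s * e i + s ^ 2 * k i) ^ 2 ≤ s ^ 2 * (|e i| + |k i|) ^ 2 := by
        rw [← mul_pow]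
        refine sq_le_sq.2 ?_
        rw [abs_of_nonneg (by positivity : 0 ≤ s * (|e i| + |k i|))]
        refine (abs_add_le _ _).trans ?_
        rw [abs_mul, abs_mul, abs_of_pos hs, abs_of_pos (by positivity : 0 < s ^ 2)]
        have := mul_le_mul_of_nonneg_right (by nlinarith : s ^ 2 ≤ s) (abs_nonneg (k i))
        linarith
      nlinarith [mul_le_mul_of_nonneg_left h3 (sq_nonneg σ)]
    have h4 := mul_le_mul_of_nonneg_left h1 (by positivity : 0 ≤ 1 / (2 * σ))
    have h5 : 1 / (2 * σ) * ∑ i, (2 * max (a i) 0 * (σ * (s * e i + s ^ 2 * k i))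
          + σ ^ 2 * (s ^ 2 * (|e i| + |k i|) ^ 2))
        = s * ∑ i, max (a i) 0 * e i + s ^ 2 * ∑ i, max (a i) 0 * k i
          + s ^ 2 * (σ / 2 * ∑ i, (|e i| + |k i|) ^ 2) := by
      simp only [Finset.mul_sum, ← Finset.sum_add_distrib]
      refine Finset.sum_congr rfl fun i _ => ?_
      field_simp
    linarith
  -- At s = 1 the tangent bound for [·]₊² gives the derivative, known to be nonnegative, plus the
  -- curvature terms weighted by [a]₊.
  have h1 : ∑ i, (2 * max (a i) 0 * (σ * (e i + k i)))
      ≤ ∑ i, (max (a i + σ * (e i + k i)) 0 ^ 2 - max (a i) 0 ^ 2) :=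
    Finset.sum_le_sum fun i _ => by linarith [le_posPart_sq_add (a i) (σ * (e i + k i))]
  have h4 := mul_le_mul_of_nonneg_left h1 (by positivity : 0 ≤ 1 / (2 * σ))
  have h5 : 1 / (2 * σ) * ∑ i, (2 * max (a i) 0 * (σ * (e i + k i)))
      = ∑ i, max (a i) 0 * e i + ∑ i, max (a i) 0 * k i := by
    simp only [Finset.mul_sum, ← Finset.sum_add_distrib]
    refine Finset.sum_congr rfl fun i _ => ?_
    field_simp
  linarith

/-! ### One iteration: the three-point inequality and its consequences. -/

/-- The conditions on the constants under which the method is analysed. -/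
structure Consts.Admissible {p : ℕ} (c : Consts p) : Prop where
  D0_pos : 0 < c.D0
  nug_pos : 0 < c.nug
  kf_pos : 0 < c.kf
  kg_pos : 0 < c.kg
  eps0_pos : 0 < c.eps0
  L0_pos : 0 < c.L0
  L_pos : ∀ i, 0 < c.L i
  kS_pos : 0 < c.kS
  kS_le : √(p : ℝ) * c.kS * c.D0 ^ 2 ≤ c.eps0
  eps0_le : c.eps0 ≤ c.nug

/-- One iteration of the method, from `(y, lam)` to `(xp, lam')`, for the sampled functions `Fh` and
`Gh i`, together with the bounds that hold for the data. -/
structure IsStep {n p : ℕ} (c : Consts p) (X0 : Set (E n)) (sigma alpha tau : ℝ)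
    (Fh : E n → ℝ) (Gh : Fin p → E n → ℝ) (S : Fin p → Matrix (Fin n) (Fin n) ℝ)
    (y : E n) (lam : E p) (xp : E n) (lam' : E p) : Prop where
  sigma_pos : 0 < sigma
  alpha_pos : 0 < alpha
  tau_nonneg : 0 ≤ tau
  convex : Convex ℝ X0
  diam_le : ∀ u ∈ X0, ∀ v ∈ X0, ‖u - v‖ ≤ c.D0
  y_mem : y ∈ X0
  xp_mem : xp ∈ X0
  lam_nonneg : ∀ i, 0 ≤ lam i
  symm : ∀ i, (S i).IsSymm
  quadForm_le : ∀ i v, quadForm (S i) v ≤ -c.L i * ‖v‖ ^ 2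
  abs_quadForm_le : ∀ i v, |quadForm (S i) v| ≤ c.kS * ‖v‖ ^ 2
  norm_G_le : ∀ u ∈ X0, √(∑ i, Gh i u ^ 2) ≤ c.nug
  norm_gradF_le : ‖gradient Fh y‖ ≤ c.kf
  norm_gradG_le : ∀ i, ‖gradient (Gh i) y‖ ≤ c.kg
  lower_F : ∀ z ∈ X0, Fh y + inner ℝ (gradient Fh y) (z - y) - c.L0 / 2 * ‖z - y‖ ^ 2 ≤ Fh z
  lower_G : ∀ i, ∀ z ∈ X0,
    Gh i y + inner ℝ (gradient (Gh i) y) (z - y) - c.L i / 2 * ‖z - y‖ ^ 2 ≤ Gh i z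
  isMinOn : IsMinOn (fun u => augLagrangian sigma (quadModel Fh (sigma0 tau S lam) y)
    (fun i => quadModel (Gh i) (S i) y) lam u + alpha / 2 * ‖u - y‖ ^ 2) X0 xp
  lam'_eq : ∀ i, lam' i = max (lam i + sigma * quadModel (Gh i) (S i) y xp) 0

namespace IsStep

variable {n p : ℕ} {c : Consts p} {X0 : Set (E n)} {sigma alpha tau : ℝ}
  {Fh : E n → ℝ} {Gh : Fin p → E n → ℝ} {S : Fin p → Matrix (Fin n) (Fin n) ℝ}
  {y : E n} {lam : E p} {xp : E n} {lam' : E p}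

theorem lam'_nonneg (h : IsStep c X0 sigma alpha tau Fh Gh S y lam xp lam') (i : Fin p) :
    0 ≤ lam' i := by
  rw [h.lam'_eq]; exact le_max_right _ _

/-- The three-point inequality for the subproblem. -/
theorem three_point (h : IsStep c X0 sigma alpha tau Fh Gh S y lam xp lam') {z : E n}
    (hz : z ∈ X0) :
    augLagrangian sigma (quadModel Fh (sigma0 tau S lam) y)
        (fun i => quadModel (Gh i) (S i) y) lam xp + alpha / 2 * ‖xp - y‖ ^ 2
      + (tau + alpha) / 2 * ‖z - xp‖ ^ 2
      + 1 / 2 * ∑ i, (lam' i - lam i) * quadForm (S i) (z - xp)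
    ≤ augLagrangian sigma (quadModel Fh (sigma0 tau S lam) y)
        (fun i => quadModel (Gh i) (S i) y) lam z + alpha / 2 * ‖z - y‖ ^ 2 := by
  have hσ := h.sigma_pos
  set w := z - xp with hw
  set A : Fin p → ℝ := fun i => lam i + sigma * quadModel (Gh i) (S i) y xp with hA
  set e : Fin p → ℝ := fun i => inner ℝ (gradient (Gh i) y) w
    + inner ℝ (Matrix.toEuclideanCLM (𝕜 := ℝ) (S i) (xp - y)) w with he
  set e0 : ℝ := inner ℝ (gradient Fh y) w
    + inner ℝ (Matrix.toEuclideanCLM (𝕜 := ℝ) (sigma0 tau S lam) (xp - y)) w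
    + alpha * inner ℝ (xp - y) w with he0
  set k0 : ℝ := quadForm (sigma0 tau S lam) w / 2 + alpha / 2 * ‖w‖ ^ 2 with hk0
  have key : ∀ s : ℝ, augLagrangian sigma (quadModel Fh (sigma0 tau S lam) y)
        (fun i => quadModel (Gh i) (S i) y) lam (xp + s • w) + alpha / 2 * ‖xp + s • w - y‖ ^ 2
      = augLagrangian sigma (quadModel Fh (sigma0 tau S lam) y)
        (fun i => quadModel (Gh i) (S i) y) lam xp + alpha / 2 * ‖xp - y‖ ^ 2
        + (s * e0 + s ^ 2 * k0 + 1 / (2 * sigma) * ∑ i,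
          (max (A i + sigma * (s * e i + s ^ 2 * (quadForm (S i) w / 2))) 0 ^ 2
            - max (A i) 0 ^ 2)) := by
    intro s
    have h1 : xp + s • w - y = (xp - y) + s • w := by abel
    have h2 : ‖xp - y + s • w‖ ^ 2
        = ‖xp - y‖ ^ 2 + 2 * (s * inner ℝ (xp - y) w) + s ^ 2 * ‖w‖ ^ 2 := by
      rw [norm_add_sq_real, inner_smul_right, norm_smul, mul_pow, Real.norm_eq_abs, sq_abs]
    have h3 : ∀ i, lam i + sigma * quadModel (Gh i) (S i) y (xp + s • w)
        = A i + sigma * (s * e i + s ^ 2 * (quadForm (S i) w / 2)) := by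
      intro i
      rw [quadModel_add_smul _ (h.symm i)]
      simp only [hA, he]; ring
    rw [h1, h2]
    simp only [augLagrangian, h3]
    rw [quadModel_add_smul _ (sigma0_isSymm h.symm), Finset.sum_sub_distrib]
    simp only [he0, hk0]; ring
  have h1 := quadratic_le_of_forall_nonneg hσ A e (fun i => quadForm (S i) w / 2) e0 k0 (by
    intro s hs hs1
    have hmem : xp + s • w ∈ X0 := by
      have := h.convex h.xp_mem hz (sub_nonneg.2 hs1) hs.le (by ring)
      convert this using 1
      rw [hw, smul_sub, sub_smul, one_smul]; abel
    have := isMinOn_iff.1 h.isMinOn _ hmem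
    rw [key s] at this
    linarith)
  have h2 := key 1
  have h3 : xp + (1 : ℝ) • w = z := by rw [hw, one_smul]; abel
  rw [h3] at h2
  simp only [one_pow, one_mul] at h2
  rw [h2]
  have h4 : ∀ i, lam' i = max (A i) 0 := fun i => h.lam'_eq i
  -- The weights [Aᵢ]₊ are the new multipliers and Σ₀ carries the old ones with opposite sign, so
  -- only τ and the curvature of the multiplier increment remain.
  have h5 : quadForm (sigma0 tau S lam) w / 2 + ∑ i, max (A i) 0 * (quadForm (S i) w / 2)
      = tau / 2 * ‖w‖ ^ 2 + 1 / 2 * ∑ i, (lam' i - lam i) * quadForm (S i) w := by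
    rw [quadForm_sigma0]
    simp only [h4, sub_mul, Finset.sum_sub_distrib, mul_div_assoc', ← Finset.sum_div]
    ring
  linarith

end IsStep

theorem quadModel_self {n : ℕ} (h : E n → ℝ) (A : Matrix (Fin n) (Fin n) ℝ) (y : E n) :
    quadModel h A y y = h y := by
  simp [quadModel, quadForm]

theorem Consts.Admissible.nug_le_gamma1 {p : ℕ} {c : Consts p} (hc : c.Admissible) :
    c.nug ≤ c.gamma1 := by
  have := hc.D0_pos
  have := hc.kg_pos
  have := hc.kS_pos
  unfold gamma1
  have : 0 ≤ √(p : ℝ) * (c.kg * c.D0 + 1 / 2 * c.kS * c.D0 ^ 2) := by positivity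
  linarith

theorem Consts.Admissible.gamma1_pos {p : ℕ} {c : Consts p} (hc : c.Admissible) :
    0 < c.gamma1 := hc.nug_pos.trans_le hc.nug_le_gamma1

namespace IsStep

variable {n p : ℕ} {c : Consts p} {X0 : Set (E n)} {sigma alpha tau : ℝ}
  {Fh : E n → ℝ} {Gh : Fin p → E n → ℝ} {S : Fin p → Matrix (Fin n) (Fin n) ℝ}
  {y : E n} {lam : E p} {xp : E n} {lam' : E p}

theorem sum_G_sq_le (h : IsStep c X0 sigma alpha tau Fh Gh S y lam xp lam') (hc : c.Admissible)
    {u : E n} (hu : u ∈ X0) : ∑ i, Gh i u ^ 2 ≤ c.nug ^ 2 := by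
  have := h.norm_G_le u hu
  rwa [Real.sqrt_le_left hc.nug_pos.le] at this

theorem abs_G_le (h : IsStep c X0 sigma alpha tau Fh Gh S y lam xp lam') (hc : c.Admissible)
    {u : E n} (hu : u ∈ X0) (i : Fin p) : |Gh i u| ≤ c.nug := by
  refine abs_le_of_sq_le_sq ?_ hc.nug_pos.le
  exact (Finset.single_le_sum (f := fun i => Gh i u ^ 2) (fun i _ => sq_nonneg _)
    (Finset.mem_univ i)).trans (h.sum_G_sq_le hc hu)

theorem abs_quadModel_sub_le (h : IsStep c X0 sigma alpha tau Fh Gh S y lam xp lam')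
    (hc : c.Admissible) {u : E n} (hu : u ∈ X0) (i : Fin p) :
    |quadModel (Gh i) (S i) y u - Gh i y| ≤ (c.kg + c.kS * c.D0 / 2) * ‖u - y‖ := by
  have h1 := abs_real_inner_le_norm (gradient (Gh i) y) (u - y)
  have h2 := h.abs_quadForm_le i (u - y)
  have h3 := mul_le_mul_of_nonneg_right (h.norm_gradG_le i) (norm_nonneg (u - y))
  have h4 := h.diam_le u hu y h.y_mem
  have h5 : c.kS * ‖u - y‖ ^ 2 ≤ c.kS * c.D0 * ‖u - y‖ := by
    have := mul_le_mul_of_nonneg_left h4 (mul_nonneg hc.kS_pos.le (norm_nonneg (u - y)))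
    nlinarith
  have h6 : quadModel (Gh i) (S i) y u - Gh i y
      = inner ℝ (gradient (Gh i) y) (u - y) + 1 / 2 * quadForm (S i) (u - y) := by
    rw [quadModel]; ring
  rw [h6]
  refine (abs_add_le _ _).trans ?_
  rw [abs_mul, abs_of_pos (by norm_num : (0 : ℝ) < 1 / 2)]
  linarith

/-- A bound for a single coordinate, free of the factor √p in γ₁; it governs the pathwise growth of
each multiplier. -/
theorem quadModel_le_gamma2 (h : IsStep c X0 sigma alpha tau Fh Gh S y lam xp lam')
    (hc : c.Admissible) {u : E n} (hu : u ∈ X0) (i : Fin p) :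
    quadModel (Gh i) (S i) y u ≤ c.gamma2 := by
  have h1 := (abs_le.1 (h.abs_quadModel_sub_le hc hu i)).2
  have h2 := (abs_le.1 (h.abs_G_le hc h.y_mem i)).2
  have h3 := h.diam_le u hu y h.y_mem
  have h4 : 0 ≤ c.kg + c.kS * c.D0 / 2 := by
    have := hc.kg_pos; have := hc.kS_pos; have := hc.D0_pos; positivity
  have h5 := mul_le_mul_of_nonneg_left h3 h4
  unfold Consts.gamma2
  nlinarith

theorem norm_quadModel_le (h : IsStep c X0 sigma alpha tau Fh Gh S y lam xp lam')
    (hc : c.Admissible) {u : E n} (hu : u ∈ X0) :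
    ‖(WithLp.toLp 2 fun i => quadModel (Gh i) (S i) y u : E p)‖ ≤ c.gamma1 := by
  have h4 : 0 ≤ c.kg + c.kS * c.D0 / 2 := by
    have := hc.kg_pos; have := hc.kS_pos; have := hc.D0_pos; positivity
  have e : (WithLp.toLp 2 fun i => quadModel (Gh i) (S i) y u : E p)
      = WithLp.toLp 2 (fun i => Gh i y)
        + WithLp.toLp 2 (fun i => quadModel (Gh i) (S i) y u - Gh i y) := by
    ext i; simp
  have h1 : ‖(WithLp.toLp 2 fun i => Gh i y : E p)‖ ≤ c.nug := by
    refine abs_le_of_sq_le_sq' ?_ hc.nug_pos.le |>.2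
    rw [norm_sq_eq_sum]; exact h.sum_G_sq_le hc h.y_mem
  have h2 : ‖(WithLp.toLp 2 fun i => quadModel (Gh i) (S i) y u - Gh i y : E p)‖
      ≤ √(p : ℝ) * ((c.kg + c.kS * c.D0 / 2) * c.D0) := by
    refine norm_le_sqrt_mul (mul_nonneg h4 hc.D0_pos.le) fun i => ?_
    exact (h.abs_quadModel_sub_le hc hu i).trans
      (mul_le_mul_of_nonneg_left (h.diam_le u hu y h.y_mem) h4)
  rw [e]
  refine (norm_add_le _ _).trans ((add_le_add h1 h2).trans (le_of_eq ?_))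
  unfold Consts.gamma1
  ring

/-- A nonnegative multiplier is its own positive part, and the positive part is 1-Lipschitz in each
coordinate. -/
theorem norm_sub_le (h : IsStep c X0 sigma alpha tau Fh Gh S y lam xp lam')
    (hc : c.Admissible) : ‖lam' - lam‖ ≤ sigma * c.gamma1 := by
  have h1 : ‖lam' - lam‖
      ≤ sigma * ‖(WithLp.toLp 2 fun i => quadModel (Gh i) (S i) y xp : E p)‖ := by
    refine le_of_sq_le_sq ?_ (mul_nonneg h.sigma_pos.le (norm_nonneg _))
    rw [mul_pow, norm_sq_eq_sum, norm_sq_eq_sum, Finset.mul_sum]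
    refine Finset.sum_le_sum fun i _ => ?_
    rw [← mul_pow]
    refine sq_le_sq.2 ?_
    simpa [h.lam'_eq i, abs_mul] using
      abs_posPart_add_sub_le (h.lam_nonneg i) (sigma * quadModel (Gh i) (S i) y xp)
  exact h1.trans (mul_le_mul_of_nonneg_left (h.norm_quadModel_le hc h.xp_mem) h.sigma_pos.le)

theorem norm_le (h : IsStep c X0 sigma alpha tau Fh Gh S y lam xp lam')
    (hc : c.Admissible) : ‖lam'‖ ≤ ‖lam‖ + sigma * c.gamma1 := by
  have h1 := h.norm_sub_le hc
  have h2 := norm_le_norm_add_norm_sub' lam' lam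
  linarith

theorem gamma2_nonneg (hc : c.Admissible) : 0 ≤ c.gamma2 := by
  have := hc.kg_pos; have := hc.kS_pos; have := hc.D0_pos; have := hc.nug_pos
  unfold Consts.gamma2
  positivity

theorem apply_le (h : IsStep c X0 sigma alpha tau Fh Gh S y lam xp lam')
    (hc : c.Admissible) (i : Fin p) : lam' i ≤ lam i + sigma * c.gamma2 := by
  have := posPart_add_sub_le (mul_nonneg h.sigma_pos.le (gamma2_nonneg hc)) (h.lam_nonneg i)
    (mul_le_mul_of_nonneg_left (h.quadModel_le_gamma2 hc h.xp_mem i) h.sigma_pos.le)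
  rw [h.lam'_eq]; linarith

/-- The curvature of the model, at most -Lᵢ, lies below the lower quadratic bound that weak
convexity provides. This lets true constraint values, such as those at a Slater point, replace the
models. -/
theorem quadModel_le (h : IsStep c X0 sigma alpha tau Fh Gh S y lam xp lam')
    {u : E n} (hu : u ∈ X0) (i : Fin p) : quadModel (Gh i) (S i) y u ≤ Gh i u := by
  have h1 := h.lower_G i u hu
  have h2 := h.quadForm_le i (u - y)
  unfold quadModel
  linarith

theorem le_quadForm_sigma0 (h : IsStep c X0 sigma alpha tau Fh Gh S y lam xp lam')
    (hc : c.Admissible) (v : E n) : 0 ≤ quadForm (sigma0 tau S lam) v := by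
  rw [quadForm_sigma0]
  have : ∑ i, lam i * quadForm (S i) v ≤ 0 := by
    refine Finset.sum_nonpos fun i _ => mul_nonpos_of_nonneg_of_nonpos (h.lam_nonneg i) ?_
    have := h.quadForm_le i v
    nlinarith [mul_nonneg (hc.L_pos i).le (sq_nonneg ‖v‖)]
  have := mul_nonneg h.tau_nonneg (sq_nonneg ‖v‖)
  linarith

/-- The condition √p κ_Σ D₀² ≤ ε₀ is used here: after the factor ½, the curvature of Σ₀ consumes
only half of the Slater margin ε₀‖λ‖. -/
theorem quadForm_sigma0_le (h : IsStep c X0 sigma alpha tau Fh Gh S y lam xp lam')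
    (hc : c.Admissible) {z : E n} (hz : z ∈ X0) :
    quadForm (sigma0 tau S lam) (z - y) ≤ c.eps0 * ‖lam‖ + tau * ‖z - y‖ ^ 2 := by
  rw [quadForm_sigma0, ← Finset.sum_neg_distrib]
  have h1 : ∑ i, -(lam i * quadForm (S i) (z - y)) ≤ ∑ i, |lam i| * (c.kS * c.D0 ^ 2) := by
    refine Finset.sum_le_sum fun i _ => ?_
    rw [← mul_neg, abs_of_nonneg (h.lam_nonneg i)]
    refine mul_le_mul_of_nonneg_left ?_ (h.lam_nonneg i)
    refine (neg_le_abs _).trans ((h.abs_quadForm_le i _).trans ?_)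
    exact mul_le_mul_of_nonneg_left
      (pow_le_pow_left₀ (norm_nonneg _) (h.diam_le z hz y h.y_mem) 2) hc.kS_pos.le
  rw [← Finset.sum_mul] at h1
  have h2 := mul_le_mul_of_nonneg_right (sum_abs_le_sqrt_mul_norm lam)
    (mul_nonneg hc.kS_pos.le (sq_nonneg c.D0))
  have h3 := mul_le_mul_of_nonneg_right hc.kS_le (norm_nonneg lam)
  nlinarith

/-- Bounds the nonconvexity error of the three-point inequality. It involves the increment of the
multipliers, not their size, and is therefore O(σ). -/
theorem curvature_loss_le (h : IsStep c X0 sigma alpha tau Fh Gh S y lam xp lam')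
    (hc : c.Admissible) {z : E n} (hz : z ∈ X0) :
    -(c.eps0 * (sigma * c.gamma1)) ≤ ∑ i, (lam' i - lam i) * quadForm (S i) (z - xp) := by
  have h1 : ∑ i, -((lam' i - lam i) * quadForm (S i) (z - xp))
      ≤ ∑ i, |(lam' - lam) i| * (c.kS * c.D0 ^ 2) := by
    refine Finset.sum_le_sum fun i _ => ?_
    refine (neg_le_abs _).trans ?_
    rw [abs_mul]
    refine mul_le_mul_of_nonneg_left ?_ (abs_nonneg _)
    exact (h.abs_quadForm_le i _).trans (mul_le_mul_of_nonneg_left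
      (pow_le_pow_left₀ (norm_nonneg _) (h.diam_le z hz xp h.xp_mem) 2) hc.kS_pos.le)
  rw [← Finset.sum_mul, Finset.sum_neg_distrib] at h1
  have h2 := mul_le_mul_of_nonneg_right (sum_abs_le_sqrt_mul_norm (lam' - lam))
    (mul_nonneg hc.kS_pos.le (sq_nonneg c.D0))
  have h3 := mul_le_mul_of_nonneg_right hc.kS_le (norm_nonneg (lam' - lam))
  have h4 := mul_le_mul_of_nonneg_left (h.norm_sub_le hc) hc.eps0_pos.le
  nlinarith

/-- At the minimizer the positive parts are exactly the updated multipliers, so the augmented term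
becomes a difference of squared norms that telescopes. -/
theorem augLagrangian_xp (h : IsStep c X0 sigma alpha tau Fh Gh S y lam xp lam') :
    augLagrangian sigma (quadModel Fh (sigma0 tau S lam) y)
      (fun i => quadModel (Gh i) (S i) y) lam xp
    = Fh y + inner ℝ (gradient Fh y) (xp - y) + 1 / 2 * quadForm (sigma0 tau S lam) (xp - y)
      + 1 / (2 * sigma) * (‖lam'‖ ^ 2 - ‖lam‖ ^ 2) := by
  rw [norm_sq_eq_sum lam']
  simp only [augLagrangian, h.lam'_eq]
  rfl

/-- Upper bound of the augmented term by replacing the models by larger values. -/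
theorem sum_posPart_sq_le (h : IsStep c X0 sigma alpha tau Fh Gh S y lam xp lam')
    {a b : Fin p → ℝ} (hab : ∀ i, a i ≤ b i) :
    1 / (2 * sigma) * (∑ i, max (lam i + sigma * a i) 0 ^ 2 - ‖lam‖ ^ 2)
      ≤ ∑ i, lam i * b i + sigma / 2 * ∑ i, b i ^ 2 := by
  have hσ := h.sigma_pos
  have h1 : ∑ i, max (lam i + sigma * a i) 0 ^ 2 - ‖lam‖ ^ 2
      ≤ ∑ i, (2 * sigma * (lam i * b i) + sigma ^ 2 * b i ^ 2) := by
    rw [norm_sq_eq_sum, ← Finset.sum_sub_distrib]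
    refine Finset.sum_le_sum fun i _ => ?_
    have h2 : max (lam i + sigma * a i) 0 ≤ max (lam i + sigma * b i) 0 :=
      max_le_max (by nlinarith [hab i]) le_rfl
    have h3 := pow_le_pow_left₀ (le_max_right _ _) h2 2
    have h4 := posPart_sq_le_sq (lam i + sigma * b i)
    nlinarith
  refine (mul_le_mul_of_nonneg_left h1 (by positivity)).trans (le_of_eq ?_)
  simp only [Finset.mul_sum, ← Finset.sum_add_distrib]
  refine Finset.sum_congr rfl fun i _ => ?_
  field_simp

/-- One-step bound for the complementarity violation. -/
theorem complementarity (h : IsStep c X0 sigma alpha tau Fh Gh S y lam xp lam')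
    (hc : c.Admissible) :
    1 / (2 * sigma) * (‖lam'‖ ^ 2 - ‖lam‖ ^ 2)
      ≤ ∑ i, lam i * Gh i y + sigma / 2 * c.nug ^ 2 + c.kf ^ 2 / (2 * alpha) := by
  have hα := h.alpha_pos
  have h0 := isMinOn_iff.1 h.isMinOn _ h.y_mem
  rw [h.augLagrangian_xp] at h0
  have h1 := h.sum_posPart_sq_le (a := fun i => Gh i y) (b := fun i => Gh i y) fun i => le_rfl
  simp only [augLagrangian, quadModel_self, sub_self, norm_zero] at h0
  have h2 := h.le_quadForm_sigma0 hc (xp - y)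
  have h3 := (abs_le.1 (abs_real_inner_le_norm (gradient Fh y) (xp - y))).1
  have h4 := mul_le_mul_of_nonneg_right h.norm_gradF_le (norm_nonneg (xp - y))
  have h5 := mul_le_mul_of_nonneg_left (h.sum_G_sq_le hc h.y_mem)
    (by have := h.sigma_pos; positivity : 0 ≤ sigma / 2)
  -- The maximum over the step length of its linear gain minus the proximal penalty.
  have h6 : c.kf * ‖xp - y‖ - alpha / 2 * ‖xp - y‖ ^ 2 ≤ c.kf ^ 2 / (2 * alpha) := by
    rw [le_div_iff₀ (by positivity)]
    nlinarith [sq_nonneg (c.kf - alpha * ‖xp - y‖)]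
  linarith

/-- These are the multipliers that an iteration without movement would produce; they weight the
first-order change of the augmented term in `norm_move_le`. -/
theorem norm_posPart_le (h : IsStep c X0 sigma alpha tau Fh Gh S y lam xp lam')
    (hc : c.Admissible) :
    ‖(WithLp.toLp 2 fun i => max (lam i + sigma * Gh i y) 0 : E p)‖ ≤ ‖lam‖ + sigma * c.nug := by
  have h1 : ‖(WithLp.toLp 2 fun i => max (lam i + sigma * Gh i y) 0 : E p)‖
      ≤ ‖lam + sigma • (WithLp.toLp 2 fun i => Gh i y : E p)‖ := by
    refine le_of_sq_le_sq ?_ (norm_nonneg _)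
    rw [norm_sq_eq_sum, norm_sq_eq_sum]
    exact Finset.sum_le_sum fun i _ => by simpa using posPart_sq_le_sq (lam i + sigma * Gh i y)
  have h2 : ‖(WithLp.toLp 2 fun i => Gh i y : E p)‖ ≤ c.nug := by
    refine abs_le_of_sq_le_sq' ?_ hc.nug_pos.le |>.2
    rw [norm_sq_eq_sum]; exact h.sum_G_sq_le hc h.y_mem
  refine h1.trans ((norm_add_le _ _).trans ?_)
  rw [norm_smul, Real.norm_eq_abs, abs_of_pos h.sigma_pos]
  have := mul_le_mul_of_nonneg_left h2 h.sigma_pos.le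
  linarith

/-- The length of a step. -/
theorem norm_move_le (h : IsStep c X0 sigma alpha tau Fh Gh S y lam xp lam')
    (hc : c.Admissible) :
    ‖xp - y‖ ≤ 2 / alpha
      * (c.kf + (‖lam‖ + sigma * c.nug) * (√(p : ℝ) * (c.kg + c.kS * c.D0 / 2))) := by
  have hα := h.alpha_pos
  have hσ := h.sigma_pos
  have hκ : 0 ≤ c.kg + c.kS * c.D0 / 2 := by
    have := hc.kg_pos; have := hc.kS_pos; have := hc.D0_pos; positivity
  have h0 := isMinOn_iff.1 h.isMinOn _ h.y_mem
  simp only [augLagrangian, quadModel_self, sub_self, norm_zero] at h0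
  set a : E p := WithLp.toLp 2 fun i => max (lam i + sigma * Gh i y) 0 with ha
  set b : E p := WithLp.toLp 2 fun i => quadModel (Gh i) (S i) y xp - Gh i y with hb
  -- Tangent inequality for [·]₊² at the values that belong to y: the gain of the augmented term is
  -- at most linear in the step length, whereas the proximal penalty is quadratic.
  have h1 : ∑ i, max (lam i + sigma * Gh i y) 0 ^ 2 + 2 * sigma * ∑ i, a i * b i
      ≤ ∑ i, max (lam i + sigma * quadModel (Gh i) (S i) y xp) 0 ^ 2 := by
    rw [Finset.mul_sum, ← Finset.sum_add_distrib]
    refine Finset.sum_le_sum fun i _ => ?_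
    have := le_posPart_sq_add (lam i + sigma * Gh i y)
      (sigma * (quadModel (Gh i) (S i) y xp - Gh i y))
    have e : lam i + sigma * Gh i y + sigma * (quadModel (Gh i) (S i) y xp - Gh i y)
        = lam i + sigma * quadModel (Gh i) (S i) y xp := by ring
    rw [e] at this
    simp only [ha, hb]
    linarith
  have h1' : ∑ i, a i * b i + 1 / (2 * sigma) * (∑ i, max (lam i + sigma * Gh i y) 0 ^ 2 - ‖lam‖ ^ 2)
      ≤ 1 / (2 * sigma)
        * (∑ i, max (lam i + sigma * quadModel (Gh i) (S i) y xp) 0 ^ 2 - ‖lam‖ ^ 2) := by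
    have := mul_le_mul_of_nonneg_left h1 (by positivity : 0 ≤ 1 / (2 * sigma))
    have e : 1 / (2 * sigma) * (2 * sigma * ∑ i, a i * b i) = ∑ i, a i * b i := by
      field_simp
    linarith
  have h2 := (abs_le.1 (abs_sum_mul_le_norm_mul_norm a b)).1
  have h3 : ‖b‖ ≤ √(p : ℝ) * ((c.kg + c.kS * c.D0 / 2) * ‖xp - y‖) :=
    norm_le_sqrt_mul (by positivity) fun i => h.abs_quadModel_sub_le hc h.xp_mem i
  have h4 : ‖a‖ * ‖b‖ ≤ (‖lam‖ + sigma * c.nug)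
      * (√(p : ℝ) * ((c.kg + c.kS * c.D0 / 2) * ‖xp - y‖)) :=
    mul_le_mul (h.norm_posPart_le hc) h3 (norm_nonneg _)
      (by have := hc.nug_pos; positivity)
  have h5 := h.le_quadForm_sigma0 hc (xp - y)
  have h6 := (abs_le.1 (abs_real_inner_le_norm (gradient Fh y) (xp - y))).1
  have h7 := mul_le_mul_of_nonneg_right h.norm_gradF_le (norm_nonneg (xp - y))
  have h8 : quadModel Fh (sigma0 tau S lam) y xp = Fh y + inner ℝ (gradient Fh y) (xp - y)
    + 1 / 2 * quadForm (sigma0 tau S lam) (xp - y) := rfl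
  set K := c.kf + (‖lam‖ + sigma * c.nug) * (√(p : ℝ) * (c.kg + c.kS * c.D0 / 2)) with hK
  have hK0 : 0 ≤ K := by
    have := hc.nug_pos; have := hc.kf_pos; positivity
  have h9 : alpha / 2 * ‖xp - y‖ ^ 2 ≤ K * ‖xp - y‖ := by
    rw [hK]; linarith
  have h10 : alpha / 2 * ‖xp - y‖ ≤ K := by
    rcases (norm_nonneg (xp - y)).eq_or_lt with h0 | h0
    · rw [← h0]; simpa using hK0
    · refine le_of_mul_le_mul_right ?_ h0
      linarith
  rw [div_mul_eq_mul_div, le_div_iff₀ hα]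
  linarith

/-- One-step bound for the constraint violation. -/
theorem constraint_le (h : IsStep c X0 sigma alpha tau Fh Gh S y lam xp lam')
    (hc : c.Admissible) (i : Fin p) :
    Gh i y ≤ (lam' i - lam i) / sigma + (c.kg + c.kS * c.D0 / 2) * ‖xp - y‖ := by
  have h1 := (abs_le.1 (h.abs_quadModel_sub_le hc h.xp_mem i)).1
  have h2 : quadModel (Gh i) (S i) y xp ≤ (lam' i - lam i) / sigma := by
    rw [le_div_iff₀ h.sigma_pos, h.lam'_eq]
    linarith [le_max_left (lam i + sigma * quadModel (Gh i) (S i) y xp) 0]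
  linarith

/-- The drift of the multipliers with respect to a point of `X₀`. -/
theorem drift (h : IsStep c X0 sigma alpha tau Fh Gh S y lam xp lam')
    (hc : c.Admissible) {z : E n} (hz : z ∈ X0) :
    ‖lam'‖ ^ 2 + sigma * (tau + alpha) * ‖z - xp‖ ^ 2
      ≤ ‖lam‖ ^ 2 + sigma * (tau + alpha) * ‖z - y‖ ^ 2
        + 2 * sigma * (c.kf * c.D0 + sigma * c.nug ^ 2 / 2 + c.eps0 * (sigma * c.gamma1) / 2
          + c.eps0 / 2 * ‖lam‖ + ∑ i, lam i * Gh i z) := by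
  have hσ := h.sigma_pos
  have hα := h.alpha_pos
  have h0 := h.three_point hz
  rw [h.augLagrangian_xp] at h0
  have h1 := h.curvature_loss_le hc hz
  have h2 := h.le_quadForm_sigma0 hc (xp - y)
  have h3 := h.quadForm_sigma0_le hc hz
  have h4 := h.sum_posPart_sq_le (a := fun i => quadModel (Gh i) (S i) y z)
    (b := fun i => Gh i z) fun i => h.quadModel_le hz i
  have h5 := mul_le_mul_of_nonneg_left (h.sum_G_sq_le hc hz) (by positivity : 0 ≤ sigma / 2)
  have h6 : inner ℝ (gradient Fh y) (z - y) - inner ℝ (gradient Fh y) (xp - y) ≤ c.kf * c.D0 := by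
    rw [← inner_sub_right, sub_sub_sub_cancel_right]
    exact (real_inner_le_norm _ _).trans (mul_le_mul h.norm_gradF_le
      (h.diam_le z hz xp h.xp_mem) (norm_nonneg _) hc.kf_pos.le)
  simp only [augLagrangian] at h0
  have h7 : quadModel Fh (sigma0 tau S lam) y z = Fh y + inner ℝ (gradient Fh y) (z - y)
    + 1 / 2 * quadForm (sigma0 tau S lam) (z - y) := rfl
  rw [h7] at h0
  have h8 : 0 ≤ alpha / 2 * ‖xp - y‖ ^ 2 := by positivity
  have h9 : 1 / (2 * sigma) * (‖lam'‖ ^ 2 - ‖lam‖ ^ 2) ≤ (tau + alpha) / 2 * ‖z - y‖ ^ 2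
      - (tau + alpha) / 2 * ‖z - xp‖ ^ 2 + (c.kf * c.D0 + sigma * c.nug ^ 2 / 2
      + c.eps0 * (sigma * c.gamma1) / 2 + c.eps0 / 2 * ‖lam‖ + ∑ i, lam i * Gh i z) := by
    linarith
  have h10 := mul_le_mul_of_nonneg_left h9 (by positivity : 0 ≤ 2 * sigma)
  have e : 2 * sigma * (1 / (2 * sigma) * (‖lam'‖ ^ 2 - ‖lam‖ ^ 2)) = ‖lam'‖ ^ 2 - ‖lam‖ ^ 2 := by
    field_simp
  rw [e] at h10
  linarith

/-- The decrease of the distance to a point of `X₀`, in terms of the sampled Lagrangian. -/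
theorem descent (h : IsStep c X0 sigma alpha tau Fh Gh S y lam xp lam')
    (hc : c.Admissible) {z : E n} (hz : z ∈ X0) :
    (tau + alpha) / 2 * (‖z - xp‖ ^ 2 - ‖z - y‖ ^ 2)
      ≤ (Fh z + ∑ i, lam i * Gh i z) - (Fh y + ∑ i, lam i * Gh i y)
        + (c.L0 + ∑ i, lam i * c.L i) / 2 * ‖z - y‖ ^ 2
        + sigma * c.gamma1 ^ 2 / 2 + c.eps0 * (sigma * c.gamma1) / 2
        + (c.kf + √(p : ℝ) * c.kg * ‖lam‖) ^ 2 / (2 * (tau + alpha)) := by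
  have hσ := h.sigma_pos
  have hα := h.alpha_pos
  have hα' : 0 < tau + alpha := add_pos_of_nonneg_of_pos h.tau_nonneg hα
  have h0 := h.three_point hz
  have h1 := h.curvature_loss_le hc hz
  have h4 := h.sum_posPart_sq_le (a := fun i => quadModel (Gh i) (S i) y z)
    (b := fun i => quadModel (Gh i) (S i) y z) fun i => le_rfl
  have h5 : ∑ i, quadModel (Gh i) (S i) y z ^ 2 ≤ c.gamma1 ^ 2 := by
    have := pow_le_pow_left₀ (norm_nonneg _) (h.norm_quadModel_le hc hz) 2
    rwa [norm_sq_eq_sum] at this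
  have h5' := mul_le_mul_of_nonneg_left h5 (by positivity : 0 ≤ sigma / 2)
  -- Tangent inequality at λ ≥ 0: the augmented term is bounded below by the linear Lagrangian term.
  have h6 : ∑ i, lam i * quadModel (Gh i) (S i) y xp ≤ 1 / (2 * sigma)
      * (∑ i, max (lam i + sigma * quadModel (Gh i) (S i) y xp) 0 ^ 2 - ‖lam‖ ^ 2) := by
    have : ∑ i, 2 * sigma * (lam i * quadModel (Gh i) (S i) y xp)
        ≤ ∑ i, max (lam i + sigma * quadModel (Gh i) (S i) y xp) 0 ^ 2 - ‖lam‖ ^ 2 := by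
      rw [norm_sq_eq_sum, ← Finset.sum_sub_distrib]
      refine Finset.sum_le_sum fun i _ => ?_
      have := le_posPart_sq_add (lam i) (sigma * quadModel (Gh i) (S i) y xp)
      rw [max_eq_left (h.lam_nonneg i)] at this
      linarith
    rw [← Finset.mul_sum] at this
    rw [one_div, inv_mul_eq_div, le_div_iff₀ (by positivity)]
    linarith
  have h7 : ∀ u, ∑ i, lam i * quadModel (Gh i) (S i) y u = ∑ i, lam i * Gh i y
      + ∑ i, lam i * inner ℝ (gradient (Gh i) y) (u - y)
      + 1 / 2 * ∑ i, lam i * quadForm (S i) (u - y) := by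
    intro u
    rw [Finset.mul_sum, ← Finset.sum_add_distrib, ← Finset.sum_add_distrib]
    refine Finset.sum_congr rfl fun i _ => ?_
    rw [quadModel]; ring
  -- The curvature -∑λᵢΣᵢ in the model of F cancels that of ∑λᵢqᵢ from `h7`: the model of the
  -- Lagrangian is linear up to the term with τ.
  have h8 : ∀ u, quadModel Fh (sigma0 tau S lam) y u = Fh y + inner ℝ (gradient Fh y) (u - y)
      - 1 / 2 * ∑ i, lam i * quadForm (S i) (u - y) + tau / 2 * ‖u - y‖ ^ 2 := by
    intro u
    rw [quadModel, quadForm_sigma0]; ring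
  simp only [augLagrangian, h8] at h0
  rw [h7] at h6
  rw [h7] at h4
  have h9 : ∑ i, lam i * Gh i y + ∑ i, lam i * inner ℝ (gradient (Gh i) y) (z - y)
      - (∑ i, lam i * c.L i) / 2 * ‖z - y‖ ^ 2 ≤ ∑ i, lam i * Gh i z := by
    rw [Finset.sum_div, Finset.sum_mul, ← Finset.sum_add_distrib, ← Finset.sum_sub_distrib]
    refine Finset.sum_le_sum fun i _ => ?_
    have := mul_le_mul_of_nonneg_left (h.lower_G i z hz) (h.lam_nonneg i)
    linarith
  have h10 := h.lower_F z hz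
  have h11 : -(√(p : ℝ) * c.kg * ‖lam‖ * ‖xp - y‖)
      ≤ ∑ i, lam i * inner ℝ (gradient (Gh i) y) (xp - y) := by
    have h12 : ∑ i, -(lam i * inner ℝ (gradient (Gh i) y) (xp - y))
        ≤ ∑ i, |lam i| * (c.kg * ‖xp - y‖) := by
      refine Finset.sum_le_sum fun i _ => ?_
      refine (neg_le_abs _).trans ?_
      rw [abs_mul]
      refine mul_le_mul_of_nonneg_left ((abs_real_inner_le_norm _ _).trans ?_) (abs_nonneg _)
      exact mul_le_mul_of_nonneg_right (h.norm_gradG_le i) (norm_nonneg _)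
    rw [← Finset.sum_mul, Finset.sum_neg_distrib] at h12
    have := mul_le_mul_of_nonneg_right (sum_abs_le_sqrt_mul_norm lam)
      (mul_nonneg hc.kg_pos.le (norm_nonneg (xp - y)))
    linarith
  have h13 := (abs_le.1 (abs_real_inner_le_norm (gradient Fh y) (xp - y))).1
  have h14 := mul_le_mul_of_nonneg_right h.norm_gradF_le (norm_nonneg (xp - y))
  have h15 : (c.kf + √(p : ℝ) * c.kg * ‖lam‖) * ‖xp - y‖ - (tau + alpha) / 2 * ‖xp - y‖ ^ 2
      ≤ (c.kf + √(p : ℝ) * c.kg * ‖lam‖) ^ 2 / (2 * (tau + alpha)) := by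
    rw [le_div_iff₀ (by positivity)]
    nlinarith [sq_nonneg ((c.kf + √(p : ℝ) * c.kg * ‖lam‖) - (tau + alpha) * ‖xp - y‖)]
  linarith

end IsStep

/-! ### Weak convexity and its stability under expectation. -/

theorem norm_gradient {n : ℕ} (h : E n → ℝ) (x : E n) : ‖gradient h x‖ = ‖fderiv ℝ h x‖ := by
  simp [gradient]

theorem inner_gradient {n : ℕ} (h : E n → ℝ) (x w : E n) :
    inner ℝ (gradient h x) w = fderiv ℝ h x w := by
  simp [gradient]

/-- A weakly convex function lies above its lower quadratic models. -/
theorem WeaklyConvexOn.lower_model {n : ℕ} {ρ : ℝ} {s : Set (E n)} {h : E n → ℝ}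
    (hh : WeaklyConvexOn ρ s h) {y z : E n} (hy : y ∈ s) (hz : z ∈ s)
    (hd : DifferentiableAt ℝ h y) :
    h y + inner ℝ (gradient h y) (z - y) - ρ / 2 * ‖z - y‖ ^ 2 ≤ h z := by
  have hl : ∀ s : ℝ, AffineMap.lineMap (k := ℝ) y z s = y + s • (z - y) := fun s => by
    rw [AffineMap.lineMap_apply_module']; abel
  have hnorm : ∀ s : ℝ, ‖y + s • (z - y)‖ ^ 2
      = ‖y‖ ^ 2 + 2 * (s * inner ℝ y (z - y)) + s ^ 2 * ‖z - y‖ ^ 2 := fun s => by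
    rw [norm_add_sq_real, inner_smul_right, norm_smul, mul_pow, Real.norm_eq_abs, sq_abs]
  -- On the line from y to z the function h + (ρ/2)‖·‖² is convex, so its derivative at y is at most
  -- the slope of the chord; expanding the squares gives the claim.
  have hconv := ConvexOn.comp_affineMap (AffineMap.lineMap (k := ℝ) y z) hh
  have hderiv : HasDerivAt ((fun x => h x + ρ / 2 * ‖x‖ ^ 2) ∘ AffineMap.lineMap (k := ℝ) y z)
      (inner ℝ (gradient h y) (z - y) + ρ / 2 * (2 * inner ℝ y (z - y))) 0 := by
    have h1 : HasDerivAt (fun s : ℝ => h (y + s • (z - y))) (inner ℝ (gradient h y) (z - y)) 0 := by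
      rw [inner_gradient]
      have h2 : HasDerivAt (fun s : ℝ => y + s • (z - y)) (z - y) 0 := by
        simpa using ((hasDerivAt_id (0 : ℝ)).smul_const (z - y)).const_add y
      have h3 : HasFDerivAt h (fderiv ℝ h y) (y + (0 : ℝ) • (z - y)) := by
        simpa using hd.hasFDerivAt
      exact h3.comp_hasDerivAt 0 h2
    have h2 : HasDerivAt (fun s : ℝ => ρ / 2 * ‖y + s • (z - y)‖ ^ 2)
        (ρ / 2 * (2 * inner ℝ y (z - y))) 0 := by
      simp only [hnorm]
      refine HasDerivAt.const_mul _ ?_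
      have h3 := (((hasDerivAt_id (0 : ℝ)).mul_const (inner ℝ y (z - y))).const_mul 2).const_add
        (‖y‖ ^ 2)
      have h4 := ((hasDerivAt_id (0 : ℝ)).pow 2).mul_const (‖z - y‖ ^ 2)
      have h5 := h3.add h4
      simp only [one_mul, id_eq, Nat.cast_ofNat, Nat.add_one_sub_one, pow_one, mul_zero, zero_mul,
        add_zero] at h5
      exact h5
    refine (h1.add h2).congr_of_eventuallyEq (Filter.Eventually.of_forall fun s => ?_)
    simp [hl]
  have h1 := hconv.le_slope_of_hasDerivAt (x := 0) (y := 1) (by simpa using hy) (by simpa using hz)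
    one_pos hderiv
  rw [slope_def_field] at h1
  have h2 := hnorm 1
  rw [one_smul, add_sub_cancel] at h2
  simp only [Function.comp_apply, AffineMap.lineMap_apply_zero, AffineMap.lineMap_apply_one, h2]
    at h1
  linarith

theorem abs_integral_le_of_forall_abs_le {Ξ : Type*} [MeasurableSpace Ξ] {P : Measure Ξ}
    [IsProbabilityMeasure P] {h : Ξ → ℝ} {C : ℝ} (hC : ∀ z, |h z| ≤ C) : |∫ z, h z ∂P| ≤ C := by
  have := norm_integral_le_of_norm_le_const (μ := P) (f := h) (C := C)
    (Filter.Eventually.of_forall hC)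
  simpa using this

theorem WeaklyConvexOn.mono {n : ℕ} {ρ : ℝ} {s t : Set (E n)} {h : E n → ℝ}
    (hh : WeaklyConvexOn ρ t h) (hst : s ⊆ t) (hs : Convex ℝ s) : WeaklyConvexOn ρ s h :=
  ConvexOn.subset hh hst hs

theorem WeaklyConvexOn.integral {n : ℕ} {Ξ : Type*} [MeasurableSpace Ξ] {P : Measure Ξ}
    [IsProbabilityMeasure P] {ρ : ℝ} {s : Set (E n)} {H : E n → Ξ → ℝ} (hs : Convex ℝ s)
    (hi : ∀ x ∈ s, Integrable (H x) P) (hH : ∀ z, WeaklyConvexOn ρ s fun x => H x z) :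
    WeaklyConvexOn ρ s fun x => ∫ z, H x z ∂P := by
  have key : ∀ x ∈ s, ∫ z, H x z ∂P + ρ / 2 * ‖x‖ ^ 2 = ∫ z, (H x z + ρ / 2 * ‖x‖ ^ 2) ∂P := by
    intro x hx
    rw [integral_add (hi x hx) (integrable_const _)]
    simp
  refine ⟨hs, fun x hx y hy a b ha hb hab => ?_⟩
  have hxy := hs hx hy ha hb hab
  dsimp only
  have hx' : Integrable (fun z => H x z + ρ / 2 * ‖x‖ ^ 2) P := (hi x hx).add (integrable_const _)
  have hy' : Integrable (fun z => H y z + ρ / 2 * ‖y‖ ^ 2) P := (hi y hy).add (integrable_const _)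
  rw [key _ hxy, key _ hx, key _ hy, smul_eq_mul, smul_eq_mul, ← integral_const_mul,
    ← integral_const_mul, ← integral_add (hx'.const_mul a) (hy'.const_mul b)]
  refine integral_mono ((hi _ hxy).add (integrable_const _))
    ((hx'.const_mul a).add (hy'.const_mul b)) fun z => ?_
  exact (hH z).2 hx hy ha hb hab

/-! ### Lipschitz bounds and weak convexity of the expected functions. -/

namespace Assumptions

set_option linter.unusedSectionVars false

variable {n p : ℕ} {Ξ : Type*} [MeasurableSpace Ξ] {P : Measure Ξ} [IsProbabilityMeasure P]
  {Q : Problem n p Ξ} {c : Consts p}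

theorem abs_F_sub_le (hQ : Assumptions Q P c) {x y : E n} (hx : x ∈ Q.O0) (hy : y ∈ Q.O0) (z : Ξ) :
    |Q.F x z - Q.F y z| ≤ c.kf * ‖x - y‖ :=
  hQ.convex_O0.norm_image_sub_le_of_norm_fderiv_le (𝕜 := ℝ) (f := fun u => Q.F u z)
    (fun u hu => hQ.differentiable_F z u hu)
    (fun u hu => by rw [← norm_gradient]; exact hQ.norm_gradF_le u hu z) hy hx

theorem abs_G_sub_le (hQ : Assumptions Q P c) (i : Fin p) {x y : E n} (hx : x ∈ Q.O0)
    (hy : y ∈ Q.O0) (z : Ξ) : |Q.G i x z - Q.G i y z| ≤ c.kg * ‖x - y‖ :=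
  hQ.convex_O0.norm_image_sub_le_of_norm_fderiv_le (𝕜 := ℝ) (f := fun u => Q.G i u z)
    (fun u hu => hQ.differentiable_G i z u hu)
    (fun u hu => by rw [← norm_gradient]; exact hQ.norm_gradG_le i u hu z) hy hx

theorem abs_sum_mul_G_le (hQ : Assumptions Q P c) {x : E n} (hx : x ∈ Q.O0) (u : E p) (z : Ξ) :
    |∑ i, u i * Q.G i x z| ≤ ‖u‖ * c.nug := by
  refine (abs_sum_mul_le_norm_mul_norm u (WithLp.toLp 2 fun i => Q.G i x z)).trans ?_
  refine mul_le_mul_of_nonneg_left ?_ (norm_nonneg u)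
  rw [EuclideanSpace.norm_eq]
  simpa using hQ.norm_G_le x hx z

theorem abs_G_le (hQ : Assumptions Q P c) (i : Fin p) {x : E n} (hx : x ∈ Q.O0) (z : Ξ) :
    |Q.G i x z| ≤ c.nug := by
  have h := hQ.norm_G_le x hx z
  rw [Real.sqrt_le_left hQ.nug_pos.le] at h
  exact abs_le_of_sq_le_sq ((Finset.single_le_sum (f := fun i => Q.G i x z ^ 2)
    (fun i _ => sq_nonneg _) (Finset.mem_univ i)).trans h) hQ.nug_pos.le

theorem abs_f_sub_le (hQ : Assumptions Q P c) {x y : E n} (hx : x ∈ Q.O0) (hy : y ∈ Q.O0) :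
    |Q.f P x - Q.f P y| ≤ c.kf * ‖x - y‖ := by
  rw [Problem.f, Problem.f, ← integral_sub (hQ.integrable_F x hx) (hQ.integrable_F y hy)]
  exact abs_integral_le_of_forall_abs_le fun z => hQ.abs_F_sub_le hx hy z

theorem abs_g_sub_le (hQ : Assumptions Q P c) (i : Fin p) {x y : E n} (hx : x ∈ Q.O0)
    (hy : y ∈ Q.O0) : |Q.g P i x - Q.g P i y| ≤ c.kg * ‖x - y‖ := by
  rw [Problem.g, Problem.g, ← integral_sub (hQ.integrable_G i x hx) (hQ.integrable_G i y hy)]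
  exact abs_integral_le_of_forall_abs_le fun z => hQ.abs_G_sub_le i hx hy z

theorem abs_g_le (hQ : Assumptions Q P c) (i : Fin p) {x : E n} (hx : x ∈ Q.O0) :
    |Q.g P i x| ≤ c.nug := by
  exact abs_integral_le_of_forall_abs_le fun z => hQ.abs_G_le i hx z

theorem sum_mul_g (hQ : Assumptions Q P c) {x : E n} (hx : x ∈ Q.O0) (u : E p) :
    ∑ i, u i * Q.g P i x = ∫ z, ∑ i, u i * Q.G i x z ∂P := by
  rw [integral_finsetSum _ fun i _ => (hQ.integrable_G i x hx).const_mul _]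
  simp_rw [integral_const_mul]
  rfl

theorem abs_sum_mul_g_le (hQ : Assumptions Q P c) {x : E n} (hx : x ∈ Q.O0) (u : E p) :
    |∑ i, u i * Q.g P i x| ≤ ‖u‖ * c.nug := by
  rw [hQ.sum_mul_g hx]
  exact abs_integral_le_of_forall_abs_le fun z => hQ.abs_sum_mul_G_le hx u z

theorem lagrangian_eq_integral (hQ : Assumptions Q P c) {x : E n} (hx : x ∈ Q.O0) (u : E p) :
    Q.lagrangian P x u = ∫ z, (Q.F x z + ∑ i, u i * Q.G i x z) ∂P := by
  rw [Problem.lagrangian, hQ.sum_mul_g hx, Problem.f, integral_add (hQ.integrable_F x hx)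
    (integrable_finsetSum _ fun i _ => (hQ.integrable_G i x hx).const_mul _)]

/-- Expectation preserves the modulus, and nonnegative weights add the moduli; hence the sign
condition on the multipliers. -/
theorem weaklyConvexOn_lagrangian (hQ : Assumptions Q P c) {u : E p} (hu : ∀ i, 0 ≤ u i) :
    WeaklyConvexOn (c.L0 + ∑ i, u i * c.L i) Q.X0 fun x => Q.lagrangian P x u := by
  have hf : WeaklyConvexOn c.L0 Q.O0 (Q.f P) :=
    WeaklyConvexOn.integral hQ.convex_O0 hQ.integrable_F hQ.weaklyConvex_F
  have hg : ∀ i, WeaklyConvexOn (c.L i) Q.O0 (Q.g P i) := fun i =>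
    WeaklyConvexOn.integral hQ.convex_O0 (hQ.integrable_G i) (hQ.weaklyConvex_G i)
  have hsum : ∀ s : Finset (Fin p), ConvexOn ℝ Q.O0
      fun x => ∑ i ∈ s, u i * (Q.g P i x + c.L i / 2 * ‖x‖ ^ 2) := by
    intro s
    induction s using Finset.induction_on with
    | empty => simpa using convexOn_const 0 hQ.convex_O0
    | insert i s hi ih =>
      simp only [Finset.sum_insert hi]
      exact ((hg i).smul (hu i)).add ih
  refine WeaklyConvexOn.mono ?_ hQ.subset hQ.convex_X0
  refine (ConvexOn.add hf (hsum Finset.univ)).congr fun x _ => ?_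
  simp only [Pi.add_apply, Problem.lagrangian, mul_add, Finset.sum_add_distrib]
  have : ∑ i, u i * (c.L i / 2 * ‖x‖ ^ 2) = (∑ i, u i * c.L i) / 2 * ‖x‖ ^ 2 := by
    rw [Finset.sum_div, Finset.sum_mul]
    exact Finset.sum_congr rfl fun i _ => by ring
  rw [this]; ring

theorem continuousOn_lagrangian (hQ : Assumptions Q P c) (u : E p) :
    ContinuousOn (fun x => Q.lagrangian P x u) Q.X0 := by
  have hlip : ∀ {k : ℝ} {h : E n → ℝ}, 0 ≤ k →
      (∀ x ∈ Q.X0, ∀ y ∈ Q.X0, |h x - h y| ≤ k * ‖x - y‖) → ContinuousOn h Q.X0 := by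
    intro k h hk hh
    refine (LipschitzOnWith.of_dist_le_mul (K := ⟨k, hk⟩) fun x hx y hy => ?_).continuousOn
    rw [Real.dist_eq, dist_eq_norm]
    exact hh x hx y hy
  refine ContinuousOn.add (hlip hQ.kf_pos.le fun x hx y hy =>
    hQ.abs_f_sub_le (hQ.subset hx) (hQ.subset hy)) (continuousOn_finsetSum _ fun i _ => ?_)
  exact continuousOn_const.mul (hlip hQ.kg_pos.le fun x hx y hy =>
    hQ.abs_g_sub_le i (hQ.subset hx) (hQ.subset hy))

theorem bddBelow_f (hQ : Assumptions Q P c) : BddBelow (Q.f P '' Q.X0) := by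
  obtain ⟨w, hw, -⟩ := hQ.slater
  refine ⟨Q.f P w - c.kf * c.D0, ?_⟩
  rintro _ ⟨x, hx, rfl⟩
  have h1 := (abs_le.1 (hQ.abs_f_sub_le (hQ.subset hx) (hQ.subset hw))).1
  have h2 := mul_le_mul_of_nonneg_left (hQ.diam_le x hx w hw) hQ.kf_pos.le
  linarith

theorem isCompact_X0 (hQ : Assumptions Q P c) : IsCompact Q.X0 := by
  obtain ⟨w, hw, -⟩ := hQ.slater
  refine Metric.isCompact_of_isClosed_isBounded hQ.closed_X0
    (Metric.isBounded_closedBall (x := w) (r := c.D0) |>.subset fun x hx => ?_)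
  rw [Metric.mem_closedBall, dist_eq_norm]
  exact hQ.diam_le x hx w hw

theorem admissible (hQ : Assumptions Q P c) (hp : 1 ≤ p) (hkS_pos : 0 < c.kS)
    (hkS : √(p : ℝ) * c.kS * c.D0 ^ 2 ≤ c.eps0) : c.Admissible where
  D0_pos := hQ.D0_pos
  nug_pos := hQ.nug_pos
  kf_pos := hQ.kf_pos
  kg_pos := hQ.kg_pos
  eps0_pos := hQ.eps0_pos
  L0_pos := hQ.L0_pos
  L_pos := hQ.L_pos
  kS_pos := hkS_pos
  kS_le := hkS
  -- There is at least one constraint, and its value at the Slater point lies between -ν_g and -ε₀.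
  eps0_le := by
    obtain ⟨w, hw, h⟩ := hQ.slater
    have h1 := h ⟨0, hp⟩
    have h2 := (abs_le.1 (hQ.abs_g_le ⟨0, hp⟩ (hQ.subset hw))).1
    linarith

end Assumptions

/-! ### Proximal points and the Moreau envelope. -/

/-- `z` is a proximal point of `h + δ_X` at `x`. -/
structure IsProx {n : ℕ} (X : Set (E n)) (h : E n → ℝ) (α : ℝ) (x z : E n) : Prop where
  mem : z ∈ X
  le : ∀ u ∈ X, h z + α / 2 * ‖z - x‖ ^ 2 ≤ h u + α / 2 * ‖u - x‖ ^ 2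

theorem exists_isProx {n : ℕ} {X : Set (E n)} {h : E n → ℝ} (hX : IsCompact X)
    (hne : X.Nonempty) (hh : ContinuousOn h X) (α : ℝ) (x : E n) : ∃ z, IsProx X h α x z := by
  have hc : ContinuousOn (fun u => h u + α / 2 * ‖u - x‖ ^ 2) X :=
    hh.add (by fun_prop)
  obtain ⟨z, hz, hmin⟩ := hX.exists_isMinOn hne hc
  exact ⟨z, hz, fun u hu => isMinOn_iff.1 hmin u hu⟩

namespace IsProx

variable {n : ℕ} {X : Set (E n)} {h h' : E n → ℝ} {α ρ ρ' : ℝ} {x x' z z' : E n}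

/-- Quadratic growth at a proximal point. -/
theorem growth (hz : IsProx X h α x z) (hh : WeaklyConvexOn ρ X h) {u : E n} (hu : u ∈ X) :
    h z + α / 2 * ‖z - x‖ ^ 2 + (α - ρ) / 2 * ‖u - z‖ ^ 2 ≤ h u + α / 2 * ‖u - x‖ ^ 2 := by
  have key : 0 ≤ (h u + α / 2 * ‖u - x‖ ^ 2) - (h z + α / 2 * ‖z - x‖ ^ 2)
      - (α - ρ) / 2 * ‖u - z‖ ^ 2 := by
    -- Compare z with points of the segment towards u: the objective is (α-ρ)-strongly convex, and
    -- the surplus s²(α-ρ)/2·‖u-z‖² is the quadratic error.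
    refine nonneg_of_forall_le_linear_add_sq (C := (α - ρ) / 2 * ‖u - z‖ ^ 2) fun s hs hs1 => ?_
    have h1 := hh.2 hz.mem hu (sub_nonneg.2 hs1) hs.le (by ring)
    have h2 := hz.le _ (hh.1 hz.mem hu (sub_nonneg.2 hs1) hs.le (by ring))
    simp only [smul_eq_mul] at h1
    have e1 : ‖(1 - s) • z + s • u‖ ^ 2
        = (1 - s) * ‖z‖ ^ 2 + s * ‖u‖ ^ 2 - s * (1 - s) * ‖u - z‖ ^ 2 := by
      rw [norm_add_sq_real, norm_sub_sq_real, inner_smul_left, inner_smul_right, norm_smul,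
        norm_smul, mul_pow, mul_pow, Real.norm_eq_abs, Real.norm_eq_abs, sq_abs, sq_abs,
        real_inner_comm u z]
      simp only [conj_trivial]
      ring
    have e2 : ‖(1 - s) • z + s • u - x‖ ^ 2
        = (1 - s) * ‖z - x‖ ^ 2 + s * ‖u - x‖ ^ 2 - s * (1 - s) * ‖u - z‖ ^ 2 := by
      have e3 : (1 - s) • z + s • u - x = (1 - s) • (z - x) + s • (u - x) := by
        rw [smul_sub, smul_sub, sub_smul, sub_smul, one_smul, one_smul]; abel
      have e4 : u - z = (u - x) - (z - x) := by abel
      rw [e3, e4]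
      generalize z - x = a
      generalize u - x = b
      rw [norm_add_sq_real, norm_sub_sq_real, inner_smul_left, inner_smul_right, norm_smul,
        norm_smul, mul_pow, mul_pow, Real.norm_eq_abs, Real.norm_eq_abs, sq_abs, sq_abs,
        real_inner_comm b a]
      simp only [conj_trivial]
      ring
    rw [e1] at h1
    rw [e2] at h2
    nlinarith
  linarith

/-- Stability of proximal points with respect to the function and the centre. -/
theorem stability (hz : IsProx X h α x z) (hz' : IsProx X h' α x' z') (hh : WeaklyConvexOn ρ X h)
    (hh' : WeaklyConvexOn ρ' X h') (hρ : ρ ≤ α / 2) (hρ' : ρ' ≤ α / 2) :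
    α / 2 * ‖z - z'‖ ^ 2
      ≤ (h z' - h' z') - (h z - h' z) + α * inner ℝ (z - z') (x - x') := by
  have h1 := hz.growth hh hz'.mem
  have h2 := hz'.growth hh' hz.mem
  have e : ‖z' - x‖ ^ 2 - ‖z - x‖ ^ 2 + ‖z - x'‖ ^ 2 - ‖z' - x'‖ ^ 2
      = 2 * inner ℝ (z - z') (x - x') := by
    simp only [norm_sub_sq_real, inner_sub_left, inner_sub_right]
    ring
  rw [norm_sub_rev z' z] at h1
  -- Each growth inequality contributes at least α/4, since ρ, ρ' ≤ α/2. Their sum cancels the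
  -- squared distances to the centres except for the inner product in `e`.
  have h3 := mul_le_mul_of_nonneg_right (by linarith : α / 4 ≤ (α - ρ) / 2) (sq_nonneg ‖z - z'‖)
  have h4 := mul_le_mul_of_nonneg_right (by linarith : α / 4 ≤ (α - ρ') / 2) (sq_nonneg ‖z - z'‖)
  have h5 := congrArg (fun r => α / 2 * r) e
  linarith

theorem norm_sub_le (hz : IsProx X h α x z) (hz' : IsProx X h α x' z') (hα : 0 < α)
    (hh : WeaklyConvexOn ρ X h) (hρ : ρ ≤ α / 2) : ‖z - z'‖ ≤ 2 * ‖x - x'‖ := by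
  have h1 := hz.stability hz' hh hh hρ hρ
  have h2 := mul_le_mul_of_nonneg_left (real_inner_le_norm (z - z') (x - x')) hα.le
  rcases (norm_nonneg (z - z')).eq_or_lt with h0 | h0
  · rw [← h0]; positivity
  · refine le_of_mul_le_mul_left ?_ (mul_pos hα h0)
    nlinarith

theorem moreauEnvelope_eq (hz : IsProx X h α x z) :
    moreauEnvelope X h (1 / α) x = h z + α / 2 * ‖z - x‖ ^ 2 := by
  have e : ∀ u : E n, h u + 1 / (2 * (1 / α)) * ‖u - x‖ ^ 2 = h u + α / 2 * ‖u - x‖ ^ 2 := by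
    intro u
    congr 2
    rw [← mul_div_assoc, mul_one, one_div_div]
  unfold moreauEnvelope
  simp only [e]
  have : Nonempty X := ⟨⟨z, hz.mem⟩⟩
  refine le_antisymm ?_ (le_ciInf fun u => hz.le u u.2)
  exact ciInf_le ⟨h z + α / 2 * ‖z - x‖ ^ 2, by rintro _ ⟨u, rfl⟩; exact hz.le u u.2⟩
    (⟨z, hz.mem⟩ : X)

/-- The gradient of the Moreau envelope. -/
theorem hasGradientAt (hz : IsProx X h α x z) (hα : 0 < α) (hh : WeaklyConvexOn ρ X h)
    (hρ : ρ ≤ α / 2) (hex : ∀ x', ∃ z', IsProx X h α x' z') :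
    HasGradientAt (moreauEnvelope X h (1 / α)) (α • (x - z)) x := by
  have hexp : ∀ u v : E n, ‖u - v‖ ^ 2
      = ‖u - x‖ ^ 2 + 2 * inner ℝ (x - u) (v - x) + ‖v - x‖ ^ 2 := by
    intro u v
    have e1 : u - v = (u - x) - (v - x) := by abel
    have e2 : x - u = -(u - x) := by abel
    rw [e1, e2, norm_sub_sq_real, inner_neg_left]; ring
  -- Using each proximal point as competitor for the other centre squeezes the linearization error
  -- from both sides. The bounds are quadratic because the proximal map is 2-Lipschitz.
  have hbound : ∀ v, |moreauEnvelope X h (1 / α) v - moreauEnvelope X h (1 / α) x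
      - inner ℝ (α • (x - z)) (v - x)| ≤ 3 * α * ‖v - x‖ ^ 2 := by
    intro v
    obtain ⟨w, hw⟩ := hex v
    rw [hw.moreauEnvelope_eq, hz.moreauEnvelope_eq, inner_smul_left]
    simp only [conj_trivial]
    have h1 := hw.le z hz.mem
    have h2 := hz.le w hw.mem
    rw [hexp z v] at h1
    rw [hexp w v]
    rw [hexp w v] at h1
    have h3 := hw.norm_sub_le hz hα hh hρ
    have h4 : |inner ℝ (w - z) (v - x)| ≤ 2 * ‖v - x‖ ^ 2 :=
      (abs_real_inner_le_norm _ _).trans (by nlinarith [norm_nonneg (v - x)])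
    have h5 : (inner ℝ (x - w) (v - x) : ℝ) = inner ℝ (x - z) (v - x) - inner ℝ (w - z) (v - x) := by
      rw [← inner_sub_left]; congr 1; abel
    have h6 := mul_le_mul_of_nonneg_left (abs_le.1 h4).1 hα.le
    have h7 := mul_le_mul_of_nonneg_left (abs_le.1 h4).2 hα.le
    have h8 := mul_nonneg hα.le (sq_nonneg ‖v - x‖)
    rw [h5] at h1 ⊢
    rw [abs_le]
    constructor <;> nlinarith
  rw [hasGradientAt_iff_isLittleO]
  refine Asymptotics.IsBigO.trans_isLittleO (g := fun v => ‖v - x‖ ^ 2) ?_ ?_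
  · refine Asymptotics.IsBigO.of_bound (3 * α) (Filter.Eventually.of_forall fun v => ?_)
    rw [Real.norm_eq_abs, Real.norm_eq_abs, abs_of_nonneg (sq_nonneg ‖v - x‖)]
    exact hbound v
  · have h0 : Filter.Tendsto (fun v : E n => v - x) (nhds x) (nhds 0) := by
      have : Filter.Tendsto (fun v : E n => v - x) (nhds x) (nhds (x - x)) :=
        (continuous_id.sub continuous_const).tendsto x
      rwa [sub_self] at this
    exact (Asymptotics.isLittleO_norm_pow_id one_lt_two).comp_tendsto h0

end IsProx

/-! ### Independence of the next sample from the past. -/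

section Sampling

variable {Ω Ξ : Type*} [mΩ : MeasurableSpace Ω] [mΞ : MeasurableSpace Ξ] {ξ : ℕ → Ω → Ξ}
  {P : Measure Ξ} {μ : Measure Ω}

theorem IsIIDSample.history_le (hξ : IsIIDSample ξ P μ) (t : ℕ) : history ξ t ≤ mΩ :=
  iSup₂_le fun s hs => (hξ.measurable s hs.1).comap_le

/-- Disjoint blocks of an independent family are independent. Samples are numbered from 1, so the
history consists of the indices i+1 with i < k. -/
theorem IsIIDSample.indep_history (hξ : IsIIDSample ξ P μ) (k : ℕ) :
    Indep (history ξ k) (mΞ.comap (ξ (k + 1))) μ := by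
  have h1 := indep_iSup_of_disjoint (m := fun i => mΞ.comap (ξ (i + 1)))
    (fun i => (hξ.measurable (i + 1) (by omega)).comap_le) hξ.indep
    (S := {i | i < k}) (T := {k}) (by simp)
  refine indep_of_indep_of_le_left (indep_of_indep_of_le_right h1 (by simp)) ?_
  refine iSup₂_le fun s hs => ?_
  obtain ⟨i, rfl⟩ : ∃ i, s = i + 1 := ⟨s - 1, by have := hs.1; omega⟩
  exact le_iSup₂_of_le (f := fun i (_ : i ∈ {i | i < k}) => mΞ.comap (ξ (i + 1))) i
    (show i < k by have := hs.2; omega) le_rfl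

/-- Integrating out a sample that is independent of the past. -/
theorem IsIIDSample.integral_fresh [IsProbabilityMeasure μ] [IsProbabilityMeasure P]
    (hξ : IsIIDSample ξ P μ) {k : ℕ}
    {S : Type*} [MeasurableSpace S] {X : Ω → S} (hX : Measurable[history ξ k] X)
    {h : S → Ξ → ℝ} (hh : Measurable (Function.uncurry h)) {C : ℝ}
    (hC : ∀ ω z, |h (X ω) z| ≤ C) :
    Integrable (fun ω => h (X ω) (ξ (k + 1) ω)) μ ∧
    Integrable (fun ω => ∫ z, h (X ω) z ∂P) μ ∧
    ∫ ω, h (X ω) (ξ (k + 1) ω) ∂μ = ∫ ω, ∫ z, h (X ω) z ∂P ∂μ := by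
  have hXm : Measurable X := hX.mono (hξ.history_le k) le_rfl
  have hξm : Measurable (ξ (k + 1)) := hξ.measurable _ (by omega)
  have hind : IndepFun X (ξ (k + 1)) μ := by
    rw [IndepFun_iff_Indep]
    exact indep_of_indep_of_le_left (hξ.indep_history k) hX.comap_le
  have hmap := (indepFun_iff_map_prod_eq_prod_map_map hXm.aemeasurable hξm.aemeasurable).1 hind
  rw [hξ.law (k + 1) (by omega)] at hmap
  have hpair : Measurable fun ω => (X ω, ξ (k + 1) ω) := hXm.prodMk hξm
  have hint : Integrable (fun ω => h (X ω) (ξ (k + 1) ω)) μ :=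
    Integrable.of_bound (hh.comp hpair).aestronglyMeasurable C
      (Filter.Eventually.of_forall fun ω => hC ω _)
  have : IsProbabilityMeasure (μ.map X) := Measure.isProbabilityMeasure_map hXm.aemeasurable
  -- The bound on h is known only along the values of X, so integrability for the product law is
  -- pulled back from Ω through the joint law.
  have hint' : Integrable (Function.uncurry h) ((μ.map X).prod P) := by
    rw [← hmap, integrable_map_measure hh.aestronglyMeasurable hpair.aemeasurable]
    exact hint
  have hinner := hint'.integral_prod_left
  refine ⟨hint, ?_, ?_⟩
  · exact (integrable_map_measure hinner.aestronglyMeasurable hXm.aemeasurable).1 hinner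
  · have h1 := integral_map hpair.aemeasurable (f := Function.uncurry h) (μ := μ)
      hh.aestronglyMeasurable
    rw [hmap, integral_prod _ hint', integral_map hXm.aemeasurable hinner.aestronglyMeasurable]
      at h1
    exact h1.symm

end Sampling

/-! ### Joint measurability of the sampled functions. -/

section Caratheodory

variable {n p : ℕ} {Ξ : Type*} [MeasurableSpace Ξ] {P : Measure Ξ} {Q : Problem n p Ξ}
  {c : Consts p}

/-- A Carathéodory function: continuous in the point, measurable in the sample. The point ranges
over the subtype X₀, because nothing is known off O₀. -/
theorem Assumptions.measurable_uncurry_F (hQ : Assumptions Q P c) :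
    Measurable fun q : Q.X0 × Ξ => Q.F q.1 q.2 := by
  refine measurable_uncurry_of_continuous_of_measurable (u := fun (y : Q.X0) z => Q.F y z)
    (fun z => ?_) fun y => hQ.measurable_F y (hQ.subset y.2)
  refine continuous_iff_continuousAt.2 fun y => ?_
  exact ContinuousAt.comp (f := ((↑) : Q.X0 → E n)) (g := fun u => Q.F u z)
    (hQ.differentiable_F z y (hQ.subset y.2)).continuousAt continuous_subtype_val.continuousAt

theorem Assumptions.measurable_uncurry_G (hQ : Assumptions Q P c) (i : Fin p) :
    Measurable fun q : Q.X0 × Ξ => Q.G i q.1 q.2 := by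
  refine measurable_uncurry_of_continuous_of_measurable (u := fun (y : Q.X0) z => Q.G i y z)
    (fun z => ?_) fun y => hQ.measurable_G i y (hQ.subset y.2)
  refine continuous_iff_continuousAt.2 fun y => ?_
  exact ContinuousAt.comp (f := ((↑) : Q.X0 → E n)) (g := fun u => Q.G i u z)
    (hQ.differentiable_G i z y (hQ.subset y.2)).continuousAt continuous_subtype_val.continuousAt

end Caratheodory

/-! ### Runs of the method: pathwise bounds and measurability. -/

/-- `T` iterations of the method, started at `(x1, 0)`, for which the estimates of a single
iteration are available. -/
structure IsBoundedRun {n p : ℕ} {Ω Ξ : Type*} [MeasurableSpace Ω] [MeasurableSpace Ξ]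
    (μ : Measure Ω) (P : Measure Ξ) (Q : Problem n p Ξ) (c : Consts p) (ξ : ℕ → Ω → Ξ)
    (T : ℕ) (sigma alpha tau : ℝ) (Sig : ℕ → Fin p → Ω → Matrix (Fin n) (Fin n) ℝ)
    (x1 : E n) (x : ℕ → Ω → E n) (lam : ℕ → Ω → E p) : Prop where
  assumptions : Assumptions Q P c
  sample : IsIIDSample ξ P μ
  admissible : c.Admissible
  sigma_pos : 0 < sigma
  alpha_pos : 0 < alpha
  tau_nonneg : 0 ≤ tau
  x_one : ∀ ω, x 1 ω = x1
  lam_one : ∀ ω, lam 1 ω = 0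
  x_mem : ∀ t ≤ T, ∀ ω, x (t + 1) ω ∈ Q.X0
  measurable_x : ∀ t ≤ T, Measurable[history ξ t] (x (t + 1))
  measurable_lam : ∀ t ≤ T, Measurable[history ξ t] (lam (t + 1))
  step : ∀ t < T, ∀ ω, IsStep c Q.X0 sigma alpha tau (fun u => Q.F u (ξ (t + 1) ω))
    (fun i u => Q.G i u (ξ (t + 1) ω)) (fun i => Sig (t + 1) i ω) (x (t + 1) ω) (lam (t + 1) ω)
    (x (t + 2) ω) (lam (t + 2) ω)

section Run

variable {n p : ℕ} {Ω Ξ : Type*} [MeasurableSpace Ω] [MeasurableSpace Ξ]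
  {μ : Measure Ω} {P : Measure Ξ} {Q : Problem n p Ξ} {c : Consts p} {ξ : ℕ → Ω → Ξ}
  {T : ℕ} {sigma alpha tau : ℝ} {Sig : ℕ → Fin p → Ω → Matrix (Fin n) (Fin n) ℝ}
  {x1 : E n} {x : ℕ → Ω → E n} {lam : ℕ → Ω → E p}

theorem IsPMQSopt.isBoundedRun (hrun : IsPMQSopt Q sigma alpha tau T ξ Sig x1 x lam)
    (hQ : Assumptions Q P c) (hξ : IsIIDSample ξ P μ) (hc : c.Admissible)
    (hσ : 0 < sigma) (hα : 0 < alpha) (hτ : 0 ≤ tau) (hx1 : x1 ∈ Q.X0)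
    (hSig_le : ∀ t, 1 ≤ t → t ≤ T → ∀ i ω,
      (-(c.L i • (1 : Matrix (Fin n) (Fin n) ℝ)) - Sig t i ω).PosSemidef)
    (hSig_norm : ∀ t, 1 ≤ t → t ≤ T → ∀ i ω,
      ‖Matrix.toEuclideanCLM (𝕜 := ℝ) (Sig t i ω)‖ ≤ c.kS) :
    IsBoundedRun μ P Q c ξ T sigma alpha tau Sig x1 x lam := by
  have hmem : ∀ t ≤ T, ∀ ω, x (t + 1) ω ∈ Q.X0 := by
    intro t ht ω
    rcases Nat.eq_zero_or_pos t with rfl | h0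
    · rw [zero_add, hrun.x_one]; exact hx1
    · exact hrun.x_mem t h0 ht ω
  have hlam : ∀ t ≤ T, ∀ ω i, 0 ≤ lam (t + 1) ω i := by
    intro t ht ω i
    rcases Nat.eq_zero_or_pos t with rfl | h0
    · rw [zero_add, hrun.lam_one]; simp
    · rw [hrun.lam_succ t h0 ht]; exact le_max_right _ _
  refine ⟨hQ, hξ, hc, hσ, hα, hτ, hrun.x_one, hrun.lam_one, hmem, ?_, ?_, ?_⟩
  · intro t ht
    rcases Nat.eq_zero_or_pos t with rfl | h0
    -- The starting point is deterministic, hence measurable for the empty history.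
    · rw [zero_add, show x 1 = fun _ => x1 from funext hrun.x_one]
      exact measurable_const
    · exact hrun.measurable_x t h0 ht
  · intro t ht
    rcases Nat.eq_zero_or_pos t with rfl | h0
    · rw [zero_add, show lam 1 = fun _ => 0 from funext hrun.lam_one]
      exact measurable_const
    · exact hrun.measurable_lam t h0 ht
  · intro t ht ω
    have h1 : 1 ≤ t + 1 := by omega
    have h2 : t + 1 ≤ T := by omega
    have hy := hQ.subset (hmem t (by omega) ω)
    exact
    { sigma_pos := hσ
      alpha_pos := hα
      tau_nonneg := hτ
      convex := hQ.convex_X0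
      diam_le := hQ.diam_le
      y_mem := hmem t (by omega) ω
      xp_mem := hmem (t + 1) h2 ω
      lam_nonneg := hlam t (by omega) ω
      symm := fun i => hrun.symm (t + 1) h1 h2 i ω
      quadForm_le := fun i => quadForm_le_of_posSemidef (hSig_le (t + 1) h1 h2 i ω)
      abs_quadForm_le := fun i => abs_quadForm_le (hSig_norm (t + 1) h1 h2 i ω)
      norm_G_le := fun u hu => hQ.norm_G_le u (hQ.subset hu) _
      norm_gradF_le := hQ.norm_gradF_le _ hy _
      norm_gradG_le := fun i => hQ.norm_gradG_le i _ hy _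
      lower_F := fun z hz => (hQ.weaklyConvex_F _).lower_model hy (hQ.subset hz)
        (hQ.differentiable_F _ _ hy)
      lower_G := fun i z hz => (hQ.weaklyConvex_G i _).lower_model hy (hQ.subset hz)
        (hQ.differentiable_G i _ _ hy)
      isMinOn := hrun.x_argmin (t + 1) h1 h2 ω
      lam'_eq := hrun.lam_succ (t + 1) h1 h2 ω }

namespace IsBoundedRun

theorem lam_nonneg (h : IsBoundedRun μ P Q c ξ T sigma alpha tau Sig x1 x lam)
    {t : ℕ} (ht : t ≤ T) (ω : Ω) (i : Fin p) : 0 ≤ lam (t + 1) ω i := by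
  rcases t with - | t
  · rw [zero_add, h.lam_one]; simp
  · exact (h.step t (by omega) ω).lam'_nonneg i

/-- This bound grows with t and serves integrability only; the uniform bounds come from the
exponential moments. -/
theorem norm_lam_le (h : IsBoundedRun μ P Q c ξ T sigma alpha tau Sig x1 x lam)
    {t : ℕ} (ht : t ≤ T) (ω : Ω) : ‖lam (t + 1) ω‖ ≤ t * (sigma * c.gamma1) := by
  induction t with
  | zero => rw [zero_add, h.lam_one]; simp
  | succ t ih =>
    have h1 := (h.step t (by omega) ω).norm_le h.admissible
    have h2 := ih (by omega)
    push_cast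
    linarith

/-- Together with Tσ = T^{1/4}, this keeps the weak convexity modulus of the Lagrangian below α/2 on
every path. -/
theorem lam_le (h : IsBoundedRun μ P Q c ξ T sigma alpha tau Sig x1 x lam)
    {t : ℕ} (ht : t ≤ T) (ω : Ω) (i : Fin p) : lam (t + 1) ω i ≤ t * (sigma * c.gamma2) := by
  induction t with
  | zero => rw [zero_add, h.lam_one]; simp
  | succ t ih =>
    have h1 := (h.step t (by omega) ω).apply_le h.admissible i
    have h2 := ih (by omega)
    push_cast
    linarith

theorem measurable_x' (h : IsBoundedRun μ P Q c ξ T sigma alpha tau Sig x1 x lam)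
    {t : ℕ} (ht : t ≤ T) : Measurable (x (t + 1)) :=
  (h.measurable_x t ht).mono (h.sample.history_le t) le_rfl

theorem measurable_lam' (h : IsBoundedRun μ P Q c ξ T sigma alpha tau Sig x1 x lam)
    {t : ℕ} (ht : t ≤ T) : Measurable (lam (t + 1)) :=
  (h.measurable_lam t ht).mono (h.sample.history_le t) le_rfl

/-- The state `(x, λ)` before the iteration, as a point of `X₀ × ℝᵖ`, depends on the past only. -/
theorem measurable_state (h : IsBoundedRun μ P Q c ξ T sigma alpha tau Sig x1 x lam)
    {t : ℕ} (ht : t ≤ T) : Measurable[history ξ t]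
      fun ω => ((⟨x (t + 1) ω, h.x_mem t ht ω⟩ : Q.X0), lam (t + 1) ω) := by
  refine Measurable.prodMk ?_ (h.measurable_lam t ht)
  exact Measurable.subtype_mk (h.measurable_x t ht)

theorem integrable_norm_lam [IsFiniteMeasure μ]
    (h : IsBoundedRun μ P Q c ξ T sigma alpha tau Sig x1 x lam)
    {t : ℕ} (ht : t ≤ T) : Integrable (fun ω => ‖lam (t + 1) ω‖) μ :=
  Integrable.of_bound (h.measurable_lam' ht).norm.aestronglyMeasurable (t * (sigma * c.gamma1))
    (Filter.Eventually.of_forall fun ω => by rw [norm_norm]; exact h.norm_lam_le ht ω)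

theorem integrable_norm_lam_sq [IsFiniteMeasure μ]
    (h : IsBoundedRun μ P Q c ξ T sigma alpha tau Sig x1 x lam)
    {t : ℕ} (ht : t ≤ T) : Integrable (fun ω => ‖lam (t + 1) ω‖ ^ 2) μ :=
  Integrable.of_bound ((h.measurable_lam' ht).norm.pow_const 2).aestronglyMeasurable
    ((t * (sigma * c.gamma1)) ^ 2) (Filter.Eventually.of_forall fun ω => by
      rw [norm_pow, norm_norm]; exact pow_le_pow_left₀ (norm_nonneg _) (h.norm_lam_le ht ω) 2)

end IsBoundedRun

end Run

/-! ### Exponential moments of the multipliers by a drift argument. -/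

/-- One step of a process with quadratic drift `D`: below the threshold `θ` it increases by at most
`a`, above it the increase is linearized. -/
theorem exp_le_of_sq_le {W W' θ D σ r a k : ℝ} (hW : 0 ≤ W) (hθ : 0 < θ)
    (hσ : 0 < σ) (hr : 0 < r) (ha : 0 ≤ a) (hk : r * (σ * a) ≤ k) (hk1 : k ≤ 1)
    (hD : |D| ≤ a * max W θ) (hsq : W' ^ 2 ≤ W ^ 2 + 2 * σ * D) :
    Real.exp (r * W') ≤ Real.exp (r * (θ + σ * a))
      + if θ ≤ W then Real.exp (r * W) * (1 + r * (σ * D / W) + k ^ 2) else 0 := by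
  split_ifs with hc
  · rw [max_eq_left hc] at hD
    have hWpos : 0 < W := hθ.trans_le hc
    set u := σ * D / W with hu
    have huW : u * W = σ * D := div_mul_cancel₀ _ hWpos.ne'
    have h1 : W' ≤ W + u := by
      -- If W + u were negative, W² + 2uW would be negative too, yet it dominates W'².
      have h2 : 0 ≤ W + u := by
        by_contra! hneg
        nlinarith [sq_nonneg W']
      refine le_of_sq_le_sq ?_ h2
      nlinarith [sq_nonneg u]
    have h2 : |u| ≤ σ * a := by
      rw [hu, abs_div, abs_mul, abs_of_pos hσ, abs_of_pos hWpos, div_le_iff₀ hWpos, mul_assoc]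
      exact mul_le_mul_of_nonneg_left hD hσ.le
    have h3 : |r * u| ≤ k := by
      rw [abs_mul, abs_of_pos hr]
      exact (mul_le_mul_of_nonneg_left h2 hr.le).trans hk
    -- Since |ru| ≤ k ≤ 1, exp(ru) ≤ 1 + ru + (ru)²; keeping the linear term is what later lets the
    -- mean drift enter.
    have h4 := (abs_le.1 (Real.abs_exp_sub_one_sub_id_le (h3.trans hk1))).2
    have h5 : (r * u) ^ 2 ≤ k ^ 2 := by
      rw [← sq_abs]; exact pow_le_pow_left₀ (abs_nonneg _) h3 2
    have h6 : Real.exp (r * W') ≤ Real.exp (r * W) * Real.exp (r * u) := by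
      rw [← Real.exp_add, ← mul_add]
      exact Real.exp_le_exp.2 (mul_le_mul_of_nonneg_left h1 hr.le)
    have h7 := mul_le_mul_of_nonneg_left (by linarith : Real.exp (r * u) ≤ 1 + r * u + k ^ 2)
      (Real.exp_pos (r * W)).le
    have := (Real.exp_pos (r * (θ + σ * a))).le
    linarith
  · push Not at hc
    rw [max_eq_right hc.le] at hD
    have h1 : W' ≤ θ + σ * a := by
      refine le_of_sq_le_sq ?_ (by positivity)
      have h2 : σ * D ≤ σ * (a * θ) := mul_le_mul_of_nonneg_left ((le_abs_self _).trans hD) hσ.le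
      nlinarith [sq_nonneg (σ * a)]
    rw [add_zero]
    exact Real.exp_le_exp.2 (mul_le_mul_of_nonneg_left h1 hr.le)

section Run

set_option linter.unusedSectionVars false

variable {n p : ℕ} {Ω Ξ : Type*} [MeasurableSpace Ω] [MeasurableSpace Ξ]
  {μ : Measure Ω} [IsProbabilityMeasure μ] {P : Measure Ξ} [IsProbabilityMeasure P]
  {Q : Problem n p Ξ} {c : Consts p} {ξ : ℕ → Ω → Ξ}
  {T : ℕ} {sigma alpha tau : ℝ} {Sig : ℕ → Fin p → Ω → Matrix (Fin n) (Fin n) ℝ}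
  {x1 : E n} {x : ℕ → Ω → E n} {lam : ℕ → Ω → E p}

/-- The constant part of the drift of the multipliers. -/
noncomputable def Consts.driftConst (c : Consts p) (sigma : ℝ) : ℝ :=
  c.kf * c.D0 + sigma * c.nug ^ 2 / 2 + c.eps0 * (sigma * c.gamma1) / 2

/-- The level above which the multipliers drift downwards; `K` is the weight of the squared
distance in the Lyapunov function. -/
noncomputable def Consts.driftLevel (c : Consts p) (sigma K : ℝ) : ℝ :=
  4 * c.driftConst sigma / c.eps0 + 2 * (√K * c.D0)

/-- The exponent for which exponential moments of the multipliers are bounded. -/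
noncomputable def Consts.driftExponent (c : Consts p) (sigma : ℝ) : ℝ :=
  c.eps0 / (16 * sigma * c.nug ^ 2)

/-- The Lyapunov function: `√(‖λ‖² + K‖w - y‖²)`. -/
noncomputable def lyapunov (K : ℝ) (w y : E n) (l : E p) : ℝ := √(‖l‖ ^ 2 + K * ‖w - y‖ ^ 2)

theorem norm_le_lyapunov {K : ℝ} (hK : 0 ≤ K) (w y : E n) (l : E p) : ‖l‖ ≤ lyapunov K w y l :=
  Real.le_sqrt_of_sq_le (by have : 0 ≤ K * ‖w - y‖ ^ 2 := by positivity
                            linarith)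

theorem lyapunov_le {K : ℝ} (hK : 0 ≤ K) (w y : E n) (l : E p) :
    lyapunov K w y l ≤ ‖l‖ + √K * ‖w - y‖ := by
  refine Real.sqrt_le_iff.2 ⟨by positivity, ?_⟩
  have := Real.sq_sqrt hK
  have : 0 ≤ ‖l‖ * (√K * ‖w - y‖) := by positivity
  nlinarith

theorem Consts.Admissible.driftConst_pos {c : Consts p} (hc : c.Admissible) (hσ : 0 < sigma) :
    0 < c.driftConst sigma := by
  have := hc.kf_pos; have := hc.D0_pos; have := hc.eps0_pos; have := hc.gamma1_pos
  unfold driftConst; positivity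

theorem Consts.Admissible.driftLevel_pos {c : Consts p} (hc : c.Admissible) (hσ : 0 < sigma)
    (K : ℝ) : 0 < c.driftLevel sigma K := by
  have := hc.driftConst_pos hσ; have := hc.D0_pos; have := hc.eps0_pos
  unfold driftLevel; positivity

theorem Consts.Admissible.driftExponent_pos {c : Consts p} (hc : c.Admissible) (hσ : 0 < sigma) :
    0 < c.driftExponent sigma := by
  have := hc.nug_pos; have := hc.eps0_pos
  unfold driftExponent; positivity

namespace IsBoundedRun

theorem integrable_exp (h : IsBoundedRun μ P Q c ξ T sigma alpha tau Sig x1 x lam)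
    {t : ℕ} (ht : t ≤ T) {w : E n} (hw : w ∈ Q.X0) {r K : ℝ} (hr : 0 ≤ r) (hK : 0 ≤ K) :
    Integrable (fun ω => Real.exp (r * lyapunov K w (x (t + 1) ω) (lam (t + 1) ω))) μ := by
  have hx := h.measurable_x' ht
  have hl := h.measurable_lam' ht
  refine Integrable.of_bound (Measurable.aestronglyMeasurable ?_)
    (Real.exp (r * (t * (sigma * c.gamma1) + √K * c.D0))) (Filter.Eventually.of_forall fun ω => ?_)
  · unfold lyapunov
    fun_prop
  · rw [Real.norm_eq_abs, abs_of_pos (Real.exp_pos _)]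
    refine Real.exp_le_exp.2 (mul_le_mul_of_nonneg_left ((lyapunov_le hK _ _ _).trans ?_) hr)
    exact add_le_add (h.norm_lam_le ht ω) (mul_le_mul_of_nonneg_left
      (h.assumptions.diam_le w hw _ (h.x_mem t ht ω)) (Real.sqrt_nonneg K))

/-- One step of the recursion for the exponential moments. -/
theorem integral_exp_succ_le (h : IsBoundedRun μ P Q c ξ T sigma alpha tau Sig x1 x lam)
    {t : ℕ} (ht : t < T) {w : E n} (hw : w ∈ Q.X0) (hslater : ∀ i, Q.g P i w ≤ -c.eps0)
    {K r θ : ℝ} (hK : K = sigma * (tau + alpha)) (hr : r = c.driftExponent sigma)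
    (hθ : θ = c.driftLevel sigma K) :
    ∫ ω, Real.exp (r * lyapunov K w (x (t + 2) ω) (lam (t + 2) ω)) ∂μ
      ≤ Real.exp (r * (θ + sigma * (7 / 4 * c.nug)))
        + (1 - c.eps0 ^ 2 / (512 * c.nug ^ 2))
          * ∫ ω, Real.exp (r * lyapunov K w (x (t + 1) ω) (lam (t + 1) ω)) ∂μ := by
  have hc := h.admissible
  have hσ := h.sigma_pos
  have hα := h.alpha_pos
  have hν := hc.nug_pos
  have hε := hc.eps0_pos
  have hK0 : 0 ≤ K := by have := h.tau_nonneg; rw [hK]; positivity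
  have hr0 : 0 < r := hr ▸ hc.driftExponent_pos hσ
  have hB := hc.driftConst_pos hσ
  have hθ0 : 0 < θ := hθ ▸ hc.driftLevel_pos hσ K
  -- θ is chosen so that B - (ε₀/2)(V - √K·D₀) ≤ -(ε₀/4)V as soon as V ≥ θ.
  have hθB : 4 * c.driftConst sigma ≤ c.eps0 * θ - 2 * c.eps0 * (√K * c.D0) := by
    rw [hθ, Consts.driftLevel]
    have : c.eps0 * (4 * c.driftConst sigma / c.eps0) = 4 * c.driftConst sigma := by field_simp
    nlinarith
  have hKD : 0 ≤ √K * c.D0 := mul_nonneg (Real.sqrt_nonneg K) hc.D0_pos.le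
  set B := c.driftConst sigma with hBdef
  have hwO := h.assumptions.subset hw
  -- the drift as a function of the state and of the sample
  set D : E p → Ξ → ℝ := fun l z => B + c.eps0 / 2 * ‖l‖ + ∑ i, l i * Q.G i w z with hD
  set V : Q.X0 × E p → ℝ := fun s => lyapunov K w s.1 s.2 with hV
  set k : ℝ := 7 * c.eps0 / (64 * c.nug) with hk
  set H : Q.X0 × E p → Ξ → ℝ := fun s z =>
    if θ ≤ V s then Real.exp (r * V s) * (1 + r * (sigma * D s.2 z / V s) + k ^ 2) else 0 with hH
  have hrσ : r * sigma = c.eps0 / (16 * c.nug ^ 2) := by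
    rw [hr, Consts.driftExponent]; field_simp
  have hrk : r * (sigma * (7 / 4 * c.nug)) = k := by
    rw [← mul_assoc, hrσ, hk]; field_simp; norm_num
  have hk1 : k ≤ 1 := by
    rw [hk, div_le_one (by positivity)]; linarith [hc.eps0_le]
  have hk0 : 0 ≤ k := by positivity
  -- 7/4 = 1/4 + 1/2 + 1: B is at most (ε₀/4)θ, the second term (ε₀/2)‖l‖, the sampled sum at most
  -- ν_g‖l‖, and ε₀ ≤ ν_g.
  have hDabs : ∀ s : Q.X0 × E p, ∀ z, |D s.2 z| ≤ 7 / 4 * c.nug * max (V s) θ := by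
    intro s z
    have h1 := h.assumptions.abs_sum_mul_G_le hwO s.2 z
    have h2 : ‖s.2‖ ≤ max (V s) θ := (norm_le_lyapunov hK0 _ _ _).trans (le_max_left _ _)
    have h3 : B ≤ c.eps0 / 4 * max (V s) θ := by
      have := mul_le_mul_of_nonneg_left (le_max_right (V s) θ) hε.le
      nlinarith
    have h4 := mul_le_mul_of_nonneg_left h2 hε.le
    have h5 := mul_le_mul_of_nonneg_right h2 hν.le
    have h6 := mul_le_mul_of_nonneg_right hc.eps0_le (hθ0.le.trans (le_max_right (V s) θ))
    have h7 := mul_nonneg hε.le (norm_nonneg s.2)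
    rw [abs_le] at h1 ⊢
    simp only [hD]
    constructor <;> nlinarith
  have hVlb : ∀ ω, V (⟨x (t + 1) ω, h.x_mem t ht.le ω⟩, lam (t + 1) ω)
      ≤ ‖lam (t + 1) ω‖ + √K * c.D0 := by
    intro ω
    refine (lyapunov_le hK0 _ _ _).trans (add_le_add le_rfl ?_)
    exact mul_le_mul_of_nonneg_left (h.assumptions.diam_le w hw _ (h.x_mem t ht.le ω))
      (Real.sqrt_nonneg K)
  have hHabs : ∀ ω z, |H (⟨x (t + 1) ω, h.x_mem t ht.le ω⟩, lam (t + 1) ω) z|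
      ≤ Real.exp (r * (t * (sigma * c.gamma1) + √K * c.D0)) * (1 + k + k ^ 2) := by
    intro ω z
    have hbig := (hVlb ω).trans (add_le_add (h.norm_lam_le ht.le ω) le_rfl)
    have hDω := hDabs (⟨x (t + 1) ω, h.x_mem t ht.le ω⟩, lam (t + 1) ω) z
    simp only [hH]
    split_ifs with hc1
    · rw [max_eq_left hc1] at hDω
      have hVpos := hθ0.trans_le hc1
      rw [abs_mul, abs_of_pos (Real.exp_pos _)]
      refine mul_le_mul (Real.exp_le_exp.2 (mul_le_mul_of_nonneg_left hbig hr0.le)) ?_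
        (abs_nonneg _) (Real.exp_pos _).le
      refine (abs_add_le _ _).trans (add_le_add ((abs_add_le _ _).trans (add_le_add ?_ ?_)) ?_)
      · simp
      · rw [← hrk, abs_mul, abs_of_pos hr0, abs_div, abs_mul, abs_of_pos hσ, abs_of_pos hVpos]
        refine mul_le_mul_of_nonneg_left ?_ hr0.le
        rw [div_le_iff₀ hVpos, mul_assoc]
        exact mul_le_mul_of_nonneg_left hDω hσ.le
      · rw [abs_of_nonneg (sq_nonneg k)]
    · rw [abs_zero]
      positivity
  have hVmeas : Measurable V := by
    simp only [hV, lyapunov]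
    have : Measurable fun s : Q.X0 × E p => (s.1 : E n) := measurable_subtype_coe.comp measurable_fst
    fun_prop
  have hHmeas : Measurable (Function.uncurry H) := by
    have hGm : ∀ i, Measurable (Q.G i w) := fun i => h.assumptions.measurable_G i w hwO
    have h2 : Measurable fun q : (Q.X0 × E p) × Ξ => V q.1 := hVmeas.comp measurable_fst
    have h3 : Measurable fun q : (Q.X0 × E p) × Ξ => D q.1.2 q.2 := by
      simp only [hD]
      have h4 : ∀ i, Measurable fun q : (Q.X0 × E p) × Ξ => q.1.2 i * Q.G i w q.2 := fun i =>
        (by fun_prop : Measurable fun q : (Q.X0 × E p) × Ξ => q.1.2 i).mul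
          ((hGm i).comp measurable_snd)
      fun_prop
    exact Measurable.ite (measurableSet_le measurable_const h2) (by fun_prop) measurable_const
  obtain ⟨hint1, hint2, heq⟩ := h.sample.integral_fresh (h.measurable_state ht.le) hHmeas hHabs
  have hpath : ∀ ω, Real.exp (r * lyapunov K w (x (t + 2) ω) (lam (t + 2) ω))
      ≤ Real.exp (r * (θ + sigma * (7 / 4 * c.nug)))
        + H (⟨x (t + 1) ω, h.x_mem t ht.le ω⟩, lam (t + 1) ω) (ξ (t + 1) ω) := by
    intro ω
    refine exp_le_of_sq_le (Real.sqrt_nonneg _) hθ0 hσ hr0 (by positivity)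
      hrk.le hk1 (hDabs (⟨x (t + 1) ω, h.x_mem t ht.le ω⟩, lam (t + 1) ω) (ξ (t + 1) ω)) ?_
    have h1 := (h.step t ht ω).drift hc hw
    simp only [hV, lyapunov]
    rw [Real.sq_sqrt (by positivity), Real.sq_sqrt (by positivity), hK]
    exact h1
  have hinner : ∀ ω, ∫ z, H (⟨x (t + 1) ω, h.x_mem t ht.le ω⟩, lam (t + 1) ω) z ∂P
      ≤ (1 - c.eps0 ^ 2 / (512 * c.nug ^ 2))
        * Real.exp (r * lyapunov K w (x (t + 1) ω) (lam (t + 1) ω)) := by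
    intro ω
    have hfac : c.eps0 ^ 2 / (512 * c.nug ^ 2) ≤ 1 := by
      rw [div_le_one (by positivity)]
      have := pow_le_pow_left₀ hε.le hc.eps0_le 2
      nlinarith [sq_nonneg c.nug]
    set s : Q.X0 × E p := (⟨x (t + 1) ω, h.x_mem t ht.le ω⟩, lam (t + 1) ω) with hs
    have hVs : lyapunov K w (x (t + 1) ω) (lam (t + 1) ω) = V s := rfl
    rw [hVs]
    by_cases hc1 : θ ≤ V s
    · have hVpos := hθ0.trans_le hc1
      have hGi : ∀ i, Integrable (fun z => s.2 i * Q.G i w z) P := fun i =>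
        (h.assumptions.integrable_G i w hwO).const_mul _
      have hDi : Integrable (fun z => D s.2 z) P :=
        (integrable_const _).add (integrable_finsetSum _ fun i _ => hGi i)
      have hDint : ∫ z, D s.2 z ∂P = B + c.eps0 / 2 * ‖s.2‖ + ∑ i, s.2 i * Q.g P i w := by
        simp only [hD]
        rw [integral_add (integrable_const _) (integrable_finsetSum _ fun i _ => hGi i),
          h.assumptions.sum_mul_g hwO]
        simp
      -- The Slater condition contributes -ε₀‖λ‖, since ‖λ‖ ≤ ∑λᵢ for nonnegative multipliers; half
      -- of it pays for the curvature of Σ₀, and the level θ for the constants.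
      have hDle : ∫ z, D s.2 z ∂P ≤ -(c.eps0 / 4 * V s) := by
        rw [hDint]
        have h1 : ∑ i, s.2 i * Q.g P i w ≤ -(c.eps0 * ‖s.2‖) := by
          have h2 : ∑ i, s.2 i * Q.g P i w ≤ ∑ i, s.2 i * (-c.eps0) :=
            Finset.sum_le_sum fun i _ =>
              mul_le_mul_of_nonneg_left (hslater i) (h.lam_nonneg ht.le ω i)
          rw [← Finset.sum_mul] at h2
          have h3 : ‖s.2‖ ≤ ∑ i, s.2 i := by
            refine le_of_sq_le_sq ?_ (Finset.sum_nonneg fun i _ => h.lam_nonneg ht.le ω i)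
            rw [norm_sq_eq_sum]
            exact Finset.sum_sq_le_sq_sum_of_nonneg fun i _ => h.lam_nonneg ht.le ω i
          nlinarith
        have h4 : V s ≤ ‖s.2‖ + √K * c.D0 := hVlb ω
        have h5 := mul_le_mul_of_nonneg_left h4 hε.le
        have h6 := mul_le_mul_of_nonneg_left hc1 hε.le
        nlinarith
      have h1 : ∫ z, H s z ∂P
          = Real.exp (r * V s) * (1 + r * (sigma * (∫ z, D s.2 z ∂P) / V s) + k ^ 2) := by
        simp only [hH, if_pos hc1]
        rw [integral_const_mul]
        congr 1
        have e : ∀ z, 1 + r * (sigma * D s.2 z / V s) + k ^ 2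
            = (1 + k ^ 2) + (r * (sigma / V s)) * D s.2 z := fun z => by ring
        simp only [e]
        rw [integral_add (integrable_const _) (hDi.const_mul _), integral_const_mul]
        simp; ring
      rw [h1, mul_comm]
      refine mul_le_mul_of_nonneg_right ?_ (Real.exp_pos _).le
      have h2 : r * (sigma * (∫ z, D s.2 z ∂P) / V s) ≤ -(c.eps0 ^ 2 / (64 * c.nug ^ 2)) := by
        have h3 : (∫ z, D s.2 z ∂P) / V s ≤ -(c.eps0 / 4) := by
          rw [div_le_iff₀ hVpos]; linarith
        have h4 := mul_le_mul_of_nonneg_left h3 (by positivity : 0 ≤ r * sigma)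
        calc r * (sigma * (∫ z, D s.2 z ∂P) / V s) = r * sigma * ((∫ z, D s.2 z ∂P) / V s) := by
              ring
          _ ≤ r * sigma * -(c.eps0 / 4) := h4
          _ = -(c.eps0 ^ 2 / (64 * c.nug ^ 2)) := by rw [hrσ]; field_simp; norm_num
      -- In units of ε₀²/(4096ν_g²): the linear gain is 64, the quadratic error 49, and a net
      -- contraction of 8 is claimed.
      have h3 : k ^ 2 ≤ c.eps0 ^ 2 / (64 * c.nug ^ 2) - c.eps0 ^ 2 / (512 * c.nug ^ 2) := by
        have h4 : k ^ 2 = 49 / 4096 * (c.eps0 ^ 2 / c.nug ^ 2) := by rw [hk]; field_simp; norm_num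
        have h5 : c.eps0 ^ 2 / (64 * c.nug ^ 2) - c.eps0 ^ 2 / (512 * c.nug ^ 2)
          = 56 / 4096 * (c.eps0 ^ 2 / c.nug ^ 2) := by field_simp; norm_num
        rw [h4, h5]
        exact mul_le_mul_of_nonneg_right (by norm_num) (by positivity)
      linarith
    · simp only [hH, if_neg hc1, integral_zero]
      exact mul_nonneg (by linarith) (Real.exp_pos _).le
  calc ∫ ω, Real.exp (r * lyapunov K w (x (t + 2) ω) (lam (t + 2) ω)) ∂μ
      ≤ ∫ ω, (Real.exp (r * (θ + sigma * (7 / 4 * c.nug)))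
        + H (⟨x (t + 1) ω, h.x_mem t ht.le ω⟩, lam (t + 1) ω) (ξ (t + 1) ω)) ∂μ :=
        integral_mono (h.integrable_exp (t := t + 1) ht hw hr0.le hK0)
          ((integrable_const _).add hint1) hpath
    _ = Real.exp (r * (θ + sigma * (7 / 4 * c.nug)))
        + ∫ ω, ∫ z, H (⟨x (t + 1) ω, h.x_mem t ht.le ω⟩, lam (t + 1) ω) z ∂P ∂μ := by
        rw [integral_add (integrable_const _) hint1, heq]; simp
    _ ≤ _ := by
        rw [← integral_const_mul]
        exact add_le_add le_rfl (integral_mono hint2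
          ((h.integrable_exp ht.le hw hr0.le hK0).const_mul _) hinner)

/-- Uniform bound of the exponential moments of the multipliers. -/
theorem integral_exp_le (h : IsBoundedRun μ P Q c ξ T sigma alpha tau Sig x1 x lam)
    {t : ℕ} (ht : t ≤ T) {K r θ : ℝ} (hK : K = sigma * (tau + alpha))
    (hr : r = c.driftExponent sigma) (hθ : θ = c.driftLevel sigma K) :
    Integrable (fun ω => Real.exp (r * ‖lam (t + 1) ω‖)) μ ∧
    ∫ ω, Real.exp (r * ‖lam (t + 1) ω‖) ∂μ
      ≤ Real.exp (r * (θ + sigma * (7 / 4 * c.nug))) * (512 * c.nug ^ 2 / c.eps0 ^ 2) := by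
  have hc := h.admissible
  have hσ := h.sigma_pos
  have hα := h.alpha_pos
  have hν := hc.nug_pos
  have hε := hc.eps0_pos
  have hK0 : 0 ≤ K := by have := h.tau_nonneg; rw [hK]; positivity
  have hr0 : 0 < r := hr ▸ hc.driftExponent_pos hσ
  obtain ⟨w, hw, hslater⟩ := h.assumptions.slater
  set M := Real.exp (r * (θ + sigma * (7 / 4 * c.nug))) with hM
  have hM0 : 0 < M := Real.exp_pos _
  have hη : 1 ≤ 512 * c.nug ^ 2 / c.eps0 ^ 2 := by
    rw [one_le_div (by positivity)]
    have := pow_le_pow_left₀ hε.le hc.eps0_le 2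
    nlinarith [sq_nonneg c.nug]
  have key : ∀ t, t ≤ T → ∫ ω, Real.exp (r * lyapunov K w (x (t + 1) ω) (lam (t + 1) ω)) ∂μ
      ≤ M * (512 * c.nug ^ 2 / c.eps0 ^ 2) := by
    intro t
    induction t with
    | zero =>
      intro _
      -- Initially λ = 0, so the Lyapunov function is at most √K·D₀ ≤ θ.
      have h1 : ∀ ω, Real.exp (r * lyapunov K w (x (0 + 1) ω) (lam (0 + 1) ω)) ≤ M := by
        intro ω
        refine Real.exp_le_exp.2 (mul_le_mul_of_nonneg_left ?_ hr0.le)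
        refine (lyapunov_le hK0 _ _ _).trans ?_
        rw [zero_add, h.lam_one, norm_zero, zero_add]
        have h2 := mul_le_mul_of_nonneg_left
          (h.assumptions.diam_le w hw _ (h.x_mem 0 (Nat.zero_le T) ω)) (Real.sqrt_nonneg K)
        have h3 : 0 ≤ √K * c.D0 := mul_nonneg (Real.sqrt_nonneg K) hc.D0_pos.le
        have h4 : 0 ≤ 4 * c.driftConst sigma / c.eps0 := by
          have := hc.driftConst_pos hσ; positivity
        have h5 : 0 ≤ sigma * (7 / 4 * c.nug) := by positivity
        rw [hθ, Consts.driftLevel]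
        rw [zero_add] at h2
        linarith
      have h2 := integral_mono (h.integrable_exp (Nat.zero_le T) hw hr0.le hK0)
        (integrable_const M) h1
      simp only [integral_const, probReal_univ, one_smul] at h2
      nlinarith
    | succ t ih =>
      intro ht
      have h1 := h.integral_exp_succ_le (t := t) (by omega) hw hslater hK hr hθ
      have hfac : 0 ≤ 1 - c.eps0 ^ 2 / (512 * c.nug ^ 2) := by
        rw [sub_nonneg, div_le_one (by positivity)]
        have := pow_le_pow_left₀ hε.le hc.eps0_le 2
        nlinarith [sq_nonneg c.nug]
      have h2 := mul_le_mul_of_nonneg_left (ih (by omega)) hfac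
      -- With η = ε₀²/(512ν_g²), the value M/η is the fixed point of a ↦ M + (1-η)a.
      refine h1.trans ((add_le_add le_rfl h2).trans (le_of_eq ?_))
      rw [← hM]
      field_simp
      ring
  have hle : ∀ ω, Real.exp (r * ‖lam (t + 1) ω‖)
      ≤ Real.exp (r * lyapunov K w (x (t + 1) ω) (lam (t + 1) ω)) := fun ω =>
    Real.exp_le_exp.2 (mul_le_mul_of_nonneg_left (norm_le_lyapunov hK0 _ _ _) hr0.le)
  have hint : Integrable (fun ω => Real.exp (r * ‖lam (t + 1) ω‖)) μ := by
    refine (h.integrable_exp ht hw hr0.le hK0).mono' ?_ (Filter.Eventually.of_forall fun ω => ?_)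
    · exact (Real.measurable_exp.comp
        ((h.measurable_lam' ht).norm.const_mul r)).aestronglyMeasurable
    · rw [Real.norm_eq_abs, abs_of_pos (Real.exp_pos _)]
      exact hle ω
  exact ⟨hint, (integral_mono hint (h.integrable_exp ht hw hr0.le hK0) hle).trans (key t ht)⟩

end IsBoundedRun

end Run

/-! ### From exponential moments to the first two moments. -/

section Moments

variable {Ω : Type*} [MeasurableSpace Ω] {μ : Measure Ω} [IsProbabilityMeasure μ] {Y : Ω → ℝ}
  {r A : ℝ}

/-- A bound of an exponential moment bounds the mean. -/
theorem integral_le_of_integral_exp_le (hr : 0 < r) (hY : Integrable Y μ)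
    (hi : Integrable (fun ω => Real.exp (r * Y ω)) μ)
    (h : ∫ ω, Real.exp (r * Y ω) ∂μ ≤ Real.exp (r * A)) : ∫ ω, Y ω ∂μ ≤ A := by
  -- Jensen's inequality in tangent form: 1 + r(Y-A) ≤ exp(r(Y-A)).
  have h1 : ∀ ω, Y ω ≤ A - r⁻¹ + r⁻¹ * Real.exp (-(r * A)) * Real.exp (r * Y ω) := by
    intro ω
    have h2 := Real.add_one_le_exp (-(r * A) + r * Y ω)
    have h3 := mul_le_mul_of_nonneg_left h2 (inv_pos.2 hr).le
    rw [Real.exp_add] at h3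
    have h4 : r⁻¹ * (-(r * A) + r * Y ω + 1) = Y ω - A + r⁻¹ := by field_simp; ring
    linarith
  have h2 := integral_mono hY ((integrable_const _).add (hi.const_mul _)) h1
  simp only [Pi.add_apply] at h2
  rw [integral_add (integrable_const _) (hi.const_mul _), integral_const_mul] at h2
  simp only [integral_const, probReal_univ, one_smul] at h2
  have h3 := mul_le_mul_of_nonneg_left h
    (by positivity : 0 ≤ r⁻¹ * Real.exp (-(r * A)))
  have h4 : r⁻¹ * Real.exp (-(r * A)) * Real.exp (r * A) = r⁻¹ := by
    rw [mul_assoc, ← Real.exp_add]; simp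
  linarith

/-- A bound of an exponential moment bounds the second moment. -/
theorem integral_sq_le_of_integral_exp_le (hr : 0 < r) (hA : 0 ≤ A) (hY0 : ∀ ω, 0 ≤ Y ω)
    (hY : Integrable (fun ω => Y ω ^ 2) μ)
    (hi : Integrable (fun ω => Real.exp (r * Y ω)) μ)
    (h : ∫ ω, Real.exp (r * Y ω) ∂μ ≤ Real.exp (r * A)) :
    ∫ ω, Y ω ^ 2 ∂μ ≤ A ^ 2 + 2 * A * r⁻¹ + 2 * r⁻¹ ^ 2 := by
  have hri : 0 < r⁻¹ := inv_pos.2 hr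
  have h1 : ∀ ω, Y ω ^ 2
      ≤ A ^ 2 + (2 * A * r⁻¹ + 2 * r⁻¹ ^ 2) * Real.exp (-(r * A)) * Real.exp (r * Y ω) := by
    intro ω
    rw [mul_assoc, ← Real.exp_add]
    have he := (Real.exp_pos (-(r * A) + r * Y ω)).le
    -- Below A the bound Y² ≤ A² suffices. Above, expand Y² around A; with u = r(Y-A) ≥ 0 both u and
    -- u²/2 are at most exp(u).
    rcases le_total (Y ω) A with hle | hle
    · have := pow_le_pow_left₀ (hY0 ω) hle 2
      have : 0 ≤ (2 * A * r⁻¹ + 2 * r⁻¹ ^ 2) * Real.exp (-(r * A) + r * Y ω) := by positivity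
      linarith
    · have hu : 0 ≤ -(r * A) + r * Y ω := by nlinarith
      have h2 := Real.quadratic_le_exp_of_nonneg hu
      set e := Real.exp (-(r * A) + r * Y ω)
      have h3 : Y ω - A = r⁻¹ * (-(r * A) + r * Y ω) := by field_simp; ring
      have h4 : Y ω - A ≤ r⁻¹ * e := by
        rw [h3]; exact mul_le_mul_of_nonneg_left (by nlinarith) hri.le
      have h5 : (Y ω - A) ^ 2 ≤ 2 * r⁻¹ ^ 2 * e := by
        rw [h3, mul_pow]
        have := mul_le_mul_of_nonneg_left
          (by nlinarith : (-(r * A) + r * Y ω) ^ 2 ≤ 2 * e) (sq_nonneg r⁻¹)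
        linarith
      have h6 := mul_le_mul_of_nonneg_left h4 (by linarith : 0 ≤ 2 * A)
      nlinarith
  have h2 := integral_mono hY ((integrable_const _).add (hi.const_mul _)) h1
  simp only [Pi.add_apply] at h2
  rw [integral_add (integrable_const _) (hi.const_mul _), integral_const_mul] at h2
  simp only [integral_const, probReal_univ, one_smul] at h2
  have h3 := mul_le_mul_of_nonneg_left h
    (by positivity : 0 ≤ (2 * A * r⁻¹ + 2 * r⁻¹ ^ 2) * Real.exp (-(r * A)))
  have h4 : (2 * A * r⁻¹ + 2 * r⁻¹ ^ 2) * Real.exp (-(r * A)) * Real.exp (r * A)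
      = 2 * A * r⁻¹ + 2 * r⁻¹ ^ 2 := by
    rw [mul_assoc, ← Real.exp_add]; simp
  linarith

end Moments

theorem upperGamma_nonneg (a : ℝ) {b : ℝ} (hb : 0 ≤ b) : 0 ≤ upperGamma a b :=
  setIntegral_nonneg measurableSet_Ioi fun _ ht =>
    mul_nonneg (Real.rpow_nonneg (hb.trans (le_of_lt ht)) _) (Real.exp_pos _).le

/-! ### Comparison with the constants γ₃ and γ₄. -/

section Constants

variable {p : ℕ} {c : Consts p}

/-- The bound of the multipliers that results from their exponential moments. -/
noncomputable def Consts.multiplierBound (c : Consts p) (sigma K : ℝ) : ℝ :=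
  c.driftLevel sigma K + sigma * (7 / 4 * c.nug)
    + (c.driftExponent sigma)⁻¹ * Real.log (512 * c.nug ^ 2 / c.eps0 ^ 2)

theorem Consts.Admissible.log_ge (hc : c.Admissible) :
    97 / 20 ≤ Real.log (128 * c.gamma1 ^ 2 / c.eps0 ^ 2) := by
  have hε := hc.eps0_pos
  have hle := hc.eps0_le.trans hc.nug_le_gamma1
  have h1 : Real.log 128 ≤ Real.log (128 * c.gamma1 ^ 2 / c.eps0 ^ 2) := by
    refine Real.log_le_log (by norm_num) ?_
    rw [le_div_iff₀ (by positivity)]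
    exact mul_le_mul_of_nonneg_left (pow_le_pow_left₀ hε.le hle 2) (by norm_num)
  have h2 : Real.log 128 = 7 * Real.log 2 := by
    rw [show (128 : ℝ) = 2 ^ 7 by norm_num, Real.log_pow]; norm_num
  have := Real.log_two_gt_d9
  linarith

theorem Consts.Admissible.gamma1_le (hc : c.Admissible) : c.gamma1 ≤ c.gamma1 ^ 2 / c.eps0 := by
  rw [le_div_iff₀ hc.eps0_pos, sq]
  exact mul_le_mul_of_nonneg_left (hc.eps0_le.trans hc.nug_le_gamma1) hc.gamma1_pos.le

/-- The logarithmic term alone gives 16 · 97/20 > 77, and the -γ₁ in γ₃ is compensated by its 2γ₁.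
-/
theorem Consts.Admissible.gamma1_sq_div_le (hc : c.Admissible) :
    77 * (c.gamma1 ^ 2 / c.eps0) ≤ c.gamma3 := by
  have hε := hc.eps0_pos; have hk := hc.kf_pos; have hD := hc.D0_pos; have hν := hc.nug_pos
  have hγ := hc.gamma1_pos
  have hℓ := hc.log_ge
  have h1 : 0 ≤ 4 * c.kf * c.D0 / c.eps0 := by positivity
  have h2 : 0 ≤ 2 * c.D0 ^ 2 / c.eps0 := by positivity
  have h3 : 0 ≤ 2 * c.nug ^ 2 / c.eps0 := by positivity
  have h4 : 16 * c.gamma1 ^ 2 / c.eps0 * Real.log (128 * c.gamma1 ^ 2 / c.eps0 ^ 2)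
      = 16 * (c.gamma1 ^ 2 / c.eps0 * Real.log (128 * c.gamma1 ^ 2 / c.eps0 ^ 2)) := by ring
  have h5 := mul_le_mul_of_nonneg_left hℓ (by positivity : 0 ≤ c.gamma1 ^ 2 / c.eps0)
  have h6 : 0 ≤ c.gamma1 ^ 2 / c.eps0 := by positivity
  unfold gamma3 kappa0 kappa1 kappa3 kappa4
  rw [h4]
  linarith

theorem Consts.Admissible.gamma3_pos (hc : c.Admissible) : 0 < c.gamma3 := by
  refine lt_of_lt_of_le ?_ hc.gamma1_sq_div_le
  have := hc.eps0_pos; have := hc.gamma1_pos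
  positivity

theorem Consts.Admissible.inv_driftExponent_le (hc : c.Admissible) {sigma : ℝ} (hσ : 0 < sigma)
    (hσ1 : sigma ≤ 3 / 5) :
    (c.driftExponent sigma)⁻¹ ≤ 48 / 5 * (c.gamma1 ^ 2 / c.eps0) := by
  have hε := hc.eps0_pos; have hν := hc.nug_pos
  have e : (c.driftExponent sigma)⁻¹ = 16 * sigma * (c.nug ^ 2 / c.eps0) := by
    unfold driftExponent; field_simp
  rw [e]
  refine mul_le_mul (by linarith) ?_ (by positivity) (by norm_num)
  exact div_le_div_of_nonneg_right (pow_le_pow_left₀ hν.le hc.nug_le_gamma1 2) hε.le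

/-- The room comes from σ ≤ 3/5: the logarithm is weighted by 48/5 here and by 16 in γ₃. As the
logarithm is at least 97/20, the difference absorbs the remaining terms, all multiples of γ₁²/ε₀. -/
theorem Consts.Admissible.multiplierBound_le (hc : c.Admissible) {sigma K : ℝ} (hσ : 0 < sigma)
    (hσ1 : sigma ≤ 3 / 5) (hK0 : 0 ≤ K) (hK : K ≤ 2) : c.multiplierBound sigma K ≤ c.gamma3 := by
  have hε := hc.eps0_pos; have hD := hc.D0_pos; have hν := hc.nug_pos
  have hγ := hc.gamma1_pos
  have hℓ := hc.log_ge
  have hνγ := hc.nug_le_gamma1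
  have hγ' := hc.gamma1_le
  set ℓ := Real.log (128 * c.gamma1 ^ 2 / c.eps0 ^ 2) with hℓdef
  set G := c.gamma1 ^ 2 / c.eps0 with hG
  have hG0 : 0 < G := by positivity
  -- The factor 4 between 512 and 128 costs log 4 ≤ 7/5.
  have hlog : Real.log (512 * c.nug ^ 2 / c.eps0 ^ 2) ≤ ℓ + 7 / 5 := by
    have h1 : Real.log (512 * c.nug ^ 2 / c.eps0 ^ 2)
        ≤ Real.log (2 ^ 2 * (128 * c.gamma1 ^ 2 / c.eps0 ^ 2)) := by
      refine Real.log_le_log (by positivity) ?_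
      rw [← mul_div_assoc]
      refine div_le_div_of_nonneg_right ?_ (by positivity)
      have := pow_le_pow_left₀ hν.le hνγ 2
      linarith
    rw [Real.log_mul (by norm_num) (by positivity), Real.log_pow] at h1
    have := Real.log_two_lt_d9
    push_cast at h1
    linarith
  have hlog0 : 0 ≤ Real.log (512 * c.nug ^ 2 / c.eps0 ^ 2) := by
    refine Real.log_nonneg ?_
    rw [one_le_div (by positivity)]
    have := pow_le_pow_left₀ hε.le hc.eps0_le 2
    nlinarith [sq_nonneg c.nug]
  have h1 : (c.driftExponent sigma)⁻¹ * Real.log (512 * c.nug ^ 2 / c.eps0 ^ 2)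
      ≤ 48 / 5 * G * (ℓ + 7 / 5) :=
    mul_le_mul (hc.inv_driftExponent_le hσ hσ1) hlog hlog0 (by positivity)
  -- Arithmetic-geometric mean inequality together with K ≤ 2.
  have h2 : 2 * (√K * c.D0) ≤ 2 * c.D0 ^ 2 / c.eps0 + c.eps0 := by
    rw [← sub_le_iff_le_add, le_div_iff₀ hε]
    have := Real.sq_sqrt hK0
    nlinarith [sq_nonneg (2 * c.D0 - c.eps0 * √K), mul_le_mul_of_nonneg_left hK (sq_nonneg c.eps0)]
  have h3 : 4 * c.driftConst sigma / c.eps0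
      = 4 * c.kf * c.D0 / c.eps0 + sigma * (2 * c.nug ^ 2 / c.eps0) + 2 * sigma * c.gamma1 := by
    unfold driftConst; field_simp; ring
  have h4 : sigma * (2 * c.nug ^ 2 / c.eps0) ≤ 2 * c.nug ^ 2 / c.eps0 :=
    mul_le_of_le_one_left (by positivity) (by linarith)
  have h5 : sigma * c.gamma1 ≤ 3 / 5 * c.gamma1 := mul_le_mul_of_nonneg_right hσ1 hγ.le
  have h6 : sigma * (7 / 4 * c.nug) ≤ 3 / 5 * (7 / 4 * c.gamma1) :=
    mul_le_mul hσ1 (by linarith) (by positivity) (by norm_num)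
  have h7 := mul_le_mul_of_nonneg_left hℓ hG0.le
  have h8 := hc.eps0_le
  have e : 16 * c.gamma1 ^ 2 / c.eps0 * ℓ = 16 * (G * ℓ) := by rw [hG]; ring
  unfold multiplierBound driftLevel gamma3 kappa0 kappa1 kappa3 kappa4
  rw [h3, ← hℓdef, e]
  linarith

/-- Only the first three terms of γ₄ are needed: 2 · 48/5 ≤ 32 and 2 · (48/5)² ≤ 256. The others are
nonnegative. -/
theorem Consts.Admissible.le_gamma4 (hc : c.Admissible) {sigma A R : ℝ} (hσ : 0 < sigma)
    (hA0 : 0 ≤ A) (hA : A ≤ c.gamma3) (hR0 : 0 ≤ R) (hR : R ≤ 48 / 5 * (c.gamma1 ^ 2 / c.eps0)) :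
    A ^ 2 + 2 * A * R + 2 * R ^ 2 ≤ c.gamma4 sigma := by
  have hε := hc.eps0_pos; have hν := hc.nug_pos; have hγ := hc.gamma1_pos
  have h3 := hc.gamma3_pos
  have hG0 : 0 ≤ c.gamma1 ^ 2 / c.eps0 := by positivity
  have h1 := pow_le_pow_left₀ hA0 hA 2
  have h2 := mul_le_mul hA hR hR0 h3.le
  have h4 := pow_le_pow_left₀ hR0 hR 2
  have h5 : c.gamma1 ^ 4 / c.eps0 ^ 2 = (c.gamma1 ^ 2 / c.eps0) ^ 2 := by field_simp
  have h6 : 0 ≤ 2 * sigma * c.nug * (c.gamma3 + 16 * (c.gamma1 ^ 2 / c.eps0)) := by positivity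
  have h7 : 0 ≤ 2 * c.nug ^ 2 * (upperGamma 6 1 + 2 * upperGamma 4 1 + upperGamma 2 1) := by
    have := upperGamma_nonneg 6 zero_le_one
    have := upperGamma_nonneg 4 zero_le_one
    have := upperGamma_nonneg 2 zero_le_one
    positivity
  have h8 := mul_nonneg h3.le hG0
  unfold gamma4
  rw [h5]
  nlinarith [sq_nonneg (c.gamma1 ^ 2 / c.eps0), sq_nonneg c.nug]

end Constants

/-! ### Uniform moment bounds along a run. -/

section Run

variable {n p : ℕ} {Ω Ξ : Type*} [MeasurableSpace Ω] [MeasurableSpace Ξ]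
  {μ : Measure Ω} [IsProbabilityMeasure μ] {P : Measure Ξ} [IsProbabilityMeasure P]
  {Q : Problem n p Ξ} {c : Consts p} {ξ : ℕ → Ω → Ξ}
  {T : ℕ} {sigma alpha tau : ℝ} {Sig : ℕ → Fin p → Ω → Matrix (Fin n) (Fin n) ℝ}
  {x1 : E n} {x : ℕ → Ω → E n} {lam : ℕ → Ω → E p}

/-- Uniform bounds of the first two moments of the multipliers. -/
theorem IsBoundedRun.moments_le (h : IsBoundedRun μ P Q c ξ T sigma alpha tau Sig x1 x lam)
    (hσ1 : sigma ≤ 3 / 5) (hK : sigma * (tau + alpha) ≤ 2) {t : ℕ} (ht : t ≤ T) :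
    ∫ ω, ‖lam (t + 1) ω‖ ∂μ ≤ c.gamma3 ∧ ∫ ω, ‖lam (t + 1) ω‖ ^ 2 ∂μ ≤ c.gamma4 sigma := by
  have hc := h.admissible
  have hσ := h.sigma_pos
  have hε := hc.eps0_pos; have hν := hc.nug_pos
  have hr := hc.driftExponent_pos hσ
  have hK0 : 0 ≤ sigma * (tau + alpha) := by
    have := h.tau_nonneg; have := h.alpha_pos; positivity
  obtain ⟨hi, hle⟩ := h.integral_exp_le ht rfl rfl rfl
  have hA := hc.multiplierBound_le hσ hσ1 hK0 hK
  set A := c.multiplierBound sigma (sigma * (tau + alpha)) with hAdef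
  have hle' : ∫ ω, Real.exp (c.driftExponent sigma * ‖lam (t + 1) ω‖) ∂μ
      ≤ Real.exp (c.driftExponent sigma * A) := by
    refine hle.trans (le_of_eq ?_)
    have e : c.driftExponent sigma * A = c.driftExponent sigma
        * (c.driftLevel sigma (sigma * (tau + alpha)) + sigma * (7 / 4 * c.nug))
        + Real.log (512 * c.nug ^ 2 / c.eps0 ^ 2) := by
      rw [hAdef, Consts.multiplierBound, mul_add, mul_inv_cancel_left₀ hr.ne']
    rw [e, Real.exp_add, Real.exp_log (by positivity)]
  have h1 := integral_le_of_integral_exp_le hr (h.integrable_norm_lam ht) hi hle'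
  have hA0 : 0 ≤ A := (integral_nonneg fun ω => norm_nonneg _).trans h1
  refine ⟨h1.trans hA, ?_⟩
  exact (integral_sq_le_of_integral_exp_le hr hA0 (fun ω => norm_nonneg _)
    (h.integrable_norm_lam_sq ht) hi hle').trans
    (hc.le_gamma4 hσ hA0 hA (inv_pos.2 hr).le (hc.inv_driftExponent_le hσ hσ1))

end Run

/-! ### Complementarity and constraint violation. -/

section Run

set_option linter.unusedSectionVars false

variable {n p : ℕ} {Ω Ξ : Type*} [MeasurableSpace Ω] [MeasurableSpace Ξ]
  {μ : Measure Ω} [IsProbabilityMeasure μ] {P : Measure Ξ} [IsProbabilityMeasure P]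
  {Q : Problem n p Ξ} {c : Consts p} {ξ : ℕ → Ω → Ξ}
  {T : ℕ} {sigma alpha tau : ℝ} {Sig : ℕ → Fin p → Ω → Matrix (Fin n) (Fin n) ℝ}
  {x1 : E n} {x : ℕ → Ω → E n} {lam : ℕ → Ω → E p}

namespace IsBoundedRun

theorem integral_G (h : IsBoundedRun μ P Q c ξ T sigma alpha tau Sig x1 x lam)
    {t : ℕ} (ht : t ≤ T) (i : Fin p) :
    Integrable (fun ω => Q.G i (x (t + 1) ω) (ξ (t + 1) ω)) μ ∧
    Integrable (fun ω => Q.g P i (x (t + 1) ω)) μ ∧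
    ∫ ω, Q.G i (x (t + 1) ω) (ξ (t + 1) ω) ∂μ = ∫ ω, Q.g P i (x (t + 1) ω) ∂μ := by
  have hm : Measurable (Function.uncurry fun (s : Q.X0 × E p) (z : Ξ) => Q.G i s.1 z) :=
    (h.assumptions.measurable_uncurry_G i).comp
      ((measurable_fst.comp measurable_fst).prodMk measurable_snd)
  exact h.sample.integral_fresh (h.measurable_state ht) hm (C := c.nug) fun ω z =>
    h.assumptions.abs_G_le i (h.assumptions.subset (h.x_mem t ht ω)) z

theorem integral_sum_mul_G (h : IsBoundedRun μ P Q c ξ T sigma alpha tau Sig x1 x lam)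
    {t : ℕ} (ht : t ≤ T) :
    Integrable (fun ω => ∑ i, lam (t + 1) ω i * Q.G i (x (t + 1) ω) (ξ (t + 1) ω)) μ ∧
    Integrable (fun ω => ∑ i, lam (t + 1) ω i * Q.g P i (x (t + 1) ω)) μ ∧
    ∫ ω, ∑ i, lam (t + 1) ω i * Q.G i (x (t + 1) ω) (ξ (t + 1) ω) ∂μ
      = ∫ ω, ∑ i, lam (t + 1) ω i * Q.g P i (x (t + 1) ω) ∂μ := by
  have hm : Measurable (Function.uncurry
      fun (s : Q.X0 × E p) (z : Ξ) => ∑ i, s.2 i * Q.G i s.1 z) := by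
    refine Finset.measurable_fun_sum _ fun i _ => Measurable.mul (by fun_prop) ?_
    exact (h.assumptions.measurable_uncurry_G i).comp
      ((measurable_fst.comp measurable_fst).prodMk measurable_snd)
  have hx : ∀ ω, x (t + 1) ω ∈ Q.O0 := fun ω => h.assumptions.subset (h.x_mem t ht ω)
  obtain ⟨h1, h2, h3⟩ := h.sample.integral_fresh (h.measurable_state ht) hm
    (C := t * (sigma * c.gamma1) * c.nug) fun ω z =>
      (h.assumptions.abs_sum_mul_G_le (hx ω) (lam (t + 1) ω) z).trans
        (mul_le_mul_of_nonneg_right (h.norm_lam_le ht ω) h.admissible.nug_pos.le)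
  simp only [← h.assumptions.sum_mul_g (hx _)] at h2 h3
  exact ⟨h1, h2, h3⟩

/-- Complementarity violation. -/
theorem complementarity_le (h : IsBoundedRun μ P Q c ξ T sigma alpha tau Sig x1 x lam) :
    -∫ ω, ∑ t ∈ Finset.range T, ∑ i, lam (t + 1) ω i * Q.g P i (x (t + 1) ω) ∂μ
      ≤ T * (sigma / 2 * c.nug ^ 2 + c.kf ^ 2 / (2 * alpha)) := by
  have hσ := h.sigma_pos
  have hpath : ∀ ω, 0 ≤ ∑ t ∈ Finset.range T,
      ∑ i, lam (t + 1) ω i * Q.G i (x (t + 1) ω) (ξ (t + 1) ω)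
      + T * (sigma / 2 * c.nug ^ 2 + c.kf ^ 2 / (2 * alpha)) := by
    intro ω
    have h1 := Finset.sum_le_sum fun t (ht : t ∈ Finset.range T) =>
      (h.step t (Finset.mem_range.1 ht) ω).complementarity h.admissible
    rw [← Finset.mul_sum, Finset.sum_range_sub (fun t => ‖lam (t + 1) ω‖ ^ 2)] at h1
    simp only [add_assoc, Finset.sum_add_distrib, Finset.sum_const, Finset.card_range,
      nsmul_eq_mul] at h1
    rw [zero_add, h.lam_one, norm_zero] at h1
    have h2 : 0 ≤ 1 / (2 * sigma) * (‖lam (T + 1) ω‖ ^ 2 - 0 ^ 2) := by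
      have : 0 ≤ ‖lam (T + 1) ω‖ ^ 2 - 0 ^ 2 := by simp
      positivity
    linarith
  have hle : ∀ t ∈ Finset.range T, t ≤ T := fun t ht => (Finset.mem_range.1 ht).le
  have hi := integrable_finsetSum (Finset.range T) fun t ht =>
    (h.integral_sum_mul_G (hle t ht)).1
  have h1 : 0 ≤ ∫ ω, (∑ t ∈ Finset.range T,
      ∑ i, lam (t + 1) ω i * Q.G i (x (t + 1) ω) (ξ (t + 1) ω)
      + T * (sigma / 2 * c.nug ^ 2 + c.kf ^ 2 / (2 * alpha))) ∂μ := integral_nonneg hpath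
  rw [integral_add hi (integrable_const _)] at h1
  -- Term by term, the fresh sample is integrated out, turning sampled constraints into expected
  -- ones.
  rw [integral_finsetSum _ fun t ht => (h.integral_sum_mul_G (hle t ht)).1,
    Finset.sum_congr rfl fun t ht => (h.integral_sum_mul_G (hle t ht)).2.2,
    ← integral_finsetSum _ fun t ht => (h.integral_sum_mul_G (hle t ht)).2.1] at h1
  simp only [integral_const, probReal_univ, one_smul] at h1
  linarith

/-- The expected constraint values at the sampled and at the true constraint agree. -/
theorem integral_sum_G (h : IsBoundedRun μ P Q c ξ T sigma alpha tau Sig x1 x lam) (i : Fin p) :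
    ∫ ω, ∑ t ∈ Finset.range T, Q.G i (x (t + 1) ω) (ξ (t + 1) ω) ∂μ
      = ∫ ω, ∑ t ∈ Finset.range T, Q.g P i (x (t + 1) ω) ∂μ := by
  have hle : ∀ t ∈ Finset.range T, t ≤ T := fun t ht => (Finset.mem_range.1 ht).le
  rw [integral_finsetSum _ fun t ht => (h.integral_G (hle t ht) i).1,
    integral_finsetSum _ fun t ht => (h.integral_G (hle t ht) i).2.1]
  exact Finset.sum_congr rfl fun t ht => (h.integral_G (hle t ht) i).2.2

/-- Constraint violation. -/
theorem constraint_le (h : IsBoundedRun μ P Q c ξ T sigma alpha tau Sig x1 x lam)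
    (hσ1 : sigma ≤ 3 / 5) (hK : sigma * (tau + alpha) ≤ 2) (i : Fin p) :
    ∫ ω, ∑ t ∈ Finset.range T, Q.G i (x (t + 1) ω) (ξ (t + 1) ω) ∂μ
      ≤ c.gamma3 / sigma + T * ((c.kg + c.kS * c.D0 / 2) * (2 / alpha
        * (c.kf + (c.gamma3 + sigma * c.nug) * (√(p : ℝ) * (c.kg + c.kS * c.D0 / 2))))) := by
  have hc := h.admissible
  have hσ := h.sigma_pos
  have hα := h.alpha_pos
  have hκ : 0 ≤ c.kg + c.kS * c.D0 / 2 := by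
    have := hc.kg_pos; have := hc.kS_pos; have := hc.D0_pos; positivity
  have hle : ∀ t ∈ Finset.range T, t ≤ T := fun t ht => (Finset.mem_range.1 ht).le
  set κ := c.kg + c.kS * c.D0 / 2 with hκdef
  set m : ℝ := κ * (2 / alpha) with hm
  set s : ℝ := √(p : ℝ) * κ with hs
  have hm0 : 0 ≤ m := by positivity
  have hs0 : 0 ≤ s := by positivity
  have hpath : ∀ ω, ∑ t ∈ Finset.range T, Q.G i (x (t + 1) ω) (ξ (t + 1) ω)
      ≤ 1 / sigma * ‖lam (T + 1) ω‖
        + ∑ t ∈ Finset.range T, (m * (c.kf + sigma * c.nug * s) + m * s * ‖lam (t + 1) ω‖) := by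
    intro ω
    -- The multiplier increments telescope to λ^{T+1}ᵢ/σ; the step lengths are affine in ‖λ‖, so
    -- first moments suffice.
    have h1 : ∀ t ∈ Finset.range T, Q.G i (x (t + 1) ω) (ξ (t + 1) ω)
        ≤ (lam (t + 1 + 1) ω i - lam (t + 1) ω i) / sigma
          + (m * (c.kf + sigma * c.nug * s) + m * s * ‖lam (t + 1) ω‖) := by
      intro t ht
      have hst := h.step t (Finset.mem_range.1 ht) ω
      have h2 := hst.constraint_le hc i
      have h3 := mul_le_mul_of_nonneg_left (hst.norm_move_le hc) hκ
      refine h2.trans (add_le_add le_rfl (h3.trans (le_of_eq ?_)))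
      rw [hm, hs]; ring
    refine (Finset.sum_le_sum h1).trans ?_
    rw [Finset.sum_add_distrib, ← Finset.sum_div,
      Finset.sum_range_sub (fun t => lam (t + 1) ω i), zero_add, h.lam_one]
    refine add_le_add ?_ le_rfl
    rw [one_div, inv_mul_eq_div]
    refine div_le_div_of_nonneg_right ?_ hσ.le
    simpa using (le_abs_self _).trans (abs_apply_le_norm (lam (T + 1) ω) i)
  have hi1 : ∀ t ∈ Finset.range T, Integrable
      (fun ω => m * (c.kf + sigma * c.nug * s) + m * s * ‖lam (t + 1) ω‖) μ := fun t ht =>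
    (integrable_const _).add ((h.integrable_norm_lam (hle t ht)).const_mul _)
  have h1 := integral_mono (integrable_finsetSum _ fun t ht => (h.integral_G (hle t ht) i).1)
    (((h.integrable_norm_lam le_rfl).const_mul _).add (integrable_finsetSum _ hi1)) hpath
  refine h1.trans ?_
  simp only [Pi.add_apply]
  rw [integral_add ((h.integrable_norm_lam le_rfl).const_mul _) (integrable_finsetSum _ hi1),
    integral_const_mul, integral_finsetSum _ hi1]
  have h2 : ∀ t ∈ Finset.range T,
      ∫ ω, (m * (c.kf + sigma * c.nug * s) + m * s * ‖lam (t + 1) ω‖) ∂μ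
        ≤ m * (c.kf + sigma * c.nug * s) + m * s * c.gamma3 := by
    intro t ht
    rw [integral_add (integrable_const _) ((h.integrable_norm_lam (hle t ht)).const_mul _),
      integral_const_mul (m * s)]
    simp only [integral_const, probReal_univ, one_smul]
    have := mul_le_mul_of_nonneg_left (h.moments_le hσ1 hK (hle t ht)).1 (mul_nonneg hm0 hs0)
    linarith
  have h3 := Finset.sum_le_sum h2
  simp only [Finset.sum_const, Finset.card_range, nsmul_eq_mul] at h3
  have h4 := mul_le_mul_of_nonneg_left (h.moments_le hσ1 hK le_rfl).1
    (by positivity : 0 ≤ 1 / sigma)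
  refine (add_le_add h4 h3).trans (le_of_eq ?_)
  rw [hm]; ring

end IsBoundedRun

/-! ### Measurable choice of the proximal points. -/

/-- The proximal points of the Lagrangian can be chosen continuously in the multipliers and the
centre. -/
theorem Assumptions.exists_continuousOn_prox (hQ : Assumptions Q P c) (hα : 0 < alpha) :
    ∃ pr : E p × E n → E n,
      (∀ s, IsProx Q.X0 (fun y => Q.lagrangian P y s.1) alpha s.2 (pr s)) ∧
      ContinuousOn pr
        {s | (∀ i, 0 ≤ s.1 i) ∧ c.L0 + ∑ i, s.1 i * c.L i ≤ alpha / 2} := by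
  have hne : Q.X0.Nonempty := by
    obtain ⟨w, hw, -⟩ := hQ.slater; exact ⟨w, hw⟩
  choose pr hpr using fun s : E p × E n =>
    exists_isProx hQ.isCompact_X0 hne (hQ.continuousOn_lagrangian s.1) alpha s.2
  refine ⟨pr, hpr, ?_⟩
  intro s0 hs0
  -- The stability estimate: new multipliers change the Lagrangian by at most ν_g‖Δλ‖ uniformly on
  -- X₀, and a new centre contributes αD₀‖Δx‖.
  set b : E p × E n → ℝ := fun s => √(2 / alpha
    * (2 * c.nug * ‖s.1 - s0.1‖ + alpha * (c.D0 * ‖s.2 - s0.2‖))) with hb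
  have hbound : ∀ s ∈ {s : E p × E n | (∀ i, 0 ≤ s.1 i) ∧ c.L0 + ∑ i, s.1 i * c.L i ≤ alpha / 2},
      ‖pr s - pr s0‖ ≤ b s := by
    intro s hs
    refine Real.le_sqrt_of_sq_le ?_
    have h1 := (hpr s).stability (hpr s0) (hQ.weaklyConvexOn_lagrangian hs.1)
      (hQ.weaklyConvexOn_lagrangian hs0.1) hs.2 hs0.2
    have h2 : ∀ y ∈ Q.X0, |Q.lagrangian P y s.1 - Q.lagrangian P y s0.1|
        ≤ ‖s.1 - s0.1‖ * c.nug := by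
      intro y hy
      have h3 := hQ.abs_sum_mul_g_le (hQ.subset hy) (s.1 - s0.1)
      have h4 : Q.lagrangian P y s.1 - Q.lagrangian P y s0.1
          = ∑ i, (s.1 - s0.1) i * Q.g P i y := by
        simp [Problem.lagrangian, sub_mul, Finset.sum_sub_distrib]
      rwa [h4]
    have h3 := (abs_le.1 (h2 _ (hpr s0).mem)).2
    have h4 := (abs_le.1 (h2 _ (hpr s).mem)).1
    have h5 : inner ℝ (pr s - pr s0) (s.2 - s0.2) ≤ c.D0 * ‖s.2 - s0.2‖ :=
      (real_inner_le_norm _ _).trans (mul_le_mul_of_nonneg_right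
        (hQ.diam_le _ (hpr s).mem _ (hpr s0).mem) (norm_nonneg _))
    have h6 := mul_le_mul_of_nonneg_left h5 hα.le
    rw [div_mul_eq_mul_div, le_div_iff₀ hα]
    linarith
  have hb0 : Filter.Tendsto b (nhdsWithin s0
      {s | (∀ i, 0 ≤ s.1 i) ∧ c.L0 + ∑ i, s.1 i * c.L i ≤ alpha / 2}) (nhds 0) := by
    have h1 : Continuous b := by fun_prop
    have h2 : b s0 = 0 := by simp [hb]
    rw [← h2]
    exact h1.continuousWithinAt
  rw [ContinuousWithinAt, tendsto_iff_norm_sub_tendsto_zero]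
  exact squeeze_zero' (Filter.Eventually.of_forall fun s => norm_nonneg _)
    (Filter.eventually_of_mem self_mem_nhdsWithin hbound) hb0

/-- The continuous selection composed with the state depends on the past only, so the next sample is
independent of the proximal point. -/
theorem IsBoundedRun.exists_prox (h : IsBoundedRun μ P Q c ξ T sigma alpha tau Sig x1 x lam)
    (hρ : ∀ t < T, ∀ ω, c.L0 + ∑ i, lam (t + 1) ω i * c.L i ≤ alpha / 2) :
    ∃ xt : ℕ → Ω → E n, ∀ t < T,
      (∀ ω, IsProx Q.X0 (fun y => Q.lagrangian P y (lam (t + 1) ω)) alpha (x (t + 1) ω) (xt t ω)) ∧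
      Measurable[history ξ t] (xt t) := by
  obtain ⟨pr, hpr, hcont⟩ := h.assumptions.exists_continuousOn_prox h.alpha_pos
  refine ⟨fun t ω => pr (lam (t + 1) ω, x (t + 1) ω), fun t ht => ⟨fun ω => hpr (lam (t + 1) ω, x (t + 1) ω), ?_⟩⟩
  have hmem : ∀ ω, (lam (t + 1) ω, x (t + 1) ω)
      ∈ {s : E p × E n | (∀ i, 0 ≤ s.1 i) ∧ c.L0 + ∑ i, s.1 i * c.L i ≤ alpha / 2} := fun ω =>
    ⟨h.lam_nonneg ht.le ω, hρ t ht ω⟩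
  have h1 := (continuousOn_iff_continuous_domRestrict.1 hcont).measurable
  have h2 : Measurable[history ξ t] fun ω => (lam (t + 1) ω, x (t + 1) ω) :=
    (h.measurable_lam t ht.le).prodMk (h.measurable_x t ht.le)
  exact h1.comp (Measurable.subtype_mk h2 (h := hmem))

end Run

/-! ### Decrease of the Moreau envelope. -/

section Run

set_option linter.unusedSectionVars false

variable {n p : ℕ} {Ω Ξ : Type*} [MeasurableSpace Ω] [MeasurableSpace Ξ]
  {μ : Measure Ω} [IsProbabilityMeasure μ] {P : Measure Ξ} [IsProbabilityMeasure P]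
  {Q : Problem n p Ξ} {c : Consts p} {ξ : ℕ → Ω → Ξ}
  {T : ℕ} {sigma alpha tau : ℝ} {Sig : ℕ → Fin p → Ω → Matrix (Fin n) (Fin n) ℝ}
  {x1 : E n} {x : ℕ → Ω → E n} {lam : ℕ → Ω → E p}

theorem Assumptions.exists_isProx (hQ : Assumptions Q P c) (u : E p) (α : ℝ) (y : E n) :
    ∃ z, IsProx Q.X0 (fun y => Q.lagrangian P y u) α y z := by
  obtain ⟨w, hw, -⟩ := hQ.slater
  exact PMQS.exists_isProx hQ.isCompact_X0 ⟨w, hw⟩ (hQ.continuousOn_lagrangian u) α y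

/-- The Moreau envelope with parameter `1/α` of the Lagrangian on `X₀`. -/
noncomputable def envelope (Q : Problem n p Ξ) (P : Measure Ξ) (α : ℝ) (u : E p) (y : E n) : ℝ :=
  moreauEnvelope Q.X0 (fun y => Q.lagrangian P y u) (1 / α) y

theorem Assumptions.envelope_le (hQ : Assumptions Q P c) (α : ℝ) (u : E p) (y : E n) {z : E n}
    (hz : z ∈ Q.X0) : envelope Q P α u y ≤ Q.lagrangian P z u + α / 2 * ‖z - y‖ ^ 2 := by
  obtain ⟨w, hw⟩ := hQ.exists_isProx u α y
  rw [envelope, hw.moreauEnvelope_eq]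
  exact hw.le z hz

/-- The proximal point for the old multipliers is a competitor for the new ones; this is the price
of the multiplier update in the telescoping sum. -/
theorem Assumptions.envelope_sub_le (hQ : Assumptions Q P c) (α : ℝ) (u u' : E p) (y : E n) :
    envelope Q P α u' y - envelope Q P α u y ≤ c.nug * ‖u' - u‖ := by
  obtain ⟨w, hw⟩ := hQ.exists_isProx u α y
  have h1 := hQ.envelope_le α u' y hw.mem
  have h2 := (abs_le.1 (hQ.abs_sum_mul_g_le (hQ.subset hw.mem) (u' - u))).2
  have h3 : Q.lagrangian P w u' - Q.lagrangian P w u = ∑ i, (u' - u) i * Q.g P i w := by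
    simp [Problem.lagrangian, sub_mul, Finset.sum_sub_distrib]
  have h4 : envelope Q P α u y = Q.lagrangian P w u + α / 2 * ‖w - y‖ ^ 2 := hw.moreauEnvelope_eq
  rw [h4]
  linarith

theorem Assumptions.le_envelope (hQ : Assumptions Q P c) {α : ℝ} (hα : 0 ≤ α) (u : E p) (y : E n) :
    sInf (Q.f P '' Q.X0) - c.nug * ‖u‖ ≤ envelope Q P α u y := by
  obtain ⟨w, hw⟩ := hQ.exists_isProx u α y
  have h4 : envelope Q P α u y = Q.lagrangian P w u + α / 2 * ‖w - y‖ ^ 2 := hw.moreauEnvelope_eq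
  have h1 := csInf_le hQ.bddBelow_f (Set.mem_image_of_mem _ hw.mem)
  have h2 := (abs_le.1 (hQ.abs_sum_mul_g_le (hQ.subset hw.mem) u)).1
  have h3 : 0 ≤ α / 2 * ‖w - y‖ ^ 2 := by positivity
  rw [h4, Problem.lagrangian]
  linarith

namespace IsBoundedRun

/-- One-step decrease of the Moreau envelope, in terms of the sampled Lagrangian. -/
theorem envelope_descent (h : IsBoundedRun μ P Q c ξ T sigma alpha tau Sig x1 x lam)
    {t : ℕ} (ht : t < T) (ω : Ω)
    (hρ : c.L0 + ∑ i, lam (t + 1) ω i * c.L i ≤ alpha / 2) {z : E n}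
    (hz : IsProx Q.X0 (fun y => Q.lagrangian P y (lam (t + 1) ω)) alpha (x (t + 1) ω) z) :
    alpha ^ 2 * ‖z - x (t + 1) ω‖ ^ 2
      ≤ 2 * (tau + alpha) * (envelope Q P alpha (lam (t + 1) ω) (x (t + 1) ω)
          - envelope Q P alpha (lam (t + 1) ω) (x (t + 1 + 1) ω))
        + 2 * alpha * ((Q.F z (ξ (t + 1) ω) + ∑ i, lam (t + 1) ω i * Q.G i z (ξ (t + 1) ω)
            - (Q.F (x (t + 1) ω) (ξ (t + 1) ω)
              + ∑ i, lam (t + 1) ω i * Q.G i (x (t + 1) ω) (ξ (t + 1) ω)))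
          - (Q.lagrangian P z (lam (t + 1) ω) - Q.lagrangian P (x (t + 1) ω) (lam (t + 1) ω)))
        + (alpha * (sigma * c.gamma1 ^ 2 + c.eps0 * (sigma * c.gamma1))
          + alpha / (tau + alpha) * (c.kf + √(p : ℝ) * c.kg * ‖lam (t + 1) ω‖) ^ 2) := by
  have hα := h.alpha_pos
  have hα' : 0 < tau + alpha := add_pos_of_nonneg_of_pos h.tau_nonneg hα
  have hQ := h.assumptions
  have h1 := (h.step t ht ω).descent h.admissible hz.mem
  have h2 := hz.growth (hQ.weaklyConvexOn_lagrangian (h.lam_nonneg ht.le ω)) (h.x_mem t ht.le ω)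
  rw [sub_self, norm_zero, norm_sub_rev (x (t + 1) ω) z] at h2
  have h3 : envelope Q P alpha (lam (t + 1) ω) (x (t + 1) ω) = _ := hz.moreauEnvelope_eq
  have h4 := hQ.envelope_le alpha (lam (t + 1) ω) (x (t + 1 + 1) ω) hz.mem
  rw [h3]
  set A := ‖z - x (t + 1 + 1) ω‖ ^ 2
  set B := ‖z - x (t + 1) ω‖ ^ 2
  set ρ := c.L0 + ∑ i, lam (t + 1) ω i * c.L i
  set k := (c.kf + √(p : ℝ) * c.kg * ‖lam (t + 1) ω‖) ^ 2
  have hB : 0 ≤ B := sq_nonneg _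
  have h5 := mul_le_mul_of_nonneg_left h1 (by positivity : 0 ≤ 2 * alpha)
  have h6 := mul_le_mul_of_nonneg_left h4 (by positivity : 0 ≤ 2 * (tau + alpha))
  have h7 := mul_le_mul_of_nonneg_left h2 (by positivity : 0 ≤ 2 * alpha)
  have h8 := mul_le_mul_of_nonneg_right hρ (mul_nonneg hα.le hB)
  have e : 2 * alpha * (k / (2 * (tau + alpha))) = alpha / (tau + alpha) * k := by
    field_simp
  simp only [mul_add, mul_sub] at h5 h6 h7 e ⊢
  -- Growth at z yields 2α² - αρ in front of ‖z-x‖² and the descent inequality costs αρ; ρ ≤ α/2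
  -- leaves at least α².
  nlinarith

/-- The decrease of the sampled Lagrangian has the right mean. -/
theorem integral_lagrangian_sub (h : IsBoundedRun μ P Q c ξ T sigma alpha tau Sig x1 x lam)
    {t : ℕ} (ht : t ≤ T) {y : Ω → E n} (hy : Measurable[history ξ t] y)
    (hmem : ∀ ω, y ω ∈ Q.X0) :
    Integrable (fun ω =>
      (Q.F (y ω) (ξ (t + 1) ω) + ∑ i, lam (t + 1) ω i * Q.G i (y ω) (ξ (t + 1) ω)
        - (Q.F (x (t + 1) ω) (ξ (t + 1) ω)
          + ∑ i, lam (t + 1) ω i * Q.G i (x (t + 1) ω) (ξ (t + 1) ω)))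
      - (Q.lagrangian P (y ω) (lam (t + 1) ω)
        - Q.lagrangian P (x (t + 1) ω) (lam (t + 1) ω))) μ ∧
    ∫ ω, ((Q.F (y ω) (ξ (t + 1) ω) + ∑ i, lam (t + 1) ω i * Q.G i (y ω) (ξ (t + 1) ω)
        - (Q.F (x (t + 1) ω) (ξ (t + 1) ω)
          + ∑ i, lam (t + 1) ω i * Q.G i (x (t + 1) ω) (ξ (t + 1) ω)))
      - (Q.lagrangian P (y ω) (lam (t + 1) ω)
        - Q.lagrangian P (x (t + 1) ω) (lam (t + 1) ω))) ∂μ = 0 := by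
  have hQ := h.assumptions
  have hc := h.admissible
  set H : Q.X0 × (Q.X0 × E p) → Ξ → ℝ := fun s z =>
    Q.F s.1 z + ∑ i, s.2.2 i * Q.G i s.1 z - (Q.F s.2.1 z + ∑ i, s.2.2 i * Q.G i s.2.1 z) with hH
  have hX : Measurable[history ξ t] fun ω => ((⟨y ω, hmem ω⟩ : Q.X0),
      ((⟨x (t + 1) ω, h.x_mem t ht ω⟩ : Q.X0), lam (t + 1) ω)) :=
    Measurable.prodMk (Measurable.subtype_mk hy) (h.measurable_state ht)
  have hHm : Measurable (Function.uncurry H) := by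
    have a1 : Measurable fun q : (Q.X0 × (Q.X0 × E p)) × Ξ => (q.1.1, q.2) := by fun_prop
    have a2 : Measurable fun q : (Q.X0 × (Q.X0 × E p)) × Ξ => (q.1.2.1, q.2) := by fun_prop
    have b1 := hQ.measurable_uncurry_F.comp a1
    have b2 := hQ.measurable_uncurry_F.comp a2
    have b3 := fun i => (hQ.measurable_uncurry_G i).comp a1
    have b4 := fun i => (hQ.measurable_uncurry_G i).comp a2
    have b5 : ∀ i, Measurable fun q : (Q.X0 × (Q.X0 × E p)) × Ξ => q.1.2.2 i := fun i => by
      fun_prop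
    exact (b1.add (Finset.measurable_fun_sum _ fun i _ => (b5 i).mul (b3 i))).sub
      (b2.add (Finset.measurable_fun_sum _ fun i _ => (b5 i).mul (b4 i)))
  have hxO : ∀ ω, x (t + 1) ω ∈ Q.O0 := fun ω => hQ.subset (h.x_mem t ht ω)
  have hyO : ∀ ω, y ω ∈ Q.O0 := fun ω => hQ.subset (hmem ω)
  have hbound : ∀ ω z, |H ((⟨y ω, hmem ω⟩ : Q.X0),
      ((⟨x (t + 1) ω, h.x_mem t ht ω⟩ : Q.X0), lam (t + 1) ω)) z|
      ≤ c.kf * c.D0 + 2 * (t * (sigma * c.gamma1) * c.nug) := by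
    intro ω z
    have a1 := (hQ.abs_F_sub_le (hyO ω) (hxO ω) z).trans (mul_le_mul_of_nonneg_left
      (hQ.diam_le _ (hmem ω) _ (h.x_mem t ht ω)) hc.kf_pos.le)
    have a2 := mul_le_mul_of_nonneg_right (h.norm_lam_le ht ω) hc.nug_pos.le
    have a3 := (hQ.abs_sum_mul_G_le (hyO ω) (lam (t + 1) ω) z).trans a2
    have a4 := (hQ.abs_sum_mul_G_le (hxO ω) (lam (t + 1) ω) z).trans a2
    rw [abs_le] at a1 a3 a4 ⊢
    simp only [hH]
    constructor <;> linarith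
  obtain ⟨h1, h2, h3⟩ := h.sample.integral_fresh hX hHm hbound
  have hinner : ∀ ω, ∫ z, H ((⟨y ω, hmem ω⟩ : Q.X0),
      ((⟨x (t + 1) ω, h.x_mem t ht ω⟩ : Q.X0), lam (t + 1) ω)) z ∂P
      = Q.lagrangian P (y ω) (lam (t + 1) ω) - Q.lagrangian P (x (t + 1) ω) (lam (t + 1) ω) := by
    intro ω
    have hi : ∀ {v : E n}, v ∈ Q.O0 →
        Integrable (fun z => Q.F v z + ∑ i, lam (t + 1) ω i * Q.G i v z) P := fun {v} hv =>
      (hQ.integrable_F v hv).add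
        (integrable_finsetSum _ fun i _ => (hQ.integrable_G i v hv).const_mul _)
    rw [hQ.lagrangian_eq_integral (hyO ω), hQ.lagrangian_eq_integral (hxO ω),
      ← integral_sub (hi (hyO ω)) (hi (hxO ω))]
  simp only [hinner] at h2 h3
  refine ⟨h1.sub h2, ?_⟩
  have h4 := integral_sub h1 h2
  rw [h3, sub_self] at h4
  exact h4

/-- The expected squared distances to the proximal points. -/
theorem integral_prox_sq_le (h : IsBoundedRun μ P Q c ξ T sigma alpha tau Sig x1 x lam)
    (hσ1 : sigma ≤ 3 / 5) (hK : sigma * (tau + alpha) ≤ 2)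
    (hρ : ∀ t < T, ∀ ω, c.L0 + ∑ i, lam (t + 1) ω i * c.L i ≤ alpha / 2)
    {xt : ℕ → Ω → E n} (hxt : ∀ t < T,
      (∀ ω, IsProx Q.X0 (fun y => Q.lagrangian P y (lam (t + 1) ω)) alpha (x (t + 1) ω) (xt t ω)) ∧
      Measurable[history ξ t] (xt t)) :
    (∀ t < T, Integrable (fun ω => alpha ^ 2 * ‖xt t ω - x (t + 1) ω‖ ^ 2) μ) ∧
    ∫ ω, ∑ t ∈ Finset.range T, alpha ^ 2 * ‖xt t ω - x (t + 1) ω‖ ^ 2 ∂μ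
      ≤ 2 * (tau + alpha) * (Q.f P x1 - sInf (Q.f P '' Q.X0) + c.nug * c.gamma3
          + T * (c.nug * (sigma * c.gamma1)))
        + T * (alpha * (sigma * c.gamma1 ^ 2 + c.eps0 * (sigma * c.gamma1))
          + alpha / (tau + alpha) * (2 * c.kf ^ 2 + 2 * p * c.kg ^ 2 * c.gamma4 sigma)) := by
  have hc := h.admissible
  have hQ := h.assumptions
  have hα := h.alpha_pos
  have hσ := h.sigma_pos
  have hα' : 0 < tau + alpha := add_pos_of_nonneg_of_pos h.tau_nonneg hα
  have hint : ∀ t < T, Integrable (fun ω => alpha ^ 2 * ‖xt t ω - x (t + 1) ω‖ ^ 2) μ := by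
    intro t ht
    have hm : Measurable (xt t) := (hxt t ht).2.mono (h.sample.history_le t) le_rfl
    have hm' := h.measurable_x' ht.le
    refine (Integrable.of_bound (Measurable.aestronglyMeasurable (by fun_prop)) (c.D0 ^ 2)
      (Filter.Eventually.of_forall fun ω => ?_)).const_mul _
    rw [norm_pow, norm_norm]
    exact pow_le_pow_left₀ (norm_nonneg _)
      (hQ.diam_le _ ((hxt t ht).1 ω).mem _ (h.x_mem t ht.le ω)) 2
  refine ⟨hint, ?_⟩
  set N : ℕ → Ω → ℝ := fun t ω =>
    (Q.F (xt t ω) (ξ (t + 1) ω) + ∑ i, lam (t + 1) ω i * Q.G i (xt t ω) (ξ (t + 1) ω)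
        - (Q.F (x (t + 1) ω) (ξ (t + 1) ω)
          + ∑ i, lam (t + 1) ω i * Q.G i (x (t + 1) ω) (ξ (t + 1) ω)))
      - (Q.lagrangian P (xt t ω) (lam (t + 1) ω)
        - Q.lagrangian P (x (t + 1) ω) (lam (t + 1) ω)) with hN
  set C1 := alpha * (sigma * c.gamma1 ^ 2 + c.eps0 * (sigma * c.gamma1)) with hC1
  set R : ℕ → Ω → ℝ := fun t ω => 2 * alpha * N t ω + (C1 + alpha / (tau + alpha)
    * (2 * c.kf ^ 2 + 2 * p * c.kg ^ 2 * ‖lam (t + 1) ω‖ ^ 2)) with hR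
  set e : ℕ → Ω → ℝ := fun t ω => envelope Q P alpha (lam (t + 1) ω) (x (t + 1) ω) with he
  have hstep : ∀ t < T, ∀ ω, alpha ^ 2 * ‖xt t ω - x (t + 1) ω‖ ^ 2
      ≤ 2 * (tau + alpha) * (e t ω - e (t + 1) ω + c.nug * (sigma * c.gamma1)) + R t ω := by
    intro t ht ω
    have h1 := h.envelope_descent ht ω (hρ t ht ω) ((hxt t ht).1 ω)
    have h2 := hQ.envelope_sub_le alpha (lam (t + 1) ω) (lam (t + 1 + 1) ω) (x (t + 1 + 1) ω)
    have h3 := mul_le_mul_of_nonneg_left ((h.step t ht ω).norm_sub_le hc) hc.nug_pos.le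
    have h4 : e t ω - envelope Q P alpha (lam (t + 1) ω) (x (t + 1 + 1) ω)
        ≤ e t ω - e (t + 1) ω + c.nug * (sigma * c.gamma1) := by
      simp only [he]; linarith
    have h5 := mul_le_mul_of_nonneg_left h4 (by positivity : 0 ≤ 2 * (tau + alpha))
    have h6 : (c.kf + √(p : ℝ) * c.kg * ‖lam (t + 1) ω‖) ^ 2
        ≤ 2 * c.kf ^ 2 + 2 * p * c.kg ^ 2 * ‖lam (t + 1) ω‖ ^ 2 := by
      have h7 : (√(p : ℝ) * c.kg * ‖lam (t + 1) ω‖) ^ 2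
          = p * c.kg ^ 2 * ‖lam (t + 1) ω‖ ^ 2 := by
        rw [mul_pow, mul_pow, Real.sq_sqrt (by positivity)]
      nlinarith [sq_nonneg (c.kf - √(p : ℝ) * c.kg * ‖lam (t + 1) ω‖)]
    have h8 := mul_le_mul_of_nonneg_left h6 (by positivity : 0 ≤ alpha / (tau + alpha))
    simp only [hR, hN, hC1]
    linarith
  have hpath : ∀ ω, ∑ t ∈ Finset.range T, alpha ^ 2 * ‖xt t ω - x (t + 1) ω‖ ^ 2
      ≤ 2 * (tau + alpha) * (Q.f P x1 - sInf (Q.f P '' Q.X0) + T * (c.nug * (sigma * c.gamma1)))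
        + 2 * (tau + alpha) * c.nug * ‖lam (T + 1) ω‖ + ∑ t ∈ Finset.range T, R t ω := by
    intro ω
    have h1 := Finset.sum_le_sum fun t (ht : t ∈ Finset.range T) =>
      hstep t (Finset.mem_range.1 ht) ω
    have hsum : ∀ R' : ℕ → ℝ, ∑ t ∈ Finset.range T,
        (2 * (tau + alpha) * (e t ω - e (t + 1) ω + c.nug * (sigma * c.gamma1)) + R' t)
        = 2 * (tau + alpha) * (e 0 ω - e T ω + T * (c.nug * (sigma * c.gamma1)))
          + ∑ t ∈ Finset.range T, R' t := by
      intro R'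
      rw [Finset.sum_add_distrib, ← Finset.mul_sum, Finset.sum_add_distrib,
        Finset.sum_range_sub' (fun t => e t ω)]
      simp only [Finset.sum_const, Finset.card_range, nsmul_eq_mul]
    rw [hsum fun t => R t ω] at h1
    -- λ¹ = 0 reduces the Lagrangian to f, and x¹ itself is a competitor in the envelope.
    have h2 : e 0 ω ≤ Q.f P x1 := by
      have h3 := hQ.envelope_le alpha (lam (0 + 1) ω) (x (0 + 1) ω) (h.x_mem 0 (Nat.zero_le T) ω)
      simp only [zero_add, h.x_one, h.lam_one] at h3
      simp only [he, zero_add, h.x_one, h.lam_one]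
      refine h3.trans (le_of_eq ?_)
      simp [Problem.lagrangian]
    have h3 := hQ.le_envelope hα.le (lam (T + 1) ω) (x (T + 1) ω)
    have h4 : e 0 ω - e T ω + T * (c.nug * (sigma * c.gamma1))
        ≤ Q.f P x1 - sInf (Q.f P '' Q.X0) + c.nug * ‖lam (T + 1) ω‖
          + T * (c.nug * (sigma * c.gamma1)) := by
      simp only [he] at h2 ⊢; linarith
    have h5 := mul_le_mul_of_nonneg_left h4 (by positivity : 0 ≤ 2 * (tau + alpha))
    linarith
  have hNi : ∀ t ∈ Finset.range T, Integrable (N t) μ ∧ ∫ ω, N t ω ∂μ = 0 := fun t ht =>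
    h.integral_lagrangian_sub (Finset.mem_range.1 ht).le (hxt t (Finset.mem_range.1 ht)).2
      fun ω => ((hxt t (Finset.mem_range.1 ht)).1 ω).mem
  have hYi : ∀ t ∈ Finset.range T, Integrable (fun ω => C1 + alpha / (tau + alpha)
      * (2 * c.kf ^ 2 + 2 * p * c.kg ^ 2 * ‖lam (t + 1) ω‖ ^ 2)) μ := fun t ht =>
    (integrable_const _).add (((integrable_const _).add
      ((h.integrable_norm_lam_sq (Finset.mem_range.1 ht).le).const_mul _)).const_mul _)
  have hRi : ∀ t ∈ Finset.range T, Integrable (R t) μ := fun t ht =>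
    ((hNi t ht).1.const_mul _).add (hYi t ht)
  have hRle : ∀ t ∈ Finset.range T, ∫ ω, R t ω ∂μ ≤ C1 + alpha / (tau + alpha)
      * (2 * c.kf ^ 2 + 2 * p * c.kg ^ 2 * c.gamma4 sigma) := by
    intro t ht
    have hsq := h.integrable_norm_lam_sq (Finset.mem_range.1 ht).le
    have h1 : ∫ ω, R t ω ∂μ = C1 + alpha / (tau + alpha)
        * (2 * c.kf ^ 2 + 2 * p * c.kg ^ 2 * ∫ ω, ‖lam (t + 1) ω‖ ^ 2 ∂μ) := by
      have hi : Integrable (fun ω => 2 * c.kf ^ 2 + 2 * p * c.kg ^ 2 * ‖lam (t + 1) ω‖ ^ 2) μ :=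
        (integrable_const _).add (hsq.const_mul _)
      simp only [hR]
      rw [integral_add ((hNi t ht).1.const_mul _) (hYi t ht), integral_const_mul, (hNi t ht).2,
        integral_add (integrable_const _) (hi.const_mul _), integral_const_mul (alpha / (tau + alpha)),
        integral_add (integrable_const _) (hsq.const_mul _), integral_const_mul (2 * p * c.kg ^ 2)]
      simp
    rw [h1]
    have h2 := (h.moments_le hσ1 hK (Finset.mem_range.1 ht).le).2
    have h3 := mul_le_mul_of_nonneg_left h2 (by positivity : 0 ≤ 2 * p * c.kg ^ 2)
    have h4 := mul_le_mul_of_nonneg_left (add_le_add (le_refl (2 * c.kf ^ 2)) h3)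
      (by positivity : 0 ≤ alpha / (tau + alpha))
    linarith
  have hl := h.integrable_norm_lam (le_refl T)
  have hli : Integrable (fun ω => 2 * (tau + alpha)
      * (Q.f P x1 - sInf (Q.f P '' Q.X0) + T * (c.nug * (sigma * c.gamma1)))
      + 2 * (tau + alpha) * c.nug * ‖lam (T + 1) ω‖) μ :=
    (integrable_const _).add (hl.const_mul _)
  have h1 := integral_mono (integrable_finsetSum _ fun t ht => hint t (Finset.mem_range.1 ht))
    (hli.add (integrable_finsetSum _ hRi)) hpath
  simp only [Pi.add_apply] at h1
  rw [integral_add hli (integrable_finsetSum _ hRi), integral_finsetSum _ hRi,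
    integral_add (integrable_const _) (hl.const_mul _),
    integral_const_mul (2 * (tau + alpha) * c.nug)] at h1
  simp only [integral_const, probReal_univ, one_smul] at h1
  have h2 := Finset.sum_le_sum hRle
  simp only [Finset.sum_const, Finset.card_range, nsmul_eq_mul] at h2
  have h3 := mul_le_mul_of_nonneg_left (h.moments_le hσ1 hK (le_refl T)).1
    (mul_nonneg (by positivity : 0 ≤ 2 * (tau + alpha)) hc.nug_pos.le)
  linarith

end IsBoundedRun

end Run

theorem sum_Icc_one_eq_sum_range (T : ℕ) (a : ℕ → ℝ) :
    ∑ t ∈ Finset.Icc 1 T, a t = ∑ t ∈ Finset.range T, a (t + 1) := by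
  rw [Finset.range_eq_Ico, Finset.sum_Ico_add' a 0 T 1]
  rfl

/-! ### Rates in q = T^{1/4}. -/

section Parameters

variable {p : ℕ} {c : Consts p}

theorem Consts.Admissible.one_lt_beta (hc : c.Admissible) : 1 < c.beta := by
  have h1 : 0 ≤ ∑ j, c.gamma2 * c.L j :=
    Finset.sum_nonneg fun j _ => mul_nonneg (IsStep.gamma2_nonneg hc) (hc.L_pos j).le
  have := hc.L0_pos
  unfold beta
  linarith

/-- Rates in `q = T^{1/4}` of the envelope bound. -/
theorem envelope_rate_le {q σ β Δ ν γ g ε k m : ℝ} (hq : 1 ≤ q) (hβ : 0 < β) (hσ : σ = (q ^ 3)⁻¹)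
    (hΔ : 0 ≤ Δ) (hν : 0 < ν) (hγ : 0 < γ) (hg : 0 < g) (hk : 0 ≤ k) (hm : 0 ≤ m) :
    1 / q ^ 4 * (2 * (q ^ 2 + β * q) * (Δ + ν * γ + q ^ 4 * (ν * (σ * g)))
        + q ^ 4 * (β * q * (σ * g ^ 2 + ε * (σ * g))
          + β * q / (q ^ 2 + β * q) * (2 * k + 2 * m)))
      ≤ 2 * ((β + 1) / q ^ 2) * (Δ + ν * γ) + 2 * ((β + 1) / q) * (ν * g)
        + β / q ^ 2 * (g ^ 2 + ε * g) + β / q * (2 * k + 2 * m) := by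
  have hq0 : 0 < q := zero_lt_one.trans_le hq
  have e : 1 / q ^ 4 * (2 * (q ^ 2 + β * q) * (Δ + ν * γ + q ^ 4 * (ν * (σ * g)))
        + q ^ 4 * (β * q * (σ * g ^ 2 + ε * (σ * g))
          + β * q / (q ^ 2 + β * q) * (2 * k + 2 * m)))
      = 2 * ((q ^ 2 + β * q) / q ^ 4) * (Δ + ν * γ)
        + 2 * ((q ^ 2 + β * q) / q ^ 3) * (ν * g)
        + β / q ^ 2 * (g ^ 2 + ε * g) + β / (q + β) * (2 * k + 2 * m) := by
    have e1 : q ^ 2 + β * q = q * (q + β) := by ring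
    rw [hσ, e1]
    field_simp
    ring
  rw [e]
  have hqq : q ≤ q ^ 2 := by nlinarith
  have hα' : q ^ 2 + β * q ≤ (β + 1) * q ^ 2 := by nlinarith [mul_le_mul_of_nonneg_left hqq hβ.le]
  have h1 : (q ^ 2 + β * q) / q ^ 4 ≤ (β + 1) / q ^ 2 := by
    rw [div_le_div_iff₀ (by positivity) (by positivity)]
    nlinarith [mul_le_mul_of_nonneg_right hα' (sq_nonneg q)]
  have h2 : (q ^ 2 + β * q) / q ^ 3 ≤ (β + 1) / q := by
    rw [div_le_div_iff₀ (by positivity) (by positivity)]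
    nlinarith [mul_le_mul_of_nonneg_right hα' hq0.le]
  have h3 : β / (q + β) ≤ β / q := div_le_div_of_nonneg_left hβ.le hq0 (by linarith)
  have h4 := mul_le_mul_of_nonneg_right h1 (by positivity : 0 ≤ Δ + ν * γ)
  have h5 := mul_le_mul_of_nonneg_right h2 (by positivity : 0 ≤ ν * g)
  have h7 := mul_le_mul_of_nonneg_right h3 (by positivity : 0 ≤ 2 * k + 2 * m)
  linarith only [h4, h5, h7]

/-- The final estimate of the envelope bound, with `q = T^{1/4}`. -/
theorem Consts.Admissible.envelope_bound_le (hc : c.Admissible) {q Δ σ X : ℝ} (hq : 1 ≤ q)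
    (hΔ : 0 ≤ Δ) (hσ0 : 0 < σ) (hσ : σ = (q ^ 3)⁻¹) (hX : 0 ≤ X) :
    1 / q ^ 4 * (2 * (q ^ 2 + c.beta * q)
          * (Δ + c.nug * c.gamma3 + q ^ 4 * (c.nug * (σ * c.gamma1)))
        + q ^ 4 * (c.beta * q * (σ * c.gamma1 ^ 2 + c.eps0 * (σ * c.gamma1))
          + c.beta * q / (q ^ 2 + c.beta * q)
            * (2 * c.kf ^ 2 + 2 * p * c.kg ^ 2 * c.gamma4 σ)))
      ≤ 4 * (c.beta + 1) / q ^ 2 * Δ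
        + 4 / q ^ 2 * ((c.beta + 1) * c.nug * c.gamma3
            + c.beta * c.D0 * c.gamma2 * p * (c.kg + c.kS * c.D0))
        + 4 / q * ((c.beta + 1) * c.nug * c.gamma1 + c.beta * (c.kf + X) ^ 2
            + c.beta * p * c.kg ^ 2 * c.gamma4 σ)
        + 8 * c.beta / q ^ 4 * p * c.kg ^ 2 * c.gamma1 * c.gamma3
        + 4 * c.beta / q ^ 7 * c.gamma1 ^ 2 * p * c.kg ^ 2 := by
  have hβ := zero_lt_one.trans hc.one_lt_beta
  have hq0 : 0 < q := zero_lt_one.trans_le hq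
  have hν := hc.nug_pos
  have hε := hc.eps0_pos
  have hγ1 := hc.gamma1_pos
  have hγ3 := hc.gamma3_pos
  have hγ2 := IsStep.gamma2_nonneg hc
  have hkg := hc.kg_pos
  have hkf := hc.kf_pos
  have hkS := hc.kS_pos
  have hD := hc.D0_pos
  have hγ4 : 0 ≤ c.gamma4 σ := by
    have := hc.le_gamma4 hσ0 le_rfl hγ3.le le_rfl (by positivity)
    simpa using this
  -- From 77γ₁² ≤ ε₀γ₃ ≤ ν_gγ₃ and ε₀ ≤ γ₁: the O(σ) errors of the descent inequality fit into the
  -- γ₃ term.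
  have hsq : c.gamma1 ^ 2 + c.eps0 * c.gamma1 ≤ 2 * (c.nug * c.gamma3) := by
    have h1 := hc.gamma1_sq_div_le
    rw [← mul_div_assoc, div_le_iff₀ hε] at h1
    have h2 : c.eps0 * c.gamma1 ≤ c.gamma1 * c.gamma1 :=
      mul_le_mul_of_nonneg_right (hc.eps0_le.trans hc.nug_le_gamma1) hγ1.le
    have h3 : c.gamma3 * c.eps0 ≤ c.nug * c.gamma3 := by
      rw [mul_comm]; exact mul_le_mul_of_nonneg_right hc.eps0_le hγ3.le
    nlinarith only [h1, h2, h3, sq_nonneg c.gamma1]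
  have hkX : c.kf ^ 2 ≤ (c.kf + X) ^ 2 := pow_le_pow_left₀ hkf.le (by linarith) 2
  have h0 := envelope_rate_le (ε := c.eps0) hq hβ hσ hΔ hν hγ3 hγ1 (sq_nonneg c.kf)
    (by positivity : 0 ≤ p * c.kg ^ 2 * c.gamma4 σ)
  have e : 2 * c.kf ^ 2 + 2 * p * c.kg ^ 2 * c.gamma4 σ
      = 2 * c.kf ^ 2 + 2 * (p * c.kg ^ 2 * c.gamma4 σ) := by ring
  rw [e]
  refine h0.trans ?_
  have h6 := mul_le_mul_of_nonneg_left hsq (by positivity : 0 ≤ c.beta / q ^ 2)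
  have h8 : 0 ≤ 4 / q ^ 2 * (c.beta * c.D0 * c.gamma2 * p * (c.kg + c.kS * c.D0)) := by positivity
  have h9 : 0 ≤ 8 * c.beta / q ^ 4 * p * c.kg ^ 2 * c.gamma1 * c.gamma3 := by positivity
  have h10 : 0 ≤ 4 * c.beta / q ^ 7 * c.gamma1 ^ 2 * p * c.kg ^ 2 := by positivity
  have h11 : 0 ≤ 2 * ((c.beta + 1) / q ^ 2) * Δ := by positivity
  have h12 : 0 ≤ 2 * (1 / q ^ 2) * (c.nug * c.gamma3) := by positivity
  have h13 : 0 ≤ 2 * ((c.beta + 1) / q) * (c.nug * c.gamma1) := by positivity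
  have h14 : 0 ≤ 2 * (c.beta / q) * (p * c.kg ^ 2 * c.gamma4 σ) := by positivity
  have h15 := mul_le_mul_of_nonneg_left hkX (by positivity : 0 ≤ 4 * (c.beta / q))
  have h16 : 0 ≤ 2 * (c.beta / q) * c.kf ^ 2 := by positivity
  have e2 : 4 / q ^ 2 * ((c.beta + 1) * c.nug * c.gamma3
      + c.beta * c.D0 * c.gamma2 * p * (c.kg + c.kS * c.D0))
      = 4 * ((c.beta + 1) / q ^ 2) * (c.nug * c.gamma3)
        + 4 / q ^ 2 * (c.beta * c.D0 * c.gamma2 * p * (c.kg + c.kS * c.D0)) := by ring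
  have e3 : 4 / q * ((c.beta + 1) * c.nug * c.gamma1 + c.beta * (c.kf + X) ^ 2
      + c.beta * p * c.kg ^ 2 * c.gamma4 σ)
      = 4 * ((c.beta + 1) / q) * (c.nug * c.gamma1) + 4 * (c.beta / q) * (c.kf + X) ^ 2
        + 4 * (c.beta / q) * (p * c.kg ^ 2 * c.gamma4 σ) := by ring
  have e4 : 4 * (c.beta + 1) / q ^ 2 * Δ = 4 * ((c.beta + 1) / q ^ 2) * Δ := by ring
  have e5 : (c.beta + 1) / q ^ 2 = c.beta / q ^ 2 + 1 / q ^ 2 := by ring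
  rw [e2, e3, e4]
  rw [e5] at h11 ⊢
  generalize 4 / q ^ 2 * (c.beta * c.D0 * c.gamma2 * p * (c.kg + c.kS * c.D0)) = t8 at h8 ⊢
  generalize 8 * c.beta / q ^ 4 * p * c.kg ^ 2 * c.gamma1 * c.gamma3 = t9 at h9 ⊢
  generalize 4 * c.beta / q ^ 7 * c.gamma1 ^ 2 * p * c.kg ^ 2 = t10 at h10 ⊢
  generalize p * c.kg ^ 2 * c.gamma4 σ = t14 at h14 ⊢
  generalize (c.kf + X) ^ 2 = t15 at h15 ⊢
  generalize (c.beta + 1) / q = t13 at h13 ⊢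
  generalize c.beta / q = t at h14 h15 h16 ⊢
  have h17 : 0 ≤ c.beta / q ^ 2 * (c.nug * c.gamma3) := by positivity
  generalize c.beta / q ^ 2 = u at h6 h11 h17 ⊢
  generalize 1 / q ^ 2 = v at h11 h12 ⊢
  generalize c.nug * c.gamma3 = w at h6 h12 h17 ⊢
  generalize c.nug * c.gamma1 = w' at h13 ⊢
  linarith only [h6, h8, h9, h10, h11, h12, h13, h14, h15, h16, h17]

/-- The final estimate of the constraint violation, with `q = T^{1/4}`. -/
theorem Consts.Admissible.constraint_bound_le (hc : c.Admissible) {q σ : ℝ} (hq : 1 ≤ q)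
    (hσ : σ = (q ^ 3)⁻¹) (hσ1 : σ ≤ 1) :
    1 / q ^ 4 * (c.gamma3 / σ + q ^ 4 * ((c.kg + c.kS * c.D0 / 2) * (2 / (c.beta * q)
        * (c.kf + (c.gamma3 + σ * c.nug) * (√(p : ℝ) * (c.kg + c.kS * c.D0 / 2))))))
      ≤ c.gamma5 / q := by
  have hβ := zero_lt_one.trans hc.one_lt_beta
  have hq0 : 0 < q := zero_lt_one.trans_le hq
  have hκ : 0 ≤ c.kg + c.kS * c.D0 / 2 := by
    have := hc.kg_pos; have := hc.kS_pos; have := hc.D0_pos; positivity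
  set κ := c.kg + c.kS * c.D0 / 2 with hκdef
  have h1 : σ * c.nug ≤ c.nug := mul_le_of_le_one_left hc.nug_pos.le hσ1
  have h2 := mul_le_mul_of_nonneg_right h1 (by positivity : 0 ≤ √(p : ℝ) * κ)
  have h3 : κ * (2 / (c.beta * q) * (c.kf + (c.gamma3 + σ * c.nug) * (√(p : ℝ) * κ)))
      ≤ κ * (2 / (c.beta * q) * (c.kf + (c.gamma3 + c.nug) * (√(p : ℝ) * κ))) :=
    mul_le_mul_of_nonneg_left (mul_le_mul_of_nonneg_left (by linarith) (by positivity)) hκ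
  have e1 : 1 / q ^ 4 * (c.gamma3 / σ + q ^ 4 * (κ * (2 / (c.beta * q)
        * (c.kf + (c.gamma3 + σ * c.nug) * (√(p : ℝ) * κ)))))
      = c.gamma3 / q
        + κ * (2 / (c.beta * q) * (c.kf + (c.gamma3 + σ * c.nug) * (√(p : ℝ) * κ))) := by
    rw [mul_add, ← mul_assoc (1 / q ^ 4) (q ^ 4), one_div_mul_cancel (by positivity), one_mul]
    congr 1
    rw [hσ]; field_simp
  rw [e1]
  refine (add_le_add le_rfl h3).trans (le_of_eq ?_)
  have e2 : 2 * c.kg + c.kS * c.D0 = 2 * κ := by rw [hκdef]; ring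
  rw [gamma5, rho1, rho2, e2]
  field_simp
  ring

end Parameters

end PMQS

/-! ### Assembly with the prescribed parameters. -/

theorem theorem3p2 {n p : ℕ} (hp : 1 ≤ p) {Ω Ξ : Type*} [MeasurableSpace Ω] [MeasurableSpace Ξ]
    (μ : Measure Ω) [IsProbabilityMeasure μ] (P : Measure Ξ) [IsProbabilityMeasure P]
    (Q : Problem n p Ξ) (c : Consts p) (hQ : Assumptions Q P c)
    (ξ : ℕ → Ω → Ξ) (hξ : IsIIDSample ξ P μ)
    -- the number of iterations and the parameters `σ`, `α`, `τ`
    (T : ℕ) (sigma alpha tau : ℝ)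
    (hsigma : sigma = (T : ℝ) ^ (-(3 / 4) : ℝ))
    (halpha : alpha = c.beta * (T : ℝ) ^ (1 / 4 : ℝ))
    (htau : tau = (T : ℝ) ^ (1 / 2 : ℝ))
    (hT : max (c.beta ^ 2)
        (max (c.beta⁻¹ * p * (c.kg + c.kS * c.D0 / 2) ^ 2) ((c.kS * c.gamma2) ^ 4)) < (T : ℝ))
    -- the matrices `Σᵢᵗ`: `Σᵢᵗ ⪯ -Lᵢ I` and `‖Σᵢᵗ‖ ≤ κ_Σ`
    (Sig : ℕ → Fin p → Ω → Matrix (Fin n) (Fin n) ℝ)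
    (hSig_le : ∀ t, 1 ≤ t → t ≤ T → ∀ i ω,
      (-(c.L i • (1 : Matrix (Fin n) (Fin n) ℝ)) - Sig t i ω).PosSemidef)
    (hSig_norm : ∀ t, 1 ≤ t → t ≤ T → ∀ i ω,
      ‖Matrix.toEuclideanCLM (𝕜 := ℝ) (Sig t i ω)‖ ≤ c.kS)
    (hkS_pos : 0 < c.kS)
    (hkS : √(p : ℝ) * c.kS * c.D0 ^ 2 ≤ c.eps0)
    -- the iterates
    (x1 : E n) (hx1 : x1 ∈ Q.X0) (x : ℕ → Ω → E n) (lam : ℕ → Ω → E p)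
    (hrun : IsPMQSopt Q sigma alpha tau T ξ Sig x1 x lam) :
    -- (i) Moreau envelope of the Lagrangian
    ((∀ t ∈ Finset.Icc 1 T, ∀ ω, DifferentiableAt ℝ
          (moreauEnvelope Q.X0 (fun y => Q.lagrangian P y (lam t ω)) (1 / alpha)) (x t ω)) ∧
      (∀ t ∈ Finset.Icc 1 T, Integrable (fun ω => ‖gradient
          (moreauEnvelope Q.X0 (fun y => Q.lagrangian P y (lam t ω)) (1 / alpha))
            (x t ω)‖ ^ 2) μ) ∧
      BddBelow (Q.f P '' Q.X0) ∧
      1 / (T : ℝ) * ∫ ω, ∑ t ∈ Finset.Icc 1 T, ‖gradient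
          (moreauEnvelope Q.X0 (fun y => Q.lagrangian P y (lam t ω)) (1 / alpha))
            (x t ω)‖ ^ 2 ∂μ
        ≤ 4 * (c.beta + 1) / (T : ℝ) ^ (1 / 2 : ℝ) * (Q.f P x1 - sInf (Q.f P '' Q.X0))
          + 4 / (T : ℝ) ^ (1 / 2 : ℝ) * ((c.beta + 1) * c.nug * c.gamma3
              + c.beta * c.D0 * c.gamma2 * p * (c.kg + c.kS * c.D0))
          + 4 / (T : ℝ) ^ (1 / 4 : ℝ) * ((c.beta + 1) * c.nug * c.gamma1
              + c.beta * (c.kf + c.gamma2 * p * (c.kg + c.kS * c.D0)) ^ 2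
              + c.beta * p * c.kg ^ 2 * c.gamma4 sigma)
          + 8 * c.beta / (T : ℝ) * p * c.kg ^ 2 * c.gamma1 * c.gamma3
          + 4 * c.beta / (T : ℝ) ^ (7 / 4 : ℝ) * c.gamma1 ^ 2 * p * c.kg ^ 2) ∧
    -- (ii) constraint violation
    (∀ i, (∀ t ∈ Finset.Icc 1 T, Integrable (fun ω => Q.G i (x t ω) (ξ t ω)) μ) ∧
      (∀ t ∈ Finset.Icc 1 T, Integrable (fun ω => Q.g P i (x t ω)) μ) ∧
      1 / (T : ℝ) * ∫ ω, ∑ t ∈ Finset.Icc 1 T, Q.G i (x t ω) (ξ t ω) ∂μ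
        ≤ c.gamma5 / (T : ℝ) ^ (1 / 4 : ℝ) ∧
      1 / (T : ℝ) * ∫ ω, ∑ t ∈ Finset.Icc 1 T, Q.g P i (x t ω) ∂μ
        ≤ c.gamma5 / (T : ℝ) ^ (1 / 4 : ℝ)) ∧
    -- (iii) complementarity violation
    ((∀ t ∈ Finset.Icc 1 T,
        Integrable (fun ω => ∑ i, lam t ω i * Q.g P i (x t ω)) μ) ∧
      -(1 / (T : ℝ)) * ∫ ω, ∑ t ∈ Finset.Icc 1 T, ∑ i, lam t ω i * Q.g P i (x t ω) ∂μ
        ≤ c.nug ^ 2 / (2 * (T : ℝ) ^ (3 / 4 : ℝ))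
          + c.kf ^ 2 / (2 * c.beta * (T : ℝ) ^ (1 / 4 : ℝ))) := by
  have hc := hQ.admissible hp hkS_pos hkS
  have hβ := hc.one_lt_beta
  have hβ0 := zero_lt_one.trans hβ
  have hTβ : c.beta ^ 2 < (T : ℝ) := (le_max_left _ _).trans_lt hT
  have hT1 : 1 < (T : ℝ) := by nlinarith
  have hT2 : (2 : ℝ) ≤ T := by
    have : 1 < T := by exact_mod_cast hT1
    exact_mod_cast this
  have hT0 : 0 < (T : ℝ) := by linarith
  set q : ℝ := (T : ℝ) ^ (1 / 4 : ℝ) with hq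
  have hq0 : 0 < q := Real.rpow_pos_of_pos hT0 _
  have hpow : ∀ k : ℕ, (T : ℝ) ^ ((k : ℝ) / 4) = q ^ k := by
    intro k
    rw [hq, ← Real.rpow_natCast, ← Real.rpow_mul hT0.le]
    congr 1; ring
  have hT4 : (T : ℝ) = q ^ 4 := by have := hpow 4; norm_num at this; exact this
  have hq2 : (T : ℝ) ^ (1 / 2 : ℝ) = q ^ 2 := by
    have := hpow 2; norm_num at this ⊢; exact this
  have hq3 : (T : ℝ) ^ (3 / 4 : ℝ) = q ^ 3 := by have := hpow 3; norm_num at this ⊢; exact this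
  have hq7 : (T : ℝ) ^ (7 / 4 : ℝ) = q ^ 7 := by have := hpow 7; norm_num at this ⊢; exact this
  have hq1 : 1 ≤ q := Real.one_le_rpow hT1.le (by norm_num)
  have hσ : sigma = (q ^ 3)⁻¹ := by rw [hsigma, Real.rpow_neg hT0.le, hq3]
  have hσ0 : 0 < sigma := by rw [hσ]; positivity
  -- β > 1 forces T ≥ 2, and (5/3)⁴ ≤ 2³.
  have hσ1 : sigma ≤ 3 / 5 := by
    have h1 : 5 / 3 ≤ q ^ 3 := by
      refine le_of_pow_le_pow_left₀ (n := 4) (by norm_num) (by positivity) ?_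
      have h2 : (q ^ 3) ^ 4 = (T : ℝ) ^ 3 := by rw [hT4]; ring
      rw [h2]
      have := pow_le_pow_left₀ (by norm_num : (0 : ℝ) ≤ 2) hT2 3
      norm_num at this ⊢
      linarith
    rw [hσ, inv_le_comm₀ (by positivity) (by norm_num)]
    norm_num
    exact h1
  have hα0 : 0 < alpha := by rw [halpha]; positivity
  have hτ : tau = q ^ 2 := by rw [htau, hq2]
  -- The product is 1/q + β/q², and T > β² means β < q².
  have hK : sigma * (tau + alpha) ≤ 2 := by
    have h1 : c.beta ≤ q ^ 2 := by
      refine le_of_sq_le_sq ?_ (by positivity)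
      have : (q ^ 2) ^ 2 = (T : ℝ) := by rw [hT4]; ring
      rw [this]; exact hTβ.le
    rw [hσ, hτ, halpha, inv_mul_le_iff₀ (by positivity)]
    nlinarith [mul_le_mul_of_nonneg_right h1 hq0.le,
      mul_le_mul_of_nonneg_right hq1 (sq_nonneg q)]
  have hR := hrun.isBoundedRun hQ hξ hc hσ0 hα0 (by rw [hτ]; positivity) hx1 hSig_le hSig_norm
  -- Since Tσ = q, each multiplier is at most qγ₂, and α/2 = q(L₀ + ∑γ₂Lⱼ) + q/2 by the definition
  -- of β.
  have hρ : ∀ t < T, ∀ ω, c.L0 + ∑ i, lam (t + 1) ω i * c.L i ≤ alpha / 2 := by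
    intro t ht ω
    have h1 : ∀ i, lam (t + 1) ω i ≤ q * c.gamma2 := by
      intro i
      refine (hR.lam_le ht.le ω i).trans ?_
      rw [← mul_assoc]
      refine mul_le_mul_of_nonneg_right ?_ (IsStep.gamma2_nonneg hc)
      calc (t : ℝ) * sigma ≤ T * sigma :=
            mul_le_mul_of_nonneg_right (by exact_mod_cast ht.le) hσ0.le
        _ = q := by rw [hσ, hT4]; field_simp
    have h2 : ∑ i, lam (t + 1) ω i * c.L i ≤ q * ∑ i, c.gamma2 * c.L i := by
      rw [Finset.mul_sum]
      refine Finset.sum_le_sum fun i _ => ?_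
      rw [← mul_assoc]
      exact mul_le_mul_of_nonneg_right (h1 i) (hc.L_pos i).le
    have h3 : c.L0 ≤ q * c.L0 := le_mul_of_one_le_left hc.L0_pos.le hq1
    have h4 : alpha / 2 = q * (c.L0 + ∑ i, c.gamma2 * c.L i) + q / 2 := by
      rw [halpha, Consts.beta]; ring
    rw [h4]
    linarith
  obtain ⟨xt, hxt⟩ := hR.exists_prox hρ
  have hgrad : ∀ t < T, ∀ ω, HasGradientAt
      (moreauEnvelope Q.X0 (fun y => Q.lagrangian P y (lam (t + 1) ω)) (1 / alpha))
      (alpha • (x (t + 1) ω - xt t ω)) (x (t + 1) ω) := fun t ht ω =>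
    ((hxt t ht).1 ω).hasGradientAt hα0
      (hQ.weaklyConvexOn_lagrangian (hR.lam_nonneg ht.le ω)) (hρ t ht ω)
      (hQ.exists_isProx (lam (t + 1) ω) alpha)
  have hnorm : ∀ t < T, ∀ ω, ‖gradient
      (moreauEnvelope Q.X0 (fun y => Q.lagrangian P y (lam (t + 1) ω)) (1 / alpha))
        (x (t + 1) ω)‖ ^ 2 = alpha ^ 2 * ‖xt t ω - x (t + 1) ω‖ ^ 2 := by
    intro t ht ω
    rw [(hgrad t ht ω).gradient, norm_smul, mul_pow, Real.norm_eq_abs, sq_abs, norm_sub_rev]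
  obtain ⟨hprox_int, hprox⟩ := hR.integral_prox_sq_le hσ1 hK hρ hxt
  have hIcc : ∀ t ∈ Finset.Icc 1 T, ∃ k < T, t = k + 1 := by
    intro t ht
    rw [Finset.mem_Icc] at ht
    exact ⟨t - 1, by omega, by omega⟩
  have hinv : (0 : ℝ) ≤ 1 / T := by positivity
  refine ⟨⟨?_, ?_, hQ.bddBelow_f, ?_⟩, fun i => ⟨?_, ?_, ?_, ?_⟩, ?_, ?_⟩
  · intro t ht ω
    obtain ⟨k, hk, rfl⟩ := hIcc t ht
    exact (hgrad k hk ω).differentiableAt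
  · intro t ht
    obtain ⟨k, hk, rfl⟩ := hIcc t ht
    simp only [hnorm k hk]
    exact hprox_int k hk
  · have hsum : ∀ ω, ∑ t ∈ Finset.Icc 1 T, ‖gradient
        (moreauEnvelope Q.X0 (fun y => Q.lagrangian P y (lam t ω)) (1 / alpha)) (x t ω)‖ ^ 2
        = ∑ t ∈ Finset.range T, alpha ^ 2 * ‖xt t ω - x (t + 1) ω‖ ^ 2 := by
      intro ω
      rw [sum_Icc_one_eq_sum_range]
      exact Finset.sum_congr rfl fun t ht => hnorm t (Finset.mem_range.1 ht) ω
    simp only [hsum]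
    refine (mul_le_mul_of_nonneg_left hprox hinv).trans ?_
    rw [hq2, hq7, halpha, hτ, hT4]
    have hΔ : 0 ≤ Q.f P x1 - sInf (Q.f P '' Q.X0) :=
      sub_nonneg.2 (csInf_le hQ.bddBelow_f (Set.mem_image_of_mem _ hx1))
    refine hc.envelope_bound_le hq1 hΔ hσ0 hσ ?_
    have := IsStep.gamma2_nonneg hc
    have := hc.kg_pos
    have := hc.kS_pos
    have := hc.D0_pos
    positivity
  · intro t ht
    obtain ⟨k, hk, rfl⟩ := hIcc t ht
    exact (hR.integral_G hk.le i).1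
  · intro t ht
    obtain ⟨k, hk, rfl⟩ := hIcc t ht
    exact (hR.integral_G hk.le i).2.1
  · simp only [sum_Icc_one_eq_sum_range]
    refine (mul_le_mul_of_nonneg_left (hR.constraint_le hσ1 hK i) hinv).trans ?_
    rw [halpha, hT4]
    exact hc.constraint_bound_le hq1 hσ (by linarith)
  · simp only [sum_Icc_one_eq_sum_range]
    rw [← hR.integral_sum_G i]
    refine (mul_le_mul_of_nonneg_left (hR.constraint_le hσ1 hK i) hinv).trans ?_
    rw [halpha, hT4]
    exact hc.constraint_bound_le hq1 hσ (by linarith)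
  · intro t ht
    obtain ⟨k, hk, rfl⟩ := hIcc t ht
    exact (hR.integral_sum_mul_G hk.le).2.1
  · simp only [sum_Icc_one_eq_sum_range]
    rw [neg_mul, ← mul_neg]
    refine (mul_le_mul_of_nonneg_left hR.complementarity_le hinv).trans (le_of_eq ?_)
    rw [hq3, ← mul_assoc, one_div_mul_cancel hT0.ne', one_mul, hσ, halpha]
    field_simp
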